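/- Let $d\ge 1$ and consider the completely unknown pure state on $\mathbb C^d$: let $\theta\mapsto\rho(\theta)$ be any continuously differentiable parametrization, by $\theta$ in an open set $\Theta\subseteq\mathbb R^{2(d-1)}$, of pure states (density matrices with $\rho^2=\rho$) whose partial derivatives $\partial_1\rho,\dots,\partial_{2(d-1)}\rho$ are linearly independent over $\mathbb R$ at each point. Let $\mathrm{Fid}(\sigma,\rho)=(\operatorname{trace}\sqrt{\rho^{1/2}\sigma\rho^{1/2}})^2$. At every $\theta\in\Theta$ there is a unique real symmetric matrix $H=H(\theta)$ (the Helstrom information) with $$1-\mathrm{Fid}(\rho(\theta'),\rho(\theta))=\tfrac14(\theta'-\theta)^\top H(\theta'-\theta)+o(\|\theta'-\theta\|^2),\qquad \theta'\to\theta,$$ and $H$ is positive definite. For a real symmetric $G$ let the Holevo bound be $\mathcal C_G(\theta)=\inf\operatorname{trace}(GV)$, the infimum over all self-adjoint $d\times d$ matrices $X_1,\dots,X_{2(d-1)}$ with $\frac{\partial}{\partial\theta_i}\operatorname{trace}(\rho(\theta)X_j)=\delta_{ij}$ and all real symmetric $V\ge Z(X)$, where $Z(X)_{ij}=\operatorname{trace}(\rho(\theta)X_iX_j)$.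 For a measurement (POVM) $M$ on $N\ge1$ copies, with outcomes in any measurable space, let $\overline I_M(\theta)$ be $1/N$ times the Fisher information matrix at $\theta$ of the distribution $B\mapsto\operatorname{trace}(\rho(\theta)^{\otimes N}M(B))$ of its outcome. $M$ is exhaustive if its density with respect to the measure $\operatorname{trace}M(\cdot)$ has rank one almost everywhere. $M$ is covariant if the unitary group $U(d)$ acts by measurable maps on its outcome space and $M(gB)=g^{\otimes N}M(B)(g^{\otimes N})^*$ for all $g\in U(d)$ and all measurable $B$. Then: 1. $\mathcal C_{\frac14H}(\theta)=d-1$. 2. $\operatorname{trace}\bigl(\tfrac14H\,\overline I_M^{-1}\bigr)\ge\mathcal C_{\frac14H}(\theta)$ for every $N\ge1$ and every measurement $M$ on $N$ copies with $\overline I_M(\theta)$ non-singular. 3. Every exhaustive covariant measurement $M$ on $N\ge 1$ copies has $\overline I_M(\theta)=\tfrac12H(\theta)$ and attains the bound: $\operatorname{trace}\bigl(\tfrac14H\,\overline I_M^{-1}\bigr)=\mathcal C_{\frac14H}(\theta)$. 4. In particular this holds for standard tomography, where for each of the $N$ copies independently a uniformly (Haar) distributed orthonormal basis of $\mathbb C^d$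 is chosen, the copy is measured in that basis, and the bases and the observed indices are recorded; this measurement is exhaustive, and covariant for the action of $U(d)$ that rotates all the bases. Moreover, let $\pi$ be a prior probability distribution on the set of all pure states on $\mathbb C^d$ that has a continuous density with respect to the unitarily invariant probability distribution. For each $N$ let $M^{(N)}$ be an arbitrary measurement on $N$ copies and let $\widehat\rho^{(N)}$ be an arbitrary estimator, a measurable function of its outcome with values in the pure states. Then $$\liminf_{N\to\infty}\,N\Bigl(1-\mathbb E_\pi\,\mathbb E_\rho\,\mathrm{Fid}(\widehat\rho^{(N)},\rho)\Bigr)\ \ge\ d-1 .$$ In particular this holds for the uniform prior. -/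

import Mathlib

open scoped Matrix ComplexOrder

universe u

noncomputable section

namespace QuantumEstimation

open MeasureTheory

/-! ### States -/

/-- Pure states of a `d`-dimensional system: density matrices (non-negative, trace one) with
`ρ² = ρ`. -/
def IsPureState {d : ℕ} (ρ : Matrix (Fin d) (Fin d) ℂ) : Prop :=
  ρ.PosSemidef ∧ ρ.trace = 1 ∧ ρ * ρ = ρ

/-- The space of all pure states on `ℂ^d`, with the topology inherited from the matrices. -/
abbrev PureState (d : ℕ) : Type := {ρ : Matrix (Fin d) (Fin d) ℂ // IsPureState ρ}

instance (d : ℕ) : MeasurableSpace (PureState d) := borel _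

instance (d : ℕ) : BorelSpace (PureState d) := ⟨rfl⟩

open scoped MatrixOrder in
/-- Fidelity of two states, `(trace √(ρ^{1/2} σ ρ^{1/2}))²`. -/
def fidelity {d : ℕ} (σ ρ : Matrix (Fin d) (Fin d) ℂ) : ℝ :=
  (CFC.sqrt (CFC.sqrt ρ * σ * CFC.sqrt ρ)).trace.re ^ 2

open scoped MatrixOrder in
theorem exists_conjTranspose_mul_self {ι : Type*} [Fintype ι] {A : Matrix ι ι ℂ}
    (hA : A.PosSemidef) : ∃ C : Matrix ι ι ℂ, A = Cᴴ * C := by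
  classical
  refine ⟨CFC.sqrt A, ?_⟩
  have h1 : (CFC.sqrt A).PosSemidef := Matrix.nonneg_iff_posSemidef.1 (CFC.sqrt_nonneg A)
  rw [h1.1.eq, CFC.sqrt_mul_sqrt_self A hA.nonneg]

/-- The tensor product `A 0 ⊗ ⋯ ⊗ A (N-1)`, a matrix on `(ℂ^d)^{⊗N}`; this space has the product
basis indexed by `Fin N → Fin d`. -/
def tensorProd {d N : ℕ} (A : Fin N → Matrix (Fin d) (Fin d) ℂ) :
    Matrix (Fin N → Fin d) (Fin N → Fin d) ℂ :=
  Matrix.of fun I J => ∏ k, A k (I k) (J k)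

/-- The `N`-fold tensor power `A^{⊗N}`. -/
def tensorPower {d : ℕ} (N : ℕ) (A : Matrix (Fin d) (Fin d) ℂ) :
    Matrix (Fin N → Fin d) (Fin N → Fin d) ℂ :=
  tensorProd fun _ => A

theorem tensorProd_mul {d N : ℕ} (A B : Fin N → Matrix (Fin d) (Fin d) ℂ) :
    tensorProd A * tensorProd B = tensorProd fun k => A k * B k := by
  ext I J
  simp only [tensorProd, Matrix.mul_apply, Matrix.of_apply]
  rw [Finset.prod_univ_sum, Fintype.piFinset_univ]
  simp only [Finset.prod_mul_distrib]

theorem tensorProd_conjTranspose {d N : ℕ} (A : Fin N → Matrix (Fin d) (Fin d) ℂ) :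
    (tensorProd A)ᴴ = tensorProd fun k => (A k)ᴴ := by
  ext I J
  simp [tensorProd, Matrix.conjTranspose_apply]

theorem tensorProd_posSemidef {d N : ℕ} {A : Fin N → Matrix (Fin d) (Fin d) ℂ}
    (hA : ∀ k, (A k).PosSemidef) : (tensorProd A).PosSemidef := by
  choose B hB using fun k => exists_conjTranspose_mul_self (hA k)
  have h : tensorProd A = (tensorProd B)ᴴ * tensorProd B := by
    rw [tensorProd_conjTranspose, tensorProd_mul]
    congr 1
    funext k
    exact hB k
  rw [h]
  exact Matrix.posSemidef_conjTranspose_mul_self _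

theorem tensorPower_posSemidef {d N : ℕ} {A : Matrix (Fin d) (Fin d) ℂ}
    (hA : A.PosSemidef) : (tensorPower N A).PosSemidef :=
  tensorProd_posSemidef fun _ => hA

/-! ### Measurements -/

/-- A measurement with outcome space `X` on the Hilbert space `ℂ^ι`: a positive operator valued
measure, i.e. a σ-additive map from the measurable sets to the non-negative matrices, with total
mass `1`. (A `VectorMeasure` takes the value `0` on non-measurable sets.) -/
structure POVM (X : Type*) [MeasurableSpace X] (ι : Type*) [Fintype ι] [DecidableEq ι] where
  toVectorMeasure : VectorMeasure X (Matrix ι ι ℂ)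
  posSemidef : ∀ B, (toVectorMeasure B).PosSemidef
  univ_eq_one : toVectorMeasure Set.univ = 1

namespace POVM

theorem trace_mul_re_nonneg {ι : Type*} [Fintype ι] {A B : Matrix ι ι ℂ} (hA : A.PosSemidef) (hB : B.PosSemidef) :
    0 ≤ (A * B).trace.re := by
  obtain ⟨C, rfl⟩ := exists_conjTranspose_mul_self hA
  rw [Matrix.mul_assoc, Matrix.trace_mul_comm]
  exact (Complex.le_def.1 (hB.mul_mul_conjTranspose_same C).trace_nonneg).1

open Classical in
/-- The matrix-valued measure `B ↦ ∫_B m dμ`, for an integrable density `m`. -/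
def integralMeasure {X ι : Type*} [MeasurableSpace X] (μ : Measure X) (m : X → Matrix ι ι ℂ)
    (hint : ∀ i j, Integrable (fun x => m x i j) μ) : VectorMeasure X (Matrix ι ι ℂ) where
  measureOf' := fun B =>
    if MeasurableSet B then Matrix.of fun i j => ∫ x in B, m x i j ∂μ else 0
  empty' := by ext; simp
  not_measurable' := fun B hB => if_neg hB
  m_iUnion' := by
    intro B hB hd
    rw [if_pos (MeasurableSet.iUnion hB)]
    simp only [if_pos (hB _)]
    refine Pi.hasSum.2 fun i => Pi.hasSum.2 fun j => ?_
    exact hasSum_integral_iUnion hB hd (hint i j).integrableOn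

theorem integralMeasure_apply {X ι : Type*} [MeasurableSpace X] (μ : Measure X) (m : X → Matrix ι ι ℂ)
    (hint : ∀ i j, Integrable (fun x => m x i j) μ) {B : Set X} (hB : MeasurableSet B) :
    integralMeasure μ m hint B = Matrix.of fun i j => ∫ x in B, m x i j ∂μ :=
  if_pos hB

variable {X : Type*} [MeasurableSpace X] {ι : Type*} [Fintype ι] [DecidableEq ι]

/-- The measure `B ↦ trace (ρ M(B))`. If `ρ` is a state, this is the probability distribution of
the outcome of `M`. -/
def law (M : POVM X ι) (ρ : Matrix ι ι ℂ) (hρ : ρ.PosSemidef) : Measure X :=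
  Measure.ofMeasurable (fun B _ => ENNReal.ofReal (ρ * M.toVectorMeasure B).trace.re)
    (by simp)
    (by
      intro B hB hd
      have hs : HasSum (fun n => (ρ * M.toVectorMeasure (B n)).trace.re)
          (ρ * M.toVectorMeasure (⋃ n, B n)).trace.re := by
        have h := M.toVectorMeasure.m_iUnion hB hd
        let g : Matrix ι ι ℂ →+ ℝ :=
          { toFun := fun A => (ρ * A).trace.re
            map_zero' := by simp
            map_add' := fun A A' => by simp [Matrix.mul_add, Matrix.trace_add] }
        have hg : Continuous g := by
          change Continuous fun A : Matrix ι ι ℂ => (ρ * A).trace.re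
          exact Complex.continuous_re.comp
            (Continuous.matrix_trace (Continuous.matrix_mul continuous_const continuous_id))
        exact h.map g hg
      rw [← hs.tsum_eq]
      exact ENNReal.ofReal_tsum_of_nonneg
        (fun n => trace_mul_re_nonneg hρ (M.posSemidef _)) hs.summable)

/-- The real measure `B ↦ trace M(B)`. -/
def traceMeasure (M : POVM X ι) : Measure X := M.law 1 Matrix.PosSemidef.one

/-- The complex measure `B ↦ M(B)_{ij}`. -/
def entry (M : POVM X ι) (i j : ι) : ComplexMeasure X :=
  M.toVectorMeasure.mapRange (Matrix.entryAddMonoidHom ℂ i j)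
    (by exact continuous_id.matrix_elem i j)

/-- The density of the matrix-valued measure `M` with respect to the measure `trace M(·)`. -/
def density (M : POVM X ι) (x : X) : Matrix ι ι ℂ :=
  Matrix.of fun i j => (M.entry i j).rnDeriv M.traceMeasure x

/-- A measurement is exhaustive if its density has rank one almost everywhere. -/
def IsExhaustive (M : POVM X ι) : Prop :=
  ∀ᵐ x ∂M.traceMeasure, (M.density x).rank = 1

/-- The POVM `B ↦ ∫_B m dμ` with density `m` with respect to `μ`. -/
def ofDensity (μ : Measure X) (m : X → Matrix ι ι ℂ) (hm : ∀ x, (m x).PosSemidef)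
    (hint : ∀ i j, Integrable (fun x => m x i j) μ)
    (htot : ∀ i j, ∫ x, m x i j ∂μ = (1 : Matrix ι ι ℂ) i j) : POVM X ι where
  toVectorMeasure := integralMeasure μ m hint
  posSemidef := by
    intro B
    by_cases hB : MeasurableSet B
    · rw [integralMeasure_apply μ m hint hB]
      refine Matrix.PosSemidef.of_dotProduct_mulVec_nonneg ?_ ?_
      · ext i j
        simp only [Matrix.conjTranspose_apply, Matrix.of_apply]
        rw [Complex.star_def, ← integral_conj]
        refine integral_congr_ae (Filter.Eventually.of_forall fun x => ?_)
        exact (hm x).1.apply i j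
      · intro v
        have h : star v ⬝ᵥ ((Matrix.of fun i j => ∫ x in B, m x i j ∂μ) *ᵥ v)
            = ∫ x in B, star v ⬝ᵥ (m x *ᵥ v) ∂μ := by
          simp only [dotProduct, Matrix.mulVec, Matrix.of_apply]
          rw [integral_finsetSum]
          · refine Finset.sum_congr rfl fun i _ => ?_
            rw [integral_const_mul, integral_finsetSum]
            · simp only [integral_mul_const]
            · exact fun j _ => (hint i j).integrableOn.mul_const _
          · exact fun i _ => (integrable_finsetSum _ fun j _ =>
              (hint i j).integrableOn.mul_const _).const_mul _
        rw [h]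
        exact integral_nonneg fun x => (hm x).dotProduct_mulVec_nonneg v
    · rw [VectorMeasure.not_measurable _ hB]
      exact Matrix.PosSemidef.zero
  univ_eq_one := by
    rw [integralMeasure_apply μ m hint MeasurableSet.univ]
    ext i j
    simpa using htot i j

end POVM

/-! ### The unitary group, covariance, and standard tomography -/

/-- The unitary group of `ℂ^d`. -/
abbrev U (d : ℕ) : Type := Matrix.unitaryGroup (Fin d) ℂ

instance (d : ℕ) : MeasurableSpace (U d) := borel _

instance (d : ℕ) : BorelSpace (U d) := ⟨rfl⟩

instance (d : ℕ) : CompactSpace (U d) := by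
  apply isCompact_iff_compactSpace.1
  have hK : IsCompact (Set.univ.pi fun _ : Fin d => Set.univ.pi fun _ : Fin d =>
      Metric.closedBall (0 : ℂ) 1) :=
    isCompact_univ_pi fun _ => isCompact_univ_pi fun _ => isCompact_closedBall 0 1
  have hcl : IsClosed ((Matrix.unitaryGroup (Fin d) ℂ : Submonoid (Matrix (Fin d) (Fin d) ℂ)) :
      Set (Matrix (Fin d) (Fin d) ℂ)) := by
    have : ((Matrix.unitaryGroup (Fin d) ℂ : Submonoid (Matrix (Fin d) (Fin d) ℂ)) :
      Set (Matrix (Fin d) (Fin d) ℂ)) = {A | A * star A = 1} := by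
      ext A
      exact Matrix.mem_unitaryGroup_iff
    rw [this]
    exact isClosed_eq (Continuous.matrix_mul continuous_id continuous_star) continuous_const
  refine IsCompact.of_isClosed_subset hK hcl fun A hA => ?_
  refine fun i _ j _ => ?_
  simpa using entry_norm_bound_of_unitary hA i j

/-- The uniform distribution on the unitary group: normalized Haar measure. -/
def haarU (d : ℕ) : Measure (U d) := Measure.haarMeasure ⊤

instance (d : ℕ) : IsProbabilityMeasure (haarU d) :=
  ⟨by simpa [haarU] using Measure.haarMeasure_self (K₀ := (⊤ : TopologicalSpace.PositiveCompacts (U d)))⟩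

/-- A measurement `M` on `N` copies is covariant, with respect to a measurable action of the
unitary group on its outcome space, if transforming the state of each copy by `g`, doing the
measurement, and transforming the outcome back by `g⁻¹`, is the same measurement as `M`.
In formulas: `M(B) = U_g^{⊗N} M(g⁻¹ B) (U_g^{⊗N})*`. -/
def IsCovariant {d N : ℕ} {X : Type*} [MeasurableSpace X] (act : U d →* Equiv.Perm X)
    (M : POVM X (Fin N → Fin d)) : Prop :=
  (∀ g, Measurable (act g)) ∧
  ∀ (g : U d) (B : Set X), MeasurableSet B →
    M.toVectorMeasure B = tensorPower N (g : Matrix (Fin d) (Fin d) ℂ) *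
      M.toVectorMeasure (act g ⁻¹' B) * (tensorPower N (g : Matrix (Fin d) (Fin d) ℂ))ᴴ

/-- The projector `|u_i⟩⟨u_i|` on the `i`-th vector of the orthonormal basis formed by the columns
of the unitary matrix `u`. -/
def basisProjector {d : ℕ} (u : U d) (i : Fin d) : Matrix (Fin d) (Fin d) ℂ :=
  Matrix.vecMulVec ((u : Matrix (Fin d) (Fin d) ℂ).col i)
    (star ((u : Matrix (Fin d) (Fin d) ℂ).col i))

/-- The outcome of standard tomography: for each of the `N` copies, the chosen orthonormal basis
and the index of the basis vector that was observed. -/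
abbrev TomographyOutcome (d N : ℕ) : Type := Fin N → U d × Fin d

/-- The uniform choice of a basis, together with counting measure on its index set. -/
def basisMeasure (d : ℕ) : Measure (U d × Fin d) := (haarU d).prod Measure.count

theorem sum_basisProjector {d : ℕ} (u : U d) : ∑ i, basisProjector u i = 1 := by
  have h := Matrix.mem_unitaryGroup_iff.1 u.2
  rw [← h]
  ext a b
  simp [basisProjector, Matrix.sum_apply, Matrix.mul_apply, Matrix.vecMulVec_apply,
    Matrix.star_apply]

theorem basisProjector_isPureState {d : ℕ} (u : U d) (i : Fin d) :
    IsPureState (basisProjector u i) := by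
  have h := congrFun (congrFun (Matrix.mem_unitaryGroup_iff'.1 u.2) i) i
  have h1 : star ((u : Matrix (Fin d) (Fin d) ℂ).col i) ⬝ᵥ
      ((u : Matrix (Fin d) (Fin d) ℂ).col i) = 1 := by
    simpa [Matrix.mul_apply, Matrix.star_apply, dotProduct] using h
  refine ⟨Matrix.posSemidef_vecMulVec_self_star _, ?_, ?_⟩
  · rw [basisProjector, Matrix.trace_vecMulVec, dotProduct_comm, h1]
  · rw [basisProjector, Matrix.vecMulVec_mul_vecMulVec, h1, one_smul]

theorem continuous_basisProjector {d : ℕ} (i : Fin d) :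
    Continuous fun u : U d => basisProjector u i := by
  refine continuous_matrix fun a b => ?_
  have hc : ∀ c : Fin d, Continuous fun u : U d => (u : Matrix (Fin d) (Fin d) ℂ) c i :=
    fun c => continuous_subtype_val.matrix_elem c i
  exact (hc a).mul (hc b).star

theorem norm_basisProjector_le {d : ℕ} (u : U d) (i a b : Fin d) :
    ‖basisProjector u i a b‖ ≤ 1 := by
  simp only [basisProjector, Matrix.vecMulVec_apply, norm_mul, Pi.star_apply, norm_star]
  exact mul_le_one₀ (entry_norm_bound_of_unitary u.2 a i) (norm_nonneg _)
    (entry_norm_bound_of_unitary u.2 b i)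

theorem measurable_basisProjector {d : ℕ} (a b : Fin d) :
    Measurable fun y : U d × Fin d => basisProjector y.1 y.2 a b :=
  measurable_from_prod_countable_left fun i =>
    ((continuous_basisProjector i).matrix_elem a b).measurable

instance (d : ℕ) : IsFiniteMeasure (basisMeasure d) := by
  unfold basisMeasure
  infer_instance

theorem integral_basisProjector {d : ℕ} (a b : Fin d) :
    ∫ y, basisProjector y.1 y.2 a b ∂basisMeasure d = (1 : Matrix (Fin d) (Fin d) ℂ) a b := by
  have hi : Integrable (fun y : U d × Fin d => basisProjector y.1 y.2 a b)
      ((haarU d).prod Measure.count) :=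
    Integrable.of_bound (measurable_basisProjector a b).aestronglyMeasurable 1
      (Filter.Eventually.of_forall fun y => norm_basisProjector_le _ _ _ _)
  rw [basisMeasure, integral_prod _ hi]
  have h : ∀ u : U d, ∫ i, basisProjector u i a b ∂Measure.count
      = (1 : Matrix (Fin d) (Fin d) ℂ) a b := by
    intro u
    rw [← sum_basisProjector u, Matrix.sum_apply]
    simp [integral_fintype, Measure.real]
  simp [h]

/-- Standard tomography: for each of the `N` copies, independently, choose a uniformly distributed
orthonormal basis of `ℂ^d` and perform the simple measurement corresponding to that basis. -/
def tomography (d N : ℕ) : POVM (TomographyOutcome d N) (Fin N → Fin d) :=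
  POVM.ofDensity (Measure.pi fun _ => basisMeasure d)
    (fun x => tensorProd fun k => basisProjector (x k).1 (x k).2)
    (fun x => tensorProd_posSemidef fun k => Matrix.posSemidef_vecMulVec_self_star _)
    (fun I J => Integrable.of_bound
      (show Measurable fun x : TomographyOutcome d N =>
          ∏ k, basisProjector (x k).1 (x k).2 (I k) (J k) from
        Finset.measurable_prod _ fun k _ => (measurable_basisProjector (I k) (J k)).comp
          (measurable_pi_apply k)).aestronglyMeasurable 1
      (Filter.Eventually.of_forall fun x => by
        simp only [tensorProd, Matrix.of_apply, norm_prod]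
        exact Finset.prod_le_one (fun _ _ => norm_nonneg _)
          fun k _ => norm_basisProjector_le _ _ _ _))
    (fun I J => by
      simp only [tensorProd, Matrix.of_apply]
      rw [integral_fintype_prod_eq_prod
        (fun (k : Fin N) (y : U d × Fin d) => basisProjector y.1 y.2 (I k) (J k))]
      simp only [integral_basisProjector, Matrix.one_apply]
      rw [Finset.prod_ite_zero]
      simp [funext_iff])

/-- The action of the unitaries on the outcomes of tomography, rotating each of the bases. -/
def tomographyAction (d N : ℕ) : U d →* Equiv.Perm (TomographyOutcome d N) where
  toFun g :=
    { toFun := fun x k => (g * (x k).1, (x k).2)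
      invFun := fun x k => (g⁻¹ * (x k).1, (x k).2)
      left_inv := fun x => by simp
      right_inv := fun x => by simp }
  map_one' := by ext x : 1; simp
  map_mul' g h := by ext x : 1; simp [mul_assoc]

/-! ### Parametric models and information -/

/-- The matrix of partial derivatives `∂ρ/∂θ_k` (entry by entry). -/
def partialDeriv {n d : ℕ} (ρ : (Fin n → ℝ) → Matrix (Fin d) (Fin d) ℂ) (θ : Fin n → ℝ)
    (k : Fin n) : Matrix (Fin d) (Fin d) ℂ :=
  Matrix.of fun i j => fderiv ℝ (fun θ' => ρ θ' i j) θ (Pi.single k 1)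

/-- A continuously differentiable regular parametrization, by `2(d-1)` real parameters ranging over
an open set `Θ`, of the completely unknown pure state on `ℂ^d`. -/
structure IsPureStateParametrization (d : ℕ) (Θ : Set (Fin (2 * (d - 1)) → ℝ))
    (ρ : (Fin (2 * (d - 1)) → ℝ) → Matrix (Fin d) (Fin d) ℂ) : Prop where
  isOpen : IsOpen Θ
  isPureState : ∀ θ ∈ Θ, IsPureState (ρ θ)
  smooth : ∀ i j, ContDiffOn ℝ 1 (fun θ => ρ θ i j) Θ
  regular : ∀ θ ∈ Θ, LinearIndependent ℝ (partialDeriv ρ θ)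

/-- `H` is the Helstrom quantum information matrix of the model `ρ` at `θ`:
`1 - Fid(ρ(θ'), ρ(θ)) = ¼ (θ' - θ)ᵀ H (θ' - θ) + o(‖θ' - θ‖²)` as `θ' → θ`. -/
def IsHelstromInformation {n d : ℕ} (ρ : (Fin n → ℝ) → Matrix (Fin d) (Fin d) ℂ)
    (θ : Fin n → ℝ) (H : Matrix (Fin n) (Fin n) ℝ) : Prop :=
  H.IsSymm ∧
  (fun θ' => 1 - fidelity (ρ θ') (ρ θ) - (1 / 4 : ℝ) * ((θ' - θ) ⬝ᵥ (H *ᵥ (θ' - θ))))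
    =o[nhds θ] fun θ' => ‖θ' - θ‖ ^ 2

/-- The Fisher information matrix at `θ` of a family of probability densities `p θ` with respect
to `μ`. -/
def fisherInformation {n : ℕ} {X : Type*} [MeasurableSpace X] (μ : Measure X)
    (p : (Fin n → ℝ) → X → ℝ) (θ : Fin n → ℝ) : Matrix (Fin n) (Fin n) ℝ :=
  Matrix.of fun k l => ∫ x, fderiv ℝ (fun θ' => p θ' x) θ (Pi.single k 1) *
    fderiv ℝ (fun θ' => p θ' x) θ (Pi.single l 1) / p θ x ∂μ

/-- The average (divided by `N`) Fisher information matrix at `θ` in the outcome of the measurement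
`M` on `N` copies of the state `ρ θ`. The outcome has density `trace (ρ(θ)^{⊗N} m(x))` with respect
to `trace M(·)`, where `m` is the density of `M`. -/
def averageInformation {n d N : ℕ} {X : Type*} [MeasurableSpace X] (M : POVM X (Fin N → Fin d))
    (ρ : (Fin n → ℝ) → Matrix (Fin d) (Fin d) ℂ) (θ : Fin n → ℝ) : Matrix (Fin n) (Fin n) ℝ :=
  (N : ℝ)⁻¹ • fisherInformation M.traceMeasure
    (fun θ' x => (tensorPower N (ρ θ') * M.density x).trace.re) θ

/-- The matrix `Z(X)` with entries `trace (ρ X_i X_j)`. -/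
def holevoZ {n d : ℕ} (ρ : Matrix (Fin d) (Fin d) ℂ) (X : Fin n → Matrix (Fin d) (Fin d) ℂ) :
    Matrix (Fin n) (Fin n) ℂ :=
  Matrix.of fun i j => (ρ * X i * X j).trace

/-- The constraints in the definition of the Holevo bound: self-adjoint `X_1, …, X_n` with
`∂/∂θ_i trace (ρ(θ) X_j) = δ_ij`, and a real symmetric matrix `V ≥ Z(X)`. -/
structure IsHolevoFeasible {n d : ℕ} (ρ : (Fin n → ℝ) → Matrix (Fin d) (Fin d) ℂ)
    (θ : Fin n → ℝ) (X : Fin n → Matrix (Fin d) (Fin d) ℂ) (V : Matrix (Fin n) (Fin n) ℝ) :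
    Prop where
  isHermitian : ∀ j, (X j).IsHermitian
  unbiased : ∀ i j, fderiv ℝ (fun θ' => (ρ θ' * X j).trace.re) θ (Pi.single i 1) =
    if i = j then 1 else 0
  isSymm : V.IsSymm
  le : (V.map Complex.ofReal - holevoZ (ρ θ) X).PosSemidef

/-- The Holevo bound `𝒞_G(θ)`, the infimum of `trace (G V)` over all feasible `X` and `V`. -/
def holevoBound {n d : ℕ} (ρ : (Fin n → ℝ) → Matrix (Fin d) (Fin d) ℂ) (θ : Fin n → ℝ)
    (G : Matrix (Fin n) (Fin n) ℝ) : EReal :=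
  ⨅ (X : Fin n → Matrix (Fin d) (Fin d) ℂ) (V : Matrix (Fin n) (Fin n) ℝ)
    (_ : IsHolevoFeasible ρ θ X V), (((G * V).trace : ℝ) : EReal)

/-! ### Bayesian estimation of a pure state -/

/-- The uniform distribution on the pure states on `ℂ^d`: the distribution of `|u_0⟩⟨u_0|`, for a
uniformly distributed orthonormal basis `u`. It is invariant under the unitaries. -/
def uniformPureState (d : ℕ) [NeZero d] : Measure (PureState d) :=
  (haarU d).map fun u => ⟨basisProjector u 0, basisProjector_isPureState u 0⟩

/-- The prior distribution with density `f` with respect to the uniform distribution. -/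
def prior {d : ℕ} [NeZero d] (f : PureState d → ℝ) : Measure (PureState d) :=
  (uniformPureState d).withDensity fun φ => ENNReal.ofReal (f φ)

/-- The mean fidelity, when the true state is `φ`, of the estimate `est x` computed from the outcome
`x` of the measurement `M` on `N` copies. -/
def meanFidelity {d N : ℕ} {X : Type*} [MeasurableSpace X] (M : POVM X (Fin N → Fin d))
    (est : X → PureState d) (φ : PureState d) : ℝ :=
  ∫ x, fidelity (est x).1 φ.1 ∂M.law (tensorPower N φ.1) (tensorPower_posSemidef φ.2.1)

end QuantumEstimation

end

open QuantumEstimation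

noncomputable section

namespace QuantumEstimation

open MeasureTheory

/-! ### Pure states as unit vectors -/

/-! Local part. Let ρ(θ) = |φ⟩⟨φ|. Differentiating ρ² = ρ gives ∂_kρ = |v_k⟩⟨φ| + |φ⟩⟨v_k| with v_k
⊥ φ, and a dimension count makes the v_k a real basis of φ^⊥ (`partialDeriv_eq_tangentMatrix`,
`exists_real_combination`). Since 1 - Fid is half the squared Hilbert–Schmidt distance of pure
states, H = 4 Re⟨v_i, v_j⟩. Let y be the dual basis, 2 Re⟨v_i, y_j⟩ = δ_ij; then the matrix Re⟨y_i,
y_j⟩ is H⁻¹.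

Holevo bound (`holevoBound_eq`). Unbiasedness forces the part of X_jφ orthogonal to φ to be y_j, so
Z(X) is the complex Gram matrix of y plus a positive rank-one term. Pairing V ≥ Z(X) with the Gram
matrix of v gives at least Re ∑⟨v_i, y_i⟩ = d - 1, and V = 2 Re⟨y_i, y_j⟩ attains it.

Measurements. Cauchy–Schwarz for the density m(x) bounds the squared scores by ⟨D|m|D⟩, with D the
derivative of φ^{⊗N}. Integrating out m gives trace(H⁻¹ I_M) ≤ N(d - 1) for the unnormalized
information of any, even collective, measurement (`IsDualFrame.sum_reGram_mul_fisherForm_le`).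
Expanding a square turns this into the bound on trace(¼H Ī⁻¹) (`IsDualFrame.le_trace_mul_inv`). If m
has rank one, Cauchy–Schwarz is an equality, so the informations in the directions v and iv add up
to 4N‖v‖²; covariance under a phase rotation about φ makes the two equal
(`fisherForm_self_of_exhaustive`). Outcomes of density zero need care: there the derivative must
vanish too, which holds almost everywhere because a bad zero is isolated along a curve of unitaries
(`ae_haarU_dotProduct_derivVec_eq_zero`).

Bayesian part. On homogeneous polynomials on the unit sphere, multiplication by a coordinate is, up
to a factor, adjoint to a partial derivative. Hence |⟨t, z⟩|² has mean at most (n + 1)/(n + d) under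
a density proportional to |q(z)|² with q of degree n (`integral_normSq_mul_normSq_le`). The
likelihood of an outcome times the weight |⟨s, z⟩|^{2k} is a sum of such |q|² with n = N + k, so for
that weight as prior the mean loss is at least (d - 1)/(N + k + d). A general continuous prior
density is, up to ε and an exponentially small error, bounded below by a mixture of these weights
over s (`mul_sub_le_integral_loss`); k = ⌊√N⌋ makes all errors negligible. -/

theorem isPureState_vecMulVec {d : ℕ} {φ : Fin d → ℂ} (h : star φ ⬝ᵥ φ = 1) :
    IsPureState (Matrix.vecMulVec φ (star φ)) := by
  refine ⟨Matrix.posSemidef_vecMulVec_self_star _, ?_, ?_⟩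
  · rw [Matrix.trace_vecMulVec, dotProduct_comm, h]
  · rw [Matrix.vecMulVec_mul_vecMulVec, h, one_smul]

/-- A nonzero column j of ρ has squared norm (ρ²)_jj = ρ_jj, so dividing it by √ρ_jj gives a unit
vector φ, fixed by ρ because ρ² = ρ. With P = |φ⟩⟨φ|, the difference ρ - P is then a projector of
trace 0, hence zero. -/
theorem IsPureState.exists_vector {d : ℕ} {ρ : Matrix (Fin d) (Fin d) ℂ} (h : IsPureState ρ) :
    ∃ φ : Fin d → ℂ, star φ ⬝ᵥ φ = 1 ∧ ρ = Matrix.vecMulVec φ (star φ) := by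
  obtain ⟨hp, ht, hi⟩ := h
  obtain ⟨j, hj⟩ : ∃ j, ρ j j ≠ 0 := by
    by_contra! hc
    simp [Matrix.trace, hc] at ht
  have hjr : 0 < ρ j j := lt_of_le_of_ne hp.diag_nonneg (Ne.symm hj)
  obtain ⟨hre, him⟩ := Complex.lt_def.1 hjr
  simp only [Complex.zero_re, Complex.zero_im] at hre him
  have hjj : ρ j j = ((ρ j j).re : ℂ) := Complex.ext (by simp) (by simp [← him])
  set r : ℝ := (ρ j j).re
  have hcol : star (fun i => ρ i j) ⬝ᵥ (fun i => ρ i j) = r := by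
    have := congrFun (congrFun hi j) j
    rw [← hjj, ← this, Matrix.mul_apply]
    refine Finset.sum_congr rfl fun i _ => ?_
    rw [← hp.1.apply j i]
    rfl
  have hs : (Real.sqrt r : ℂ) * Real.sqrt r = r := by
    rw [← Complex.ofReal_mul, Real.mul_self_sqrt hre.le]
  have hs0 : (Real.sqrt r : ℂ) ≠ 0 := by
    simpa using (Real.sqrt_pos.2 hre).ne'
  have hr0 : (r : ℂ) ≠ 0 := by simpa using hre.ne'
  let φ : Fin d → ℂ := fun i => (Real.sqrt r : ℂ)⁻¹ * ρ i j
  have hφ : star φ ⬝ᵥ φ = 1 := by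
    have : star φ ⬝ᵥ φ = ((Real.sqrt r : ℂ) * Real.sqrt r)⁻¹ *
        (star (fun i => ρ i j) ⬝ᵥ (fun i => ρ i j)) := by
      simp only [dotProduct, Finset.mul_sum, φ, Pi.star_apply, star_mul', star_inv₀, Complex.star_def,
        Complex.conj_ofReal, mul_inv]
      exact Finset.sum_congr rfl fun i _ => by ring
    rw [this, hcol, hs, inv_mul_cancel₀ hr0]
  have hρφ : ρ *ᵥ φ = φ := by
    ext i
    have := congrFun (congrFun hi i) j
    rw [Matrix.mul_apply] at this
    simp only [Matrix.mulVec, dotProduct, φ]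
    rw [← this, Finset.mul_sum]
    exact Finset.sum_congr rfl fun k _ => by ring
  refine ⟨φ, hφ, ?_⟩
  set P := Matrix.vecMulVec φ (star φ)
  have hP : IsPureState P := isPureState_vecMulVec hφ
  have h1 : ρ * P = P := by rw [Matrix.mul_vecMulVec, hρφ]
  have h2 : P * ρ = P := by
    have := congrArg Matrix.conjTranspose h1
    rwa [Matrix.conjTranspose_mul, hP.1.1.eq, hp.1.eq] at this
  have h3 : (ρ - P)ᴴ * (ρ - P) = ρ - P := by
    rw [Matrix.conjTranspose_sub, hP.1.1.eq, hp.1.eq, Matrix.sub_mul, Matrix.mul_sub, Matrix.mul_sub,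
      hi, h1, h2, hP.2.2]
    simp
  have h4 : ((ρ - P)ᴴ * (ρ - P)).trace = 0 := by
    rw [h3, Matrix.trace_sub, ht, hP.2.1, sub_self]
  exact sub_eq_zero.1 (Matrix.trace_conjTranspose_mul_self_eq_zero_iff.1 h4)

theorem trace_vecMulVec_mul {ι : Type*} [Fintype ι] (a b : ι → ℂ) (A : Matrix ι ι ℂ) :
    (Matrix.vecMulVec a b * A).trace = b ⬝ᵥ A *ᵥ a := by
  rw [Matrix.trace_mul_comm, Matrix.mul_vecMulVec, Matrix.trace_vecMulVec, dotProduct_comm]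

theorem star_dotProduct_comm {ι : Type*} [Fintype ι] (a b : ι → ℂ) :
    star a ⬝ᵥ b = star (star b ⬝ᵥ a) := by
  rw [Matrix.star_dotProduct]

theorem trace_vecMulVec_mul_vecMulVec {ι : Type*} [Fintype ι] (a b : ι → ℂ) :
    (Matrix.vecMulVec a (star a) * Matrix.vecMulVec b (star b)).trace =
      (Complex.normSq (star a ⬝ᵥ b) : ℂ) := by
  rw [trace_vecMulVec_mul, Matrix.vecMulVec_mulVec, star_dotProduct_comm b a, ← Complex.mul_conj]
  simp [mul_comm]

open scoped MatrixOrder in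
-- A projector P is its own square root, and PSP = |⟨s, φ⟩|² P because P has rank one, so the outer
-- square root is |⟨s, φ⟩| P.
theorem fidelity_eq {d : ℕ} {σ ρ : Matrix (Fin d) (Fin d) ℂ} (hσ : IsPureState σ)
    (hρ : IsPureState ρ) : fidelity σ ρ = (σ * ρ).trace.re := by
  obtain ⟨s, hs, rfl⟩ := hσ.exists_vector
  obtain ⟨φ, hφ, rfl⟩ := hρ.exists_vector
  set S := Matrix.vecMulVec s (star s)
  set P := Matrix.vecMulVec φ (star φ)
  rw [trace_vecMulVec_mul_vecMulVec, Complex.ofReal_re]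
  set t := Complex.normSq (star s ⬝ᵥ φ)
  have ht : 0 ≤ t := Complex.normSq_nonneg _
  have h1 : CFC.sqrt P = P := CFC.sqrt_unique hρ.2.2 hρ.1.nonneg
  have h2 : P * S * P = (t : ℂ) • P := by
    simp only [P, S, Matrix.vecMulVec_mul_vecMulVec]
    rw [star_dotProduct_comm φ s, smul_dotProduct, smul_eq_mul, Complex.star_def, ← Complex.normSq_eq_conj_mul_self,
      Matrix.vecMulVec_smul]
  have h3 : CFC.sqrt (P * S * P) = (Real.sqrt t : ℂ) • P := by
    refine CFC.sqrt_unique ?_ ?_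
    · rw [h2, Matrix.smul_mul, Matrix.mul_smul, smul_smul, hρ.2.2, ← Complex.ofReal_mul,
        Real.mul_self_sqrt ht]
    · exact (hρ.1.smul (by simp)).nonneg
  rw [fidelity, h1, h3, Matrix.trace_smul, hρ.2.1]
  simp [Real.sq_sqrt ht]

theorem IsPureState.trace_mul_re_nonneg {d : ℕ} {σ ρ : Matrix (Fin d) (Fin d) ℂ}
    (hσ : IsPureState σ) (hρ : IsPureState ρ) : 0 ≤ (σ * ρ).trace.re :=
  POVM.trace_mul_re_nonneg hσ.1 hρ.1

/-- For pure states fidelity and Hilbert–Schmidt distance determine each other. The bound Fid ≤ 1,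
its equality case and the expansion defining the Helstrom information all come from this identity.
-/
theorem IsPureState.trace_sub_mul_sub {d : ℕ} {σ ρ : Matrix (Fin d) (Fin d) ℂ}
    (hσ : IsPureState σ) (hρ : IsPureState ρ) :
    ((σ - ρ) * (σ - ρ)).trace = 2 - 2 * (σ * ρ).trace := by
  rw [Matrix.sub_mul, Matrix.mul_sub, Matrix.mul_sub, hσ.2.2, hρ.2.2]
  simp only [Matrix.trace_sub, hσ.2.1, hρ.2.1, Matrix.trace_mul_comm ρ σ]
  ring

theorem IsPureState.trace_mul_re_le_one {d : ℕ} {σ ρ : Matrix (Fin d) (Fin d) ℂ}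
    (hσ : IsPureState σ) (hρ : IsPureState ρ) : (σ * ρ).trace.re ≤ 1 := by
  have h := (Complex.le_def.1 (Matrix.posSemidef_conjTranspose_mul_self (σ - ρ)).trace_nonneg).1
  rw [Matrix.conjTranspose_sub, hσ.1.1.eq, hρ.1.1.eq, hσ.trace_sub_mul_sub hρ] at h
  simp at h
  linarith

theorem IsPureState.trace_mul_im {d : ℕ} {σ ρ : Matrix (Fin d) (Fin d) ℂ}
    (hσ : IsPureState σ) (hρ : IsPureState ρ) : (σ * ρ).trace.im = 0 := by
  obtain ⟨s, hs, rfl⟩ := hσ.exists_vector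
  obtain ⟨φ, hφ, rfl⟩ := hρ.exists_vector
  rw [trace_vecMulVec_mul_vecMulVec, Complex.ofReal_im]

theorem IsPureState.eq_of_trace_mul_re_eq_one {d : ℕ} {σ ρ : Matrix (Fin d) (Fin d) ℂ}
    (hσ : IsPureState σ) (hρ : IsPureState ρ) (h : (σ * ρ).trace.re = 1) : σ = ρ := by
  have h1 : (σ * ρ).trace = 1 := Complex.ext h (hσ.trace_mul_im hρ)
  have h2 := hσ.trace_sub_mul_sub hρ
  rw [h1, mul_one, sub_self] at h2
  have h3 : (σ - ρ)ᴴ = σ - ρ := by rw [Matrix.conjTranspose_sub, hσ.1.1.eq, hρ.1.1.eq]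
  nth_rewrite 1 [← h3] at h2
  exact sub_eq_zero.1 (Matrix.trace_conjTranspose_mul_self_eq_zero_iff.1 h2)

/-- The unitary multiplying the range of the projector `σ` by the phase `c`. -/
def phaseUnitary {d : ℕ} {c : ℂ} (hc : star c * c = 1) {σ : Matrix (Fin d) (Fin d) ℂ}
    (hσ : IsPureState σ) : U d :=
  ⟨1 + (c - 1) • σ, by
    rw [Matrix.mem_unitaryGroup_iff']
    have h : star σ = σ := hσ.1.1
    simp only [star_add, star_smul, star_one, h, Matrix.add_mul, Matrix.mul_add, Matrix.smul_mul,
      Matrix.mul_smul, hσ.2.2, Matrix.one_mul, Matrix.mul_one, star_sub]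
    have : c - 1 + (star c - 1 + (star c - 1) * (c - 1)) = 0 := by linear_combination hc
    calc _ = 1 + (c - 1 + (star c - 1 + (star c - 1) * (c - 1))) • σ := by module
      _ = 1 := by rw [this, zero_smul, add_zero]⟩

/-! ### The density of a measurement -/

theorem dotProduct_mulVec_eq_sum {ι : Type*} [Fintype ι] (u w : ι → ℂ) (A : Matrix ι ι ℂ) :
    u ⬝ᵥ A *ᵥ w = ∑ i, ∑ j, u i * w j * A i j := by
  simp only [dotProduct, Matrix.mulVec, Finset.mul_sum]
  exact Finset.sum_congr rfl fun i _ => Finset.sum_congr rfl fun j _ => by ring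

theorem integrable_dotProduct_mulVec {X ι : Type*} [MeasurableSpace X] [Fintype ι] {μ : Measure X}
    {m : X → Matrix ι ι ℂ} (hint : ∀ i j, Integrable (fun x => m x i j) μ) (u w : ι → ℂ) :
    Integrable (fun x => u ⬝ᵥ m x *ᵥ w) μ := by
  simp only [dotProduct_mulVec_eq_sum]
  exact integrable_finsetSum _ fun i _ => integrable_finsetSum _ fun j _ =>
    (hint i j).const_mul _

theorem integral_dotProduct_mulVec {X ι : Type*} [MeasurableSpace X] [Fintype ι] {μ : Measure X}
    {m : X → Matrix ι ι ℂ} (hint : ∀ i j, Integrable (fun x => m x i j) μ) (u w : ι → ℂ) :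
    ∫ x, u ⬝ᵥ m x *ᵥ w ∂μ = u ⬝ᵥ (Matrix.of fun i j => ∫ x, m x i j ∂μ) *ᵥ w := by
  simp only [dotProduct_mulVec_eq_sum]
  rw [integral_finsetSum _ fun i _ => integrable_finsetSum _ fun j _ => (hint i j).const_mul _]
  refine Finset.sum_congr rfl fun i _ => ?_
  rw [integral_finsetSum _ fun j _ => (hint i j).const_mul _]
  exact Finset.sum_congr rfl fun j _ => integral_const_mul _ _

namespace POVM

variable {X : Type*} [MeasurableSpace X] {ι : Type*} [Fintype ι] [DecidableEq ι]

theorem law_apply (M : POVM X ι) (ρ : Matrix ι ι ℂ) (hρ : ρ.PosSemidef) {B : Set X}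
    (hB : MeasurableSet B) : M.law ρ hρ B = ENNReal.ofReal (ρ * M.toVectorMeasure B).trace.re :=
  Measure.ofMeasurable_apply B hB

instance (M : POVM X ι) (ρ : Matrix ι ι ℂ) (hρ : ρ.PosSemidef) : IsFiniteMeasure (M.law ρ hρ) :=
  ⟨by rw [law_apply M ρ hρ MeasurableSet.univ]; exact ENNReal.ofReal_lt_top⟩

instance (M : POVM X ι) : IsFiniteMeasure M.traceMeasure := by
  unfold traceMeasure; infer_instance

theorem traceMeasure_apply (M : POVM X ι) {B : Set X} (hB : MeasurableSet B) :
    M.traceMeasure B = ENNReal.ofReal (M.toVectorMeasure B).trace.re := by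
  rw [traceMeasure, law_apply _ _ _ hB, one_mul]

theorem trace_im (M : POVM X ι) (B : Set X) : (M.toVectorMeasure B).trace.im = 0 :=
  (Complex.le_def.1 (M.posSemidef B).trace_nonneg).2.symm

theorem apply_eq_zero (M : POVM X ι) {B : Set X} (hB : MeasurableSet B)
    (h : M.traceMeasure B = 0) : M.toVectorMeasure B = 0 := by
  rw [traceMeasure_apply M hB, ENNReal.ofReal_eq_zero] at h
  have h1 := Complex.le_def.1 (M.posSemidef B).trace_nonneg
  exact (M.posSemidef B).trace_eq_zero_iff.1
    (Complex.ext (le_antisymm h h1.1) (M.trace_im B))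

theorem entry_apply (M : POVM X ι) (i j : ι) (B : Set X) :
    M.entry i j B = M.toVectorMeasure B i j := rfl

theorem integrable_density (M : POVM X ι) (i j : ι) :
    Integrable (fun x => M.density x i j) M.traceMeasure :=
  ComplexMeasure.integrable_rnDeriv _ _

/-- Radon–Nikodym: if trace M(B) = 0, the positive semidefinite M(B) vanishes, so every entry of M
is absolutely continuous with respect to the trace measure. Real and imaginary parts are handled
separately. -/
theorem setIntegral_density (M : POVM X ι) (i j : ι) {B : Set X} (hB : MeasurableSet B) :
    ∫ x in B, M.density x i j ∂M.traceMeasure = M.toVectorMeasure B i j := by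
  have hac : M.entry i j ≪ᵥ M.traceMeasure.toENNRealVectorMeasure := by
    refine VectorMeasure.AbsolutelyContinuous.mk fun s hs h => ?_
    rw [Measure.toENNRealVectorMeasure_apply_measurable hs] at h
    rw [entry_apply, M.apply_eq_zero hs h, Matrix.zero_apply]
  obtain ⟨hre, him⟩ := (ComplexMeasure.absolutelyContinuous_ennreal_iff _ _).1 hac
  have h1 := SignedMeasure.withDensityᵥ_rnDeriv_eq _ _ hre
  have h2 := SignedMeasure.withDensityᵥ_rnDeriv_eq _ _ him
  have hi := (M.integrable_density i j).integrableOn (s := B)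
  apply Complex.ext
  · have := congrArg (fun v => v B) h1
    simp only [withDensityᵥ_apply (SignedMeasure.integrable_rnDeriv _ _) hB] at this
    rw [← RCLike.re_eq_complex_re, ← integral_re hi]
    exact this
  · have := congrArg (fun v => v B) h2
    simp only [withDensityᵥ_apply (SignedMeasure.integrable_rnDeriv _ _) hB] at this
    rw [← RCLike.im_eq_complex_im, ← integral_im hi]
    exact this

theorem density_ae_eq (M : POVM X ι) {m : X → Matrix ι ι ℂ}
    (hint : ∀ i j, Integrable (fun x => m x i j) M.traceMeasure)
    (h : ∀ B, MeasurableSet B → ∀ i j,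
      ∫ x in B, m x i j ∂M.traceMeasure = M.toVectorMeasure B i j) :
    ∀ᵐ x ∂M.traceMeasure, M.density x = m x := by
  have : ∀ i j, ∀ᵐ x ∂M.traceMeasure, M.density x i j = m x i j := fun i j =>
    Integrable.ae_eq_of_forall_setIntegral_eq _ _ (M.integrable_density i j) (hint i j)
      fun B hB _ => by rw [M.setIntegral_density i j hB, h B hB]
  filter_upwards [ae_all_iff.2 fun i => ae_all_iff.2 (this i)] with x hx
  ext i j
  exact hx i j

theorem setIntegral_dotProduct_density (M : POVM X ι) (u w : ι → ℂ) {B : Set X}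
    (hB : MeasurableSet B) : ∫ x in B, u ⬝ᵥ M.density x *ᵥ w ∂M.traceMeasure =
      u ⬝ᵥ M.toVectorMeasure B *ᵥ w := by
  rw [integral_dotProduct_mulVec fun i j => (M.integrable_density i j).integrableOn]
  simp only [M.setIntegral_density _ _ hB]
  rfl

theorem integral_dotProduct_density (M : POVM X ι) (u w : ι → ℂ) :
    ∫ x, u ⬝ᵥ M.density x *ᵥ w ∂M.traceMeasure = u ⬝ᵥ w := by
  have := M.setIntegral_dotProduct_density u w MeasurableSet.univ
  rwa [Measure.restrict_univ, M.univ_eq_one, Matrix.one_mulVec] at this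

theorem integrable_dotProduct_density (M : POVM X ι) (u w : ι → ℂ) :
    Integrable (fun x => u ⬝ᵥ M.density x *ᵥ w) M.traceMeasure :=
  integrable_dotProduct_mulVec M.integrable_density u w

theorem density_isHermitian (M : POVM X ι) :
    ∀ᵐ x ∂M.traceMeasure, (M.density x).IsHermitian := by
  have := M.density_ae_eq (m := fun x => (M.density x)ᴴ)
    (fun i j => by
      simp only [Matrix.conjTranspose_apply]
      exact (LinearIsometryEquiv.integrable_comp_iff (𝕜 := ℝ) Complex.conjLIE).2
        (M.integrable_density j i))
    (fun B hB i j => by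
      simp only [Matrix.conjTranspose_apply, Complex.star_def]
      rw [integral_conj, M.setIntegral_density _ _ hB]
      exact (M.posSemidef B).1.apply i j)
  filter_upwards [this] with x hx using hx.symm

/-- For one vector v the quadratic form is non-negative off a null set that depends on v. Taking a
countable dense set of v gives a single null set, and continuity in v covers the rest. -/
theorem density_posSemidef (M : POVM X ι) :
    ∀ᵐ x ∂M.traceMeasure, (M.density x).PosSemidef := by
  have h : ∀ v : ι → ℂ, ∀ᵐ x ∂M.traceMeasure, 0 ≤ (star v ⬝ᵥ M.density x *ᵥ v).re := by
    intro v
    have hi := M.integrable_dotProduct_density (star v) v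
    refine ae_nonneg_of_forall_setIntegral_nonneg hi.re fun B hB _ => ?_
    have h1 := integral_re (hi.integrableOn (s := B))
    simp only [RCLike.re_eq_complex_re] at h1
    rw [h1, M.setIntegral_dotProduct_density _ _ hB]
    exact (Complex.le_def.1 ((M.posSemidef B).dotProduct_mulVec_nonneg v)).1
  let s := TopologicalSpace.denseSeq (ι → ℂ)
  filter_upwards [M.density_isHermitian, ae_all_iff.2 fun n => h (s n)] with x hx hn
  refine Matrix.PosSemidef.of_dotProduct_mulVec_nonneg hx fun v => ?_
  have hcont : Continuous fun v : ι → ℂ => (star v ⬝ᵥ M.density x *ᵥ v).re :=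
    Complex.continuous_re.comp (continuous_star.dotProduct
      (Continuous.matrix_mulVec continuous_const continuous_id))
  have hre : 0 ≤ (star v ⬝ᵥ M.density x *ᵥ v).re :=
    (TopologicalSpace.denseRange_denseSeq (ι → ℂ)).induction_on
      (p := fun v => 0 ≤ (star v ⬝ᵥ M.density x *ᵥ v).re) v (isClosed_le continuous_const hcont) hn
  refine Complex.le_def.2 ⟨hre, ?_⟩
  have := hx.im_star_dotProduct_mulVec_self v
  simpa using this.symm

theorem law_eq_withDensity (M : POVM X ι) (ρ : Matrix ι ι ℂ) (hρ : ρ.PosSemidef) :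
    M.law ρ hρ = M.traceMeasure.withDensity
      fun x => ENNReal.ofReal (ρ * M.density x).trace.re := by
  have hi : Integrable (fun x => (ρ * M.density x).trace) M.traceMeasure := by
    simp only [Matrix.trace, Matrix.diag, Matrix.mul_apply]
    exact integrable_finsetSum _ fun i _ => integrable_finsetSum _ fun j _ =>
      (M.integrable_density j i).const_mul _
  have hre : Integrable (fun x => (ρ * M.density x).trace.re) M.traceMeasure := hi.re
  ext B hB
  rw [M.law_apply ρ hρ hB, withDensity_apply _ hB, ← ofReal_integral_eq_lintegral_ofReal
    hre.integrableOn (ae_restrict_of_ae (M.density_posSemidef.mono fun x hx =>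
      trace_mul_re_nonneg hρ hx))]
  congr 1
  have h1 := integral_re (hi.integrableOn (s := B))
  simp only [RCLike.re_eq_complex_re] at h1
  rw [h1]
  congr 1
  have h2 : ∀ i j, Integrable (fun x => ρ i j * M.density x j i) (M.traceMeasure.restrict B) :=
    fun i j => ((M.integrable_density j i).const_mul _).integrableOn
  have h3 : ∫ x in B, (ρ * M.density x).trace ∂M.traceMeasure =
      ∑ i, ∑ j, ∫ x in B, ρ i j * M.density x j i ∂M.traceMeasure := by
    simp only [Matrix.trace, Matrix.diag, Matrix.mul_apply]
    rw [integral_finsetSum _ fun i _ => integrable_finsetSum _ fun j _ => h2 i j]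
    exact Finset.sum_congr rfl fun i _ => integral_finsetSum _ fun j _ => h2 i j
  rw [h3]
  simp only [integral_const_mul, M.setIntegral_density _ _ hB, Matrix.trace, Matrix.diag,
    Matrix.mul_apply]

end POVM

/-! ### Tensor powers of vectors and their derivatives -/

/-- The tensor product `a 0 ⊗ ⋯ ⊗ a (N-1)` of vectors. -/
def prodVec {d N : ℕ} (a : Fin N → Fin d → ℂ) : (Fin N → Fin d) → ℂ := fun I => ∏ k, a k (I k)

/-- The tensor power `φ^{⊗N}`. -/
def powVec {d : ℕ} (N : ℕ) (φ : Fin d → ℂ) : (Fin N → Fin d) → ℂ := prodVec fun _ => φ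

/-- The derivative of `φ ↦ φ^{⊗N}` at `φ` in the direction `v`. -/
def derivVec {d : ℕ} (N : ℕ) (φ v : Fin d → ℂ) : (Fin N → Fin d) → ℂ :=
  fun I => ∑ k, v (I k) * ∏ l ∈ Finset.univ.erase k, φ (I l)

theorem prodVec_update {d N : ℕ} (φ v : Fin d → ℂ) (k : Fin N) (I : Fin N → Fin d) :
    prodVec (Function.update (fun _ => φ) k v) I =
      v (I k) * ∏ l ∈ Finset.univ.erase k, φ (I l) := by
  rw [prodVec, ← Finset.mul_prod_erase _ _ (Finset.mem_univ k), Function.update_self]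
  congr 1
  refine Finset.prod_congr rfl fun l hl => ?_
  rw [Function.update_of_ne (Finset.ne_of_mem_erase hl)]

theorem derivVec_eq_sum {d N : ℕ} (φ v : Fin d → ℂ) :
    derivVec N φ v = ∑ k, prodVec (Function.update (fun _ => φ) k v) := by
  ext I
  simp only [derivVec, Finset.sum_apply, prodVec_update]

theorem star_prodVec {d N : ℕ} (a : Fin N → Fin d → ℂ) :
    star (prodVec a) = prodVec fun k => star (a k) := by
  ext I
  simp [prodVec]

theorem star_prodVec_dotProduct {d N : ℕ} (a b : Fin N → Fin d → ℂ) :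
    star (prodVec a) ⬝ᵥ prodVec b = ∏ k, star (a k) ⬝ᵥ b k := by
  simp only [star_prodVec, dotProduct, prodVec, ← Finset.prod_mul_distrib]
  rw [Finset.prod_univ_sum, Fintype.piFinset_univ]

theorem tensorProd_vecMulVec {d N : ℕ} (a b : Fin N → Fin d → ℂ) :
    tensorProd (fun k => Matrix.vecMulVec (a k) (b k)) =
      Matrix.vecMulVec (prodVec a) (prodVec b) := by
  ext I J
  simp [tensorProd, Matrix.vecMulVec_apply, prodVec, Finset.prod_mul_distrib]

theorem tensorProd_mulVec {d N : ℕ} (A : Fin N → Matrix (Fin d) (Fin d) ℂ)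
    (a : Fin N → Fin d → ℂ) :
    tensorProd A *ᵥ prodVec a = prodVec fun k => A k *ᵥ a k := by
  ext I
  simp only [Matrix.mulVec, dotProduct, tensorProd, prodVec, Matrix.of_apply,
    ← Finset.prod_mul_distrib]
  rw [Finset.prod_univ_sum, Fintype.piFinset_univ]

theorem tensorPower_mulVec_powVec {d N : ℕ} (A : Matrix (Fin d) (Fin d) ℂ) (φ : Fin d → ℂ) :
    tensorPower N A *ᵥ powVec N φ = powVec N (A *ᵥ φ) := tensorProd_mulVec _ _

theorem tensorPower_mulVec_derivVec {d N : ℕ} (A : Matrix (Fin d) (Fin d) ℂ) (φ v : Fin d → ℂ) :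
    tensorPower N A *ᵥ derivVec N φ v = derivVec N (A *ᵥ φ) (A *ᵥ v) := by
  rw [derivVec_eq_sum, derivVec_eq_sum, Matrix.mulVec_sum]
  refine Finset.sum_congr rfl fun k _ => ?_
  rw [tensorPower, tensorProd_mulVec]
  congr 1
  ext l : 1
  by_cases h : l = k
  · subst h; simp
  · simp [h]

theorem tensorPower_vecMulVec {d N : ℕ} (φ : Fin d → ℂ) :
    tensorPower N (Matrix.vecMulVec φ (star φ)) =
      Matrix.vecMulVec (powVec N φ) (star (powVec N φ)) := by
  rw [tensorPower, tensorProd_vecMulVec, powVec, star_prodVec]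

theorem tensorPower_one {d N : ℕ} : tensorPower N (1 : Matrix (Fin d) (Fin d) ℂ) = 1 := by
  ext I J
  simp only [tensorPower, tensorProd, Matrix.of_apply, Matrix.one_apply]
  rw [Finset.prod_ite_zero]
  simp [funext_iff]

theorem tensorPower_conjTranspose {d N : ℕ} (A : Matrix (Fin d) (Fin d) ℂ) :
    (tensorPower N A)ᴴ = tensorPower N Aᴴ := tensorProd_conjTranspose _

theorem tensorPower_mul {d N : ℕ} (A B : Matrix (Fin d) (Fin d) ℂ) :
    tensorPower N A * tensorPower N B = tensorPower N (A * B) := tensorProd_mul _ _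

theorem powVec_smul {d N : ℕ} (c : ℂ) (φ : Fin d → ℂ) :
    powVec N (c • φ) = c ^ N • powVec N φ := by
  ext I
  simp [powVec, prodVec, Finset.prod_mul_distrib]

theorem derivVec_add {d N : ℕ} (φ v w : Fin d → ℂ) :
    derivVec N φ (v + w) = derivVec N φ v + derivVec N φ w := by
  ext I
  simp [derivVec, add_mul, Finset.sum_add_distrib]

theorem derivVec_smul {d N : ℕ} (c : ℂ) (φ v : Fin d → ℂ) :
    derivVec N φ (c • v) = c • derivVec N φ v := by
  ext I
  simp [derivVec, mul_assoc, Finset.mul_sum]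

/-- For N = 0 the derivative is an empty sum, so the truncated exponent is harmless. -/
theorem derivVec_smul_left {d N : ℕ} (c : ℂ) (φ v : Fin d → ℂ) :
    derivVec N (c • φ) v = c ^ (N - 1) • derivVec N φ v := by
  ext I
  simp only [derivVec, Pi.smul_apply, smul_eq_mul, Finset.prod_mul_distrib, Finset.mul_sum,
    Finset.prod_const, Finset.card_erase_of_mem (Finset.mem_univ _), Finset.card_univ,
    Fintype.card_fin]
  exact Finset.sum_congr rfl fun k _ => by ring

theorem derivVec_self {d N : ℕ} (φ : Fin d → ℂ) : derivVec N φ φ = (N : ℂ) • powVec N φ := by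
  ext I
  simp only [derivVec, powVec, prodVec, Pi.smul_apply, smul_eq_mul]
  simp only [Finset.mul_prod_erase Finset.univ (fun l => φ (I l)) (Finset.mem_univ _)]
  simp

/-- The N product vectors having v in one slot and φ in the others are pairwise orthogonal because v
⊥ φ. This is the source of the factor N in all information bounds. -/
theorem star_derivVec_dotProduct_self {d N : ℕ} {φ v : Fin d → ℂ} (hφ : star φ ⬝ᵥ φ = 1)
    (hv : star φ ⬝ᵥ v = 0) :
    star (derivVec N φ v) ⬝ᵥ derivVec N φ v = N * (star v ⬝ᵥ v) := by
  have hv' : star v ⬝ᵥ φ = 0 := by rw [star_dotProduct_comm, hv, star_zero]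
  have h : ∀ k l : Fin N, star (prodVec (Function.update (fun _ => φ) k v)) ⬝ᵥ
      prodVec (Function.update (fun _ => φ) l v) = if k = l then star v ⬝ᵥ v else 0 := by
    intro k l
    rw [star_prodVec_dotProduct]
    split_ifs with hkl
    · subst hkl
      rw [Finset.prod_eq_single k]
      · simp
      · intro j _ hj; simp [hj, hφ]
      · simp
    · refine Finset.prod_eq_zero (Finset.mem_univ k) ?_
      simp [hkl, hv']
  rw [derivVec_eq_sum, star_sum, sum_dotProduct]
  simp only [dotProduct_sum, h]
  simp

theorem hasDerivAt_powVec {d N : ℕ} {z : ℝ → Fin d → ℂ} {z' : Fin d → ℂ} {t : ℝ}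
    (h : HasDerivAt z z' t) : HasDerivAt (fun s => powVec N (z s)) (derivVec N (z t) z') t := by
  refine hasDerivAt_pi.2 fun I => ?_
  have h1 : ∀ k ∈ (Finset.univ : Finset (Fin N)),
      HasDerivAt (fun s => z s (I k)) (z' (I k)) t := fun k _ => hasDerivAt_pi.1 h (I k)
  have := HasDerivAt.fun_finsetProd h1
  refine this.congr_deriv ?_
  simp only [derivVec, smul_eq_mul]
  exact Finset.sum_congr rfl fun k _ => mul_comm _ _

/-! ### Tangent vectors -/

/-- The tangent vector `v` at the pure state of the unit vector `φ`, orthogonal to `φ`, which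
corresponds to the derivative `A = |v⟩⟨φ| + |φ⟩⟨v|` of the density matrix. -/
def tangentMatrix {d : ℕ} (φ v : Fin d → ℂ) : Matrix (Fin d) (Fin d) ℂ :=
  Matrix.vecMulVec v (star φ) + Matrix.vecMulVec φ (star v)

theorem differentiableAt_entry {d : ℕ} {Θ : Set (Fin (2 * (d - 1)) → ℝ)}
    {ρ : (Fin (2 * (d - 1)) → ℝ) → Matrix (Fin d) (Fin d) ℂ}
    (h : IsPureStateParametrization d Θ ρ) {θ : Fin (2 * (d - 1)) → ℝ} (hθ : θ ∈ Θ) (i j : Fin d) :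
    DifferentiableAt ℝ (fun θ' => ρ θ' i j) θ :=
  ((h.smooth i j).differentiableOn one_ne_zero).differentiableAt (h.isOpen.mem_nhds hθ)

/-- Differentiating ρ* = ρ and ρ² = ρ gives A* = A and A = Aρ + ρA. Sandwiching the second identity
between φ and φ yields ⟨φ, Aφ⟩ = 2⟨φ, Aφ⟩, so Aφ ⊥ φ, and Aρ + ρA is the tangent matrix of Aφ. No
differentiable choice of φ along the model is needed. -/
theorem partialDeriv_eq_tangentMatrix {d : ℕ} {Θ : Set (Fin (2 * (d - 1)) → ℝ)}
    {ρ : (Fin (2 * (d - 1)) → ℝ) → Matrix (Fin d) (Fin d) ℂ}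
    (h : IsPureStateParametrization d Θ ρ) {θ : Fin (2 * (d - 1)) → ℝ} (hθ : θ ∈ Θ)
    {φ : Fin d → ℂ} (hφ : star φ ⬝ᵥ φ = 1) (hρ : ρ θ = Matrix.vecMulVec φ (star φ))
    (k : Fin (2 * (d - 1))) :
    star φ ⬝ᵥ (partialDeriv ρ θ k *ᵥ φ) = 0 ∧
      partialDeriv ρ θ k = tangentMatrix φ (partialDeriv ρ θ k *ᵥ φ) := by
  set A := partialDeriv ρ θ k with hA
  have hd := fun i j => differentiableAt_entry h hθ i j
  have hev : ∀ᶠ θ' in nhds θ, IsPureState (ρ θ') :=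
    Filter.eventually_of_mem (h.isOpen.mem_nhds hθ) h.isPureState
  have hherm : Aᴴ = A := by
    ext i j
    have h1 : (fun θ' => star (ρ θ' j i)) =ᶠ[nhds θ] fun θ' => ρ θ' i j :=
      hev.mono fun θ' h' => h'.1.1.apply i j
    have h2 := ((hd j i).hasFDerivAt.star).congr_of_eventuallyEq h1.symm
    have h3 := congrArg (fun L => L (Pi.single k 1)) h2.fderiv
    simpa [hA, partialDeriv] using h3.symm
  have hid : A = A * ρ θ + ρ θ * A := by
    ext i j
    have h1 : (fun θ' => ρ θ' i j) =ᶠ[nhds θ] fun θ' => ∑ l, ρ θ' i l * ρ θ' l j :=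
      hev.mono fun θ' h' =>
        (congrFun (congrFun h'.2.2 i) j).symm
    have h2 := (HasFDerivAt.fun_sum (u := Finset.univ) fun l _ =>
      (hd i l).hasFDerivAt.mul (hd l j).hasFDerivAt).congr_of_eventuallyEq h1
    have h3 := congrArg (fun L => L (Pi.single k 1)) h2.fderiv
    simp only [Matrix.add_apply, Matrix.mul_apply, ← Finset.sum_add_distrib]
    refine h3.trans ?_
    simp only [sum_apply]
    refine Finset.sum_congr rfl fun l _ => ?_
    simp [hA, partialDeriv]
    ring
  have h0 : star φ ⬝ᵥ (A *ᵥ φ) = 0 := by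
    have h1 := congrArg (fun B => star φ ⬝ᵥ (B *ᵥ φ)) hid
    simp only [Matrix.add_mulVec, dotProduct_add, ← Matrix.mulVec_mulVec, hρ,
      Matrix.vecMulVec_mulVec, hφ] at h1
    simp only [MulOpposite.op_one, one_smul, dotProduct_smul, hφ] at h1
    simpa using h1
  refine ⟨h0, ?_⟩
  conv_lhs => rw [hid, hρ]
  rw [tangentMatrix, Matrix.mul_vecMulVec, Matrix.vecMulVec_mul, Matrix.star_mulVec, hherm]

/-! ### The statistical model of the outcome -/

theorem trace_tangent_mul {ι : Type*} [Fintype ι] {m : Matrix ι ι ℂ} (hm : m.IsHermitian)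
    (a b : ι → ℂ) : ((Matrix.vecMulVec b (star a) + Matrix.vecMulVec a (star b)) * m).trace.re =
      2 * (star a ⬝ᵥ m *ᵥ b).re := by
  have : star b ⬝ᵥ m *ᵥ a = star (star a ⬝ᵥ m *ᵥ b) := by
    rw [Matrix.star_dotProduct, Matrix.star_mulVec, hm.eq, Matrix.dotProduct_mulVec]
  rw [Matrix.add_mul, Matrix.trace_add, trace_vecMulVec_mul, trace_vecMulVec_mul, this]
  simp
  ring

/-- By the product rule the derivative of ρ^{⊗N} is |D⟩⟨φ^{⊗N}| + |φ^{⊗N}⟩⟨D|, where D is the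
derivative of the tensor power in the tangent direction; `trace_tangent_mul` evaluates its trace
against m. -/
theorem fderiv_trace_tensorPower_mul {d N : ℕ} {Θ : Set (Fin (2 * (d - 1)) → ℝ)}
    {ρ : (Fin (2 * (d - 1)) → ℝ) → Matrix (Fin d) (Fin d) ℂ}
    (h : IsPureStateParametrization d Θ ρ) {θ : Fin (2 * (d - 1)) → ℝ} (hθ : θ ∈ Θ)
    {φ : Fin d → ℂ} (hφ : star φ ⬝ᵥ φ = 1) (hρ : ρ θ = Matrix.vecMulVec φ (star φ))
    (k : Fin (2 * (d - 1))) {m : Matrix (Fin N → Fin d) (Fin N → Fin d) ℂ} (hm : m.IsHermitian) :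
    fderiv ℝ (fun θ' => (tensorPower N (ρ θ') * m).trace.re) θ (Pi.single k 1) =
      2 * (star (powVec N φ) ⬝ᵥ m *ᵥ derivVec N φ (partialDeriv ρ θ k *ᵥ φ)).re := by
  have hd := fun i j => differentiableAt_entry h hθ i j
  have h1 : ∀ I J : Fin N → Fin d, HasFDerivAt (fun θ' => tensorPower N (ρ θ') I J)
      (∑ l, (∏ l' ∈ Finset.univ.erase l, ρ θ (I l') (J l')) •
        fderiv ℝ (fun θ' => ρ θ' (I l) (J l)) θ) θ := fun I J => by
    have := HasFDerivAt.finsetProd (u := Finset.univ)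
      fun l _ => (hd (I l) (J l)).hasFDerivAt
    exact this
  have h2 : HasFDerivAt (fun θ' => (tensorPower N (ρ θ') * m).trace)
      (∑ I, ∑ J, m J I • (∑ l, (∏ l' ∈ Finset.univ.erase l, ρ θ (I l') (J l')) •
        fderiv ℝ (fun θ' => ρ θ' (I l) (J l)) θ)) θ := by
    simp only [Matrix.trace, Matrix.diag, Matrix.mul_apply]
    exact HasFDerivAt.fun_sum fun I _ => HasFDerivAt.fun_sum fun J _ => (h1 I J).mul_const (m J I)
  have h3 := (Complex.reCLM.hasFDerivAt.comp θ h2).fderiv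
  have h4 := congrArg (fun L => L (Pi.single k 1)) h3
  refine h4.trans ?_
  rw [← trace_tangent_mul hm]
  simp only [ContinuousLinearMap.comp_apply, Complex.reCLM_apply]
  congr 1
  simp only [Matrix.trace, Matrix.diag, Matrix.mul_apply, sum_apply,
    smul_apply, smul_eq_mul]
  refine Finset.sum_congr rfl fun I _ => Finset.sum_congr rfl fun J _ => ?_
  rw [mul_comm]
  congr 1
  have hA := (partialDeriv_eq_tangentMatrix h hθ hφ hρ k).2
  set v := partialDeriv ρ θ k *ᵥ φ
  have h5 : ∀ i j, fderiv ℝ (fun θ' => ρ θ' i j) θ (Pi.single k 1) =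
      v i * star (φ j) + φ i * star (v j) := fun i j =>
    congrFun (congrFun hA i) j
  simp only [h5, hρ, Matrix.add_apply, Matrix.vecMulVec_apply, derivVec, Pi.star_apply, star_sum,
    star_mul', star_prod, Finset.prod_mul_distrib, Finset.sum_mul, Finset.mul_sum,
    ← Finset.sum_add_distrib, powVec, prodVec]
  refine Finset.sum_congr rfl fun l _ => ?_
  rw [← Finset.mul_prod_erase Finset.univ (fun l => φ (I l)) (Finset.mem_univ l),
    ← Finset.mul_prod_erase Finset.univ (fun l => star (φ (J l))) (Finset.mem_univ l)]
  ring

/-- The Fisher information integral of a measurement on `N` copies of the pure state of `φ`, for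
the directions given by the tangent vectors `v` and `w`. -/
def fisherForm {d N : ℕ} {X : Type*} [MeasurableSpace X] (M : POVM X (Fin N → Fin d))
    (φ v w : Fin d → ℂ) : ℝ :=
  ∫ x, 2 * (star (powVec N φ) ⬝ᵥ M.density x *ᵥ derivVec N φ v).re *
    (2 * (star (powVec N φ) ⬝ᵥ M.density x *ᵥ derivVec N φ w).re) /
      (star (powVec N φ) ⬝ᵥ M.density x *ᵥ powVec N φ).re ∂M.traceMeasure

theorem averageInformation_apply {d N : ℕ} {Θ : Set (Fin (2 * (d - 1)) → ℝ)}
    {ρ : (Fin (2 * (d - 1)) → ℝ) → Matrix (Fin d) (Fin d) ℂ}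
    (h : IsPureStateParametrization d Θ ρ) {θ : Fin (2 * (d - 1)) → ℝ} (hθ : θ ∈ Θ)
    {φ : Fin d → ℂ} (hφ : star φ ⬝ᵥ φ = 1) (hρ : ρ θ = Matrix.vecMulVec φ (star φ))
    {X : Type*} [MeasurableSpace X] (M : POVM X (Fin N → Fin d)) (k l : Fin (2 * (d - 1))) :
    averageInformation M ρ θ k l =
      (N : ℝ)⁻¹ * fisherForm M φ (partialDeriv ρ θ k *ᵥ φ) (partialDeriv ρ θ l *ᵥ φ) := by
  simp only [averageInformation, fisherInformation, Matrix.smul_apply, Matrix.of_apply, smul_eq_mul]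
  congr 1
  refine integral_congr_ae (M.density_isHermitian.mono fun x hx => ?_)
  simp only [fderiv_trace_tensorPower_mul h hθ hφ hρ _ hx]
  rw [hρ, tensorPower_vecMulVec, trace_vecMulVec_mul]

/-! ### Real bases of the tangent space and their duals -/

theorem star_real_smul_dotProduct {ι : Type*} [Fintype ι] (c : ℝ) (a b : ι → ℂ) :
    star (c • a) ⬝ᵥ b = c * (star a ⬝ᵥ b) := by
  rw [star_smul, star_trivial, smul_dotProduct, Complex.real_smul]

theorem dotProduct_real_smul {ι : Type*} [Fintype ι] (c : ℝ) (a b : ι → ℂ) :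
    a ⬝ᵥ (c • b) = c * (a ⬝ᵥ b) := by
  rw [dotProduct_smul, Complex.real_smul]

theorem re_star_dotProduct_comm {ι : Type*} [Fintype ι] (a b : ι → ℂ) :
    (star a ⬝ᵥ b).re = (star b ⬝ᵥ a).re := by
  rw [star_dotProduct_comm]; simp

theorem star_dotProduct_self_eq {ι : Type*} [Fintype ι] (a : ι → ℂ) :
    star a ⬝ᵥ a = ((∑ i, Complex.normSq (a i) : ℝ) : ℂ) := by
  simp only [dotProduct, Pi.star_apply, Complex.star_def, ← Complex.normSq_eq_conj_mul_self,
    Complex.ofReal_sum]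

theorem re_star_dotProduct_self_nonneg {ι : Type*} [Fintype ι] (a : ι → ℂ) :
    0 ≤ (star a ⬝ᵥ a).re := by
  rw [star_dotProduct_self_eq, Complex.ofReal_re]
  exact Finset.sum_nonneg fun i _ => Complex.normSq_nonneg _

theorem eq_zero_of_re_star_dotProduct_self {ι : Type*} [Fintype ι] {a : ι → ℂ}
    (h : (star a ⬝ᵥ a).re = 0) : a = 0 := by
  rw [star_dotProduct_self_eq, Complex.ofReal_re,
    Finset.sum_eq_zero_iff_of_nonneg fun i _ => Complex.normSq_nonneg _] at h
  ext i
  exact Complex.normSq_eq_zero.1 (h i (Finset.mem_univ i))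

theorem normSq_star_dotProduct_le {ι : Type*} [Fintype ι] (a b : ι → ℂ) :
    Complex.normSq (star a ⬝ᵥ b) ≤ (star a ⬝ᵥ a).re * (star b ⬝ᵥ b).re := by
  rw [star_dotProduct_self_eq, star_dotProduct_self_eq, Complex.ofReal_re, Complex.ofReal_re,
    Complex.normSq_eq_norm_sq]
  simp only [Complex.normSq_eq_norm_sq]
  refine le_trans ?_ (Finset.sum_mul_sq_le_sq_mul_sq _ _ _)
  gcongr
  refine (norm_sum_le _ _).trans_eq (Finset.sum_congr rfl fun i _ => ?_)
  simp

theorem normSq_le_of_posSemidef {ι : Type*} [Fintype ι] {m : Matrix ι ι ℂ} (hm : m.PosSemidef)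
    (a b : ι → ℂ) : Complex.normSq (star a ⬝ᵥ m *ᵥ b) ≤
      (star a ⬝ᵥ m *ᵥ a).re * (star b ⬝ᵥ m *ᵥ b).re := by
  obtain ⟨C, rfl⟩ := exists_conjTranspose_mul_self hm
  have h : ∀ x y : ι → ℂ, star x ⬝ᵥ (Cᴴ * C) *ᵥ y = star (C *ᵥ x) ⬝ᵥ (C *ᵥ y) := fun x y => by
    rw [Matrix.star_mulVec, ← Matrix.mulVec_mulVec, Matrix.dotProduct_mulVec]
  simp only [h]
  exact normSq_star_dotProduct_le _ _

/-- `v` spans over `ℝ` the orthogonal complement of the unit vector `φ`, and `y` is a dual family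
in the sense that `2 Re ⟨v_i, y_j⟩ = δ_ij`. -/
structure IsDualFrame {n d : ℕ} (φ : Fin d → ℂ) (v y : Fin n → Fin d → ℂ) : Prop where
  unit : star φ ⬝ᵥ φ = 1
  orth : ∀ i, star φ ⬝ᵥ v i = 0
  orth' : ∀ i, star φ ⬝ᵥ y i = 0
  span : ∀ w, star φ ⬝ᵥ w = 0 → ∃ c : Fin n → ℝ, w = ∑ i, c i • v i
  dual : ∀ i j, 2 * (star (v i) ⬝ᵥ y j).re = if i = j then 1 else 0

namespace IsDualFrame

variable {n d : ℕ} {φ : Fin d → ℂ} {v y : Fin n → Fin d → ℂ}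

theorem sum_smul (h : IsDualFrame φ v y) {w : Fin d → ℂ} (hw : star φ ⬝ᵥ w = 0) :
    ∑ i, (2 * (star (y i) ⬝ᵥ w).re) • v i = w := by
  obtain ⟨c, hc⟩ := h.span w hw
  conv_rhs => rw [hc]
  refine Finset.sum_congr rfl fun i _ => ?_
  congr 1
  rw [hc, dotProduct_sum, Complex.re_sum, Finset.mul_sum]
  rw [Finset.sum_eq_single i]
  · rw [dotProduct_real_smul, Complex.re_ofReal_mul, re_star_dotProduct_comm]
    have := h.dual i i
    rw [if_pos rfl] at this
    linear_combination c i * this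
  · intro j _ hj
    rw [dotProduct_real_smul, Complex.re_ofReal_mul, re_star_dotProduct_comm]
    have := h.dual j i
    rw [if_neg hj] at this
    linear_combination c j * this
  · simp

/-- The space φ^⊥ is closed under multiplication by i, and ⟨y, w⟩ = Re⟨y, w⟩ + i Re⟨y, -iw⟩. The sum
is therefore half the real expansion of w plus i/2 times that of -iw, i.e. w/2 + w/2. This is why
the coefficient 2 of the real expansion disappears. -/
theorem sum_complex_smul (h : IsDualFrame φ v y) {w : Fin d → ℂ} (hw : star φ ⬝ᵥ w = 0) :
    ∑ i, (star (y i) ⬝ᵥ w) • v i = w := by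
  have h1 := h.sum_smul hw
  have h2 := h.sum_smul (w := (-Complex.I) • w) (by rw [dotProduct_smul, hw, smul_zero])
  have h3 : ∀ i, (star (y i) ⬝ᵥ w) • v i = (1 / 2 : ℂ) • ((2 * (star (y i) ⬝ᵥ w).re) • v i) +
      (1 / 2 * Complex.I : ℂ) • ((2 * (star (y i) ⬝ᵥ (-Complex.I) • w).re) • v i) := by
    intro i
    ext a
    rw [dotProduct_smul]
    simp only [Pi.smul_apply, Pi.add_apply, smul_eq_mul, Complex.real_smul]
    have : star (y i) ⬝ᵥ w = ((star (y i) ⬝ᵥ w).re : ℂ) + (-Complex.I * (star (y i) ⬝ᵥ w)).re *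
        Complex.I := by
      apply Complex.ext <;> simp
    nth_rewrite 1 [this]
    push_cast
    ring
  simp only [h3]
  rw [Finset.sum_add_distrib, ← Finset.smul_sum, ← Finset.smul_sum, h1, h2, smul_smul, ← add_smul,
    mul_assoc, mul_neg, Complex.I_mul_I]
  norm_num

/-- The difference of the two sides lies in φ^⊥. Expanding any z in φ^⊥ in the basis v shows it to
be orthogonal to z in the real inner product; take z to be the difference itself. -/
theorem sum_dual_smul (h : IsDualFrame φ v y) {w : Fin d → ℂ} (hw : star φ ⬝ᵥ w = 0) :
    ∑ i, (2 * (star (v i) ⬝ᵥ w).re) • y i = w := by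
  set u := ∑ i, (2 * (star (v i) ⬝ᵥ w).re) • y i with hu
  have huo : star φ ⬝ᵥ (u - w) = 0 := by
    rw [dotProduct_sub, hw, hu, dotProduct_sum]
    simp [h.orth']
  have key : ∀ z, star φ ⬝ᵥ z = 0 → (star z ⬝ᵥ (u - w)).re = 0 := by
    intro z hz
    have h1 : (star z ⬝ᵥ w).re = ∑ i, 2 * (star (y i) ⬝ᵥ z).re * (star (v i) ⬝ᵥ w).re := by
      conv_lhs => rw [← h.sum_smul hz]
      rw [star_sum, sum_dotProduct, Complex.re_sum]
      exact Finset.sum_congr rfl fun i _ => by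
        rw [star_real_smul_dotProduct, Complex.re_ofReal_mul]
    rw [dotProduct_sub, Complex.sub_re, h1, hu, dotProduct_sum, Complex.re_sum, sub_eq_zero]
    refine Finset.sum_congr rfl fun i _ => ?_
    rw [dotProduct_real_smul, Complex.re_ofReal_mul, re_star_dotProduct_comm z]
    ring
  exact sub_eq_zero.1 (eq_zero_of_re_star_dotProduct_self (key _ huo))

theorem sum_re_dual (h : IsDualFrame φ v y) : ∑ i, (star (v i) ⬝ᵥ y i).re = n / 2 := by
  have : ∀ i, (star (v i) ⬝ᵥ y i).re = 1 / 2 := fun i => by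
    have := h.dual i i
    rw [if_pos rfl] at this
    linarith
  simp [this]
  ring

end IsDualFrame

/-- The complement of φ is the kernel of a nonzero functional on ℂ^d, of complex dimension d - 1 and
real dimension 2(d - 1), which is exactly the number of parameters. -/
theorem exists_real_combination {d : ℕ} {φ : Fin d → ℂ} (hφ : star φ ⬝ᵥ φ = 1)
    {v : Fin (2 * (d - 1)) → Fin d → ℂ} (hv : ∀ i, star φ ⬝ᵥ v i = 0)
    (hli : LinearIndependent ℝ v) (w : Fin d → ℂ) (hw : star φ ⬝ᵥ w = 0) :
    ∃ c : Fin (2 * (d - 1)) → ℝ, w = ∑ i, c i • v i := by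
  let f : (Fin d → ℂ) →ₗ[ℂ] ℂ := dotProductBilin ℂ ℂ (star φ)
  have hf : ∀ w, f w = star φ ⬝ᵥ w := fun w => rfl
  have hsurj : Function.Surjective f := fun c => ⟨c • φ, by rw [hf, dotProduct_smul, hφ]; simp⟩
  have hdim := f.finrank_range_add_finrank_ker
  rw [LinearMap.range_eq_top.2 hsurj, finrank_top, Module.finrank_self, Module.finrank_fin_fun] at hdim
  have hdimR : Module.finrank ℝ (LinearMap.ker f) = 2 * (d - 1) := by
    rw [finrank_real_of_complex]
    omega
  let v' : Fin (2 * (d - 1)) → LinearMap.ker f := fun i => ⟨v i, hv i⟩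
  have hli' : LinearIndependent ℝ v' :=
    LinearIndependent.of_comp ((LinearMap.ker f).subtype.restrictScalars ℝ) hli
  have hspan := hli'.span_eq_top_of_card_eq_finrank' (by rw [hdimR, Fintype.card_fin])
  have hmem : (⟨w, hw⟩ : LinearMap.ker f) ∈ Submodule.span ℝ (Set.range v') := by
    rw [hspan]; exact Submodule.mem_top
  obtain ⟨c, hc⟩ := (Submodule.mem_span_range_iff_exists_fun ℝ).1 hmem
  refine ⟨c, ?_⟩
  have := congrArg Subtype.val hc
  refine Eq.trans this.symm ?_
  simp [v']

/-- The real part of the Gram matrix. -/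
def reGram {n d : ℕ} (v : Fin n → Fin d → ℂ) : Matrix (Fin n) (Fin n) ℝ :=
  Matrix.of fun i j => (star (v i) ⬝ᵥ v j).re

theorem reGram_apply {n d : ℕ} (v : Fin n → Fin d → ℂ) (i j : Fin n) :
    reGram v i j = (star (v i) ⬝ᵥ v j).re := rfl

theorem reGram_isSymm {n d : ℕ} (v : Fin n → Fin d → ℂ) : (reGram v).IsSymm := by
  ext i j
  exact re_star_dotProduct_comm _ _

theorem dotProduct_reGram_mulVec {n d : ℕ} (v : Fin n → Fin d → ℂ) (x : Fin n → ℝ) :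
    x ⬝ᵥ reGram v *ᵥ x = (star (∑ i, x i • v i) ⬝ᵥ ∑ i, x i • v i).re := by
  simp only [star_sum, sum_dotProduct, dotProduct_sum, star_real_smul_dotProduct,
    dotProduct_real_smul, Complex.re_sum, Complex.re_ofReal_mul]
  change ∑ i, x i * ∑ j, (star (v i) ⬝ᵥ v j).re * x j = _
  simp only [Finset.mul_sum]
  refine Finset.sum_congr rfl fun i _ => Finset.sum_congr rfl fun j _ => ?_
  rw [re_star_dotProduct_comm (v j)]
  ring

theorem reGram_posDef {n d : ℕ} {v : Fin n → Fin d → ℂ} (hli : LinearIndependent ℝ v) :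
    (reGram v).PosDef := by
  refine Matrix.PosDef.of_dotProduct_mulVec_pos ?_ fun x hx => ?_
  · rw [Matrix.IsHermitian, Matrix.conjTranspose_eq_transpose_of_trivial]
    exact reGram_isSymm v
  · rw [star_trivial, dotProduct_reGram_mulVec]
    refine lt_of_le_of_ne (re_star_dotProduct_self_nonneg _) fun h => hx ?_
    have h0 := eq_zero_of_re_star_dotProduct_self h.symm
    ext i
    exact Fintype.linearIndependent_iff.1 hli x h0 i

theorem exists_dualFrame {d : ℕ} {φ : Fin d → ℂ} (hφ : star φ ⬝ᵥ φ = 1)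
    {v : Fin (2 * (d - 1)) → Fin d → ℂ} (hv : ∀ i, star φ ⬝ᵥ v i = 0)
    (hli : LinearIndependent ℝ v) : ∃ y, IsDualFrame φ v y := by
  -- The inverse real Gram matrix gives the dual basis for Re⟨·,·⟩; the factor 1/2 adapts it to the
  -- pairing 2 Re⟨·,·⟩.
  refine ⟨fun j => ∑ k, ((1 / 2 : ℝ) * (reGram v)⁻¹ k j) • v k, hφ, hv, fun j => ?_,
    exists_real_combination hφ hv hli, fun i j => ?_⟩
  · simp [dotProduct_sum, hv]
  · have h := congrFun (congrFun (Matrix.mul_nonsing_inv (reGram v)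
      ((reGram v).isUnit_iff_isUnit_det.1 (reGram_posDef hli).isUnit)) i) j
    rw [Matrix.mul_apply, Matrix.one_apply] at h
    rw [← h, dotProduct_sum, Complex.re_sum, Finset.mul_sum]
    refine Finset.sum_congr rfl fun k _ => ?_
    rw [dotProduct_real_smul, Complex.re_ofReal_mul, reGram_apply]
    ring

/-- The tangent vector `|∂_kρ φ⟩` of a pure state model at the state `|φ⟩⟨φ|`. -/
def tangentVec {n d : ℕ} (ρ : (Fin n → ℝ) → Matrix (Fin d) (Fin d) ℂ) (θ : Fin n → ℝ)
    (φ : Fin d → ℂ) (k : Fin n) : Fin d → ℂ := partialDeriv ρ θ k *ᵥ φ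

/-- `tangentMatrix` as a real linear map. -/
def tangentMatrixₗ {d : ℕ} (φ : Fin d → ℂ) : (Fin d → ℂ) →ₗ[ℝ] Matrix (Fin d) (Fin d) ℂ where
  toFun := tangentMatrix φ
  map_add' := fun a b => by
    ext i j
    simp [tangentMatrix, Matrix.vecMulVec_apply]
    ring
  map_smul' := fun c a => by
    ext i j
    simp [tangentMatrix, Matrix.vecMulVec_apply, mul_left_comm]

theorem linearIndependent_tangentVec {d : ℕ} {Θ : Set (Fin (2 * (d - 1)) → ℝ)}
    {ρ : (Fin (2 * (d - 1)) → ℝ) → Matrix (Fin d) (Fin d) ℂ}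
    (h : IsPureStateParametrization d Θ ρ) {θ : Fin (2 * (d - 1)) → ℝ} (hθ : θ ∈ Θ)
    {φ : Fin d → ℂ} (hφ : star φ ⬝ᵥ φ = 1) (hρ : ρ θ = Matrix.vecMulVec φ (star φ)) :
    LinearIndependent ℝ (tangentVec ρ θ φ) := by
  refine LinearIndependent.of_comp (tangentMatrixₗ φ) ?_
  convert h.regular θ hθ using 1
  ext k : 1
  exact (partialDeriv_eq_tangentMatrix h hθ hφ hρ k).2.symm

/-! ### The Helstrom information -/

/-- With a the increment and b the differential, |a|² - |b|² = Re((a - b)·conj(a + b)), a product of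
an o(‖θ' - θ‖) and an O(‖θ' - θ‖). -/
theorem normSq_sub_isLittleO {n : ℕ} {f : (Fin n → ℝ) → ℂ} {θ : Fin n → ℝ}
    (hf : DifferentiableAt ℝ f θ) :
    (fun θ' => Complex.normSq (f θ' - f θ) - Complex.normSq (fderiv ℝ f θ (θ' - θ)))
      =o[nhds θ] fun θ' => ‖θ' - θ‖ ^ 2 := by
  have h1 : (fun θ' => f θ' - f θ - fderiv ℝ f θ (θ' - θ)) =o[nhds θ] fun θ' => θ' - θ :=
    hf.hasFDerivAt.isLittleO
  have h2 : (fun θ' => f θ' - f θ) =O[nhds θ] fun θ' => θ' - θ := hf.isBigO_sub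
  have h3 : (fun θ' => fderiv ℝ f θ (θ' - θ)) =O[nhds θ] fun θ' => θ' - θ :=
    (fderiv ℝ f θ).isBigO_comp _ _
  have h4 : (fun θ' => starRingEnd ℂ (f θ' - f θ + fderiv ℝ f θ (θ' - θ)))
      =O[nhds θ] fun θ' => θ' - θ := by
    refine (Asymptotics.isBigO_norm_left.1 ?_)
    simp only [RCLike.norm_conj]
    exact (h2.add h3).norm_left
  have h5 := h1.norm_right.mul_isBigO h4.norm_right
  refine Asymptotics.IsLittleO.congr' (Complex.reCLM.isBigO_comp _ _ |>.trans_isLittleO h5) ?_ ?_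
  · refine Filter.Eventually.of_forall fun θ' => ?_
    simp only [Complex.reCLM_apply, Complex.normSq_apply, Complex.mul_re, Complex.conj_re,
      Complex.conj_im, Complex.sub_re, Complex.sub_im, Complex.add_re, Complex.add_im]
    ring
  · exact Filter.Eventually.of_forall fun θ' => by simp only; ring

/-- 1 - Fid is half the sum of the squared entries of ρ(θ') - ρ(θ). Each increment may be replaced
by its differential, so first derivatives suffice for this second-order expansion. The differential
is the tangent matrix of w = ∑ (θ' - θ)_k v_k, whose squared entries sum to 2‖w‖². -/
theorem isHelstromInformation_reGram {d : ℕ} {Θ : Set (Fin (2 * (d - 1)) → ℝ)}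
    {ρ : (Fin (2 * (d - 1)) → ℝ) → Matrix (Fin d) (Fin d) ℂ}
    (h : IsPureStateParametrization d Θ ρ) {θ : Fin (2 * (d - 1)) → ℝ} (hθ : θ ∈ Θ)
    {φ : Fin d → ℂ} (hφ : star φ ⬝ᵥ φ = 1) (hρ : ρ θ = Matrix.vecMulVec φ (star φ)) :
    IsHelstromInformation ρ θ ((4 : ℝ) • reGram (tangentVec ρ θ φ)) := by
  refine ⟨(reGram_isSymm _).smul 4, ?_⟩
  set v := tangentVec ρ θ φ with hvdef
  have hd := fun i j => differentiableAt_entry h hθ i j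
  have h1 := Asymptotics.IsLittleO.fun_sum (s := Finset.univ)
    fun (i : Fin d) _ => Asymptotics.IsLittleO.fun_sum (s := Finset.univ)
      fun (j : Fin d) _ => normSq_sub_isLittleO (hd i j)
  refine (h1.const_mul_left (1 / 2)).congr' ?_ Filter.EventuallyEq.rfl
  have hev : ∀ᶠ θ' in nhds θ, IsPureState (ρ θ') :=
    Filter.eventually_of_mem (h.isOpen.mem_nhds hθ) h.isPureState
  filter_upwards [hev] with θ' hθ'
  have hp := h.isPureState θ hθ
  have hnorm : ∀ A : Matrix (Fin d) (Fin d) ℂ, A.IsHermitian →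
      (A * A).trace.re = ∑ i, ∑ j, Complex.normSq (A i j) := by
    intro A hA
    simp only [Matrix.trace, Matrix.diag, Matrix.mul_apply, Complex.re_sum]
    refine Finset.sum_congr rfl fun i _ => Finset.sum_congr rfl fun j _ => ?_
    rw [← hA.apply j i, Complex.star_def, Complex.mul_conj, Complex.ofReal_re]
  set w : Fin d → ℂ := ∑ k, (θ' - θ) k • v k with hw
  have hvo : ∀ k, star φ ⬝ᵥ v k = 0 := fun k => (partialDeriv_eq_tangentMatrix h hθ hφ hρ k).1
  have hwo : star φ ⬝ᵥ w = 0 := by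
    rw [hw, dotProduct_sum]
    exact Finset.sum_eq_zero fun k _ => by rw [dotProduct_real_smul, hvo, mul_zero]
  have hL : ∀ i j, fderiv ℝ (fun θ' => ρ θ' i j) θ (θ' - θ) = tangentMatrix φ w i j := by
    intro i j
    have h2 : tangentMatrix φ w = ∑ k, (θ' - θ) k • tangentMatrix φ (v k) := by
      change tangentMatrixₗ φ w = _
      rw [hw, map_sum]
      exact Finset.sum_congr rfl fun k _ => map_smul _ _ _
    rw [h2, Matrix.sum_apply]
    refine (LinearMap.pi_apply_eq_sum_univ (fderiv ℝ (fun θ' => ρ θ' i j) θ).toLinearMap _).trans ?_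
    refine Finset.sum_congr rfl fun k _ => ?_
    rw [Matrix.smul_apply]
    congr 1
    refine Eq.trans ?_ (congrFun (congrFun (partialDeriv_eq_tangentMatrix h hθ hφ hρ k).2 i) j)
    have hs : (fun j => if k = j then (1 : ℝ) else 0) = Pi.single k 1 := by
      ext a
      simp [Pi.single_apply, eq_comm]
    simp only [partialDeriv, Matrix.of_apply, ← hs]
    rfl
  have h3 : ∑ i, ∑ j, Complex.normSq (ρ θ' i j - ρ θ i j) = 2 - 2 * (ρ θ' * ρ θ).trace.re := by
    have h4 := hnorm (ρ θ' - ρ θ) (hθ'.1.1.sub hp.1.1)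
    rw [hθ'.trace_sub_mul_sub hp] at h4
    simpa using h4.symm
  have h5 : ∑ i, ∑ j, Complex.normSq (fderiv ℝ (fun θ' => ρ θ' i j) θ (θ' - θ)) =
      2 * (star w ⬝ᵥ w).re := by
    simp only [hL]
    rw [← hnorm]
    · rw [tangentMatrix, Matrix.add_mul, Matrix.mul_add, Matrix.mul_add]
      have hwo' : star w ⬝ᵥ φ = 0 := by rw [star_dotProduct_comm, hwo, star_zero]
      simp only [Matrix.vecMulVec_mul_vecMulVec, hwo, hwo', hφ, Matrix.trace_add,
        Matrix.trace_vecMulVec, dotProduct_smul, dotProduct_comm w (star w),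
        dotProduct_comm φ (star φ)]
      simp
      ring
    · ext i j
      simp [tangentMatrix, Matrix.vecMulVec_apply]
      ring
  simp only [Finset.sum_sub_distrib, h3, h5]
  rw [fidelity_eq hθ' hp, Matrix.smul_mulVec, dotProduct_smul, dotProduct_reGram_mulVec, ← hw]
  simp only [smul_eq_mul]
  ring

/-- The quadratic form of the difference is homogeneous of degree 2 and of order o(‖x‖²) at the same
time, so it vanishes along every line. Symmetry and polarization then kill the matrix. -/
theorem IsHelstromInformation.unique {n d : ℕ} {ρ : (Fin n → ℝ) → Matrix (Fin d) (Fin d) ℂ}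
    {θ : Fin n → ℝ} {H H' : Matrix (Fin n) (Fin n) ℝ} (h : IsHelstromInformation ρ θ H)
    (h' : IsHelstromInformation ρ θ H') : H = H' := by
  set D := H' - H with hD
  have hDs : D.IsSymm := h'.1.sub h.1
  have h1 := h.2.sub h'.2
  have h2 : (fun θ' => (1 / 4 : ℝ) * ((θ' - θ) ⬝ᵥ D *ᵥ (θ' - θ))) =o[nhds θ]
      fun θ' => ‖θ' - θ‖ ^ 2 :=
    h1.congr (fun θ' => by rw [hD, Matrix.sub_mulVec, dotProduct_sub]; ring) fun _ => rfl
  have hq : ∀ x : Fin n → ℝ, x ⬝ᵥ D *ᵥ x = 0 := by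
    intro x
    have ht : Filter.Tendsto (fun t : ℝ => θ + t • x) (nhdsWithin 0 {0}ᶜ) (nhds θ) := by
      have : Continuous fun t : ℝ => θ + t • x := by fun_prop
      simpa using (this.tendsto 0).mono_left nhdsWithin_le_nhds
    have h3 := h2.comp_tendsto ht
    have h4 : (fun _ : ℝ => (1 / 4 : ℝ) * (x ⬝ᵥ D *ᵥ x)) =o[nhdsWithin 0 {0}ᶜ]
        fun _ : ℝ => ‖x‖ ^ 2 := by
      refine ((Asymptotics.isBigO_refl (fun t : ℝ => (t ^ 2)⁻¹) _).mul_isLittleO h3).congr' ?_ ?_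
      · filter_upwards [self_mem_nhdsWithin] with t ht
        have ht0 : t ≠ 0 := ht
        simp only [Function.comp, add_sub_cancel_left, Matrix.mulVec_smul, dotProduct_smul,
          smul_dotProduct, smul_eq_mul]
        field_simp
      · filter_upwards [self_mem_nhdsWithin] with t ht
        have ht0 : t ≠ 0 := ht
        simp only [Function.comp, add_sub_cancel_left, norm_smul, mul_pow, Real.norm_eq_abs, sq_abs]
        field_simp
    have h5 := Asymptotics.isLittleO_const_const_iff.1 h4
    linarith
  have hb : ∀ i j, D i j = 0 := by
    intro i j
    have h3 := hq (Pi.single i 1 + Pi.single j 1)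
    have h4 := hq (Pi.single i 1)
    have h5 := hq (Pi.single j 1)
    have h6 := hDs.apply i j
    simp [Matrix.mulVec_add, add_dotProduct, dotProduct_add] at h3 h4 h5
    linarith
  ext i j
  have := hb i j
  rw [hD, Matrix.sub_apply] at this
  linarith

/-! ### The Holevo bound -/

theorem fderiv_trace_mul {d : ℕ} {Θ : Set (Fin (2 * (d - 1)) → ℝ)}
    {ρ : (Fin (2 * (d - 1)) → ℝ) → Matrix (Fin d) (Fin d) ℂ}
    (h : IsPureStateParametrization d Θ ρ) {θ : Fin (2 * (d - 1)) → ℝ} (hθ : θ ∈ Θ)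
    {φ : Fin d → ℂ} (hφ : star φ ⬝ᵥ φ = 1) (hρ : ρ θ = Matrix.vecMulVec φ (star φ))
    (k : Fin (2 * (d - 1))) {B : Matrix (Fin d) (Fin d) ℂ} (hB : B.IsHermitian) :
    fderiv ℝ (fun θ' => (ρ θ' * B).trace.re) θ (Pi.single k 1) =
      2 * (star (tangentVec ρ θ φ k) ⬝ᵥ B *ᵥ φ).re := by
  have h2 : HasFDerivAt (fun θ' => (ρ θ' * B).trace)
      (∑ i, ∑ j, B j i • fderiv ℝ (fun θ' => ρ θ' i j) θ) θ := by
    simp only [Matrix.trace, Matrix.diag, Matrix.mul_apply]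
    exact HasFDerivAt.fun_sum fun i _ => HasFDerivAt.fun_sum fun j _ =>
      (differentiableAt_entry h hθ i j).hasFDerivAt.mul_const (B j i)
  have h4 := congrArg (fun L => L (Pi.single k 1)) (Complex.reCLM.hasFDerivAt.comp θ h2).fderiv
  refine h4.trans ?_
  have h5 : (star (tangentVec ρ θ φ k) ⬝ᵥ B *ᵥ φ).re = (star φ ⬝ᵥ B *ᵥ tangentVec ρ θ φ k).re := by
    rw [re_star_dotProduct_comm, Matrix.star_mulVec, hB.eq, Matrix.dotProduct_mulVec]
  rw [h5, ← trace_tangent_mul hB]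
  have hA := (partialDeriv_eq_tangentMatrix h hθ hφ hρ k).2
  rw [tangentMatrix] at hA
  rw [tangentVec, ← hA]
  simp only [ContinuousLinearMap.comp_apply, Complex.reCLM_apply]
  congr 1
  simp only [Matrix.trace, Matrix.diag, Matrix.mul_apply, sum_apply, smul_apply, smul_eq_mul]
  exact Finset.sum_congr rfl fun I _ => Finset.sum_congr rfl fun J _ => mul_comm _ _

theorem holevoZ_apply {n d : ℕ} {φ : Fin d → ℂ} {X : Fin n → Matrix (Fin d) (Fin d) ℂ}
    (hX : ∀ j, (X j).IsHermitian) (i j : Fin n) :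
    holevoZ (Matrix.vecMulVec φ (star φ)) X i j = star (X i *ᵥ φ) ⬝ᵥ (X j *ᵥ φ) := by
  rw [holevoZ, Matrix.of_apply, Matrix.mul_assoc, trace_vecMulVec_mul, Matrix.star_mulVec, (hX i).eq,
    ← Matrix.mulVec_mulVec, Matrix.dotProduct_mulVec]

/-- The complex Gram matrix. -/
def gram {n d : ℕ} (v : Fin n → Fin d → ℂ) : Matrix (Fin n) (Fin n) ℂ :=
  Matrix.of fun i j => star (v i) ⬝ᵥ v j

theorem gram_posSemidef {n d : ℕ} (v : Fin n → Fin d → ℂ) : (gram v).PosSemidef := by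
  have : gram v = (Matrix.of fun a i => v i a)ᴴ * (Matrix.of fun a i => v i a) := by
    ext i j
    simp [gram, Matrix.mul_apply, dotProduct]
  rw [this]
  exact Matrix.posSemidef_conjTranspose_mul_self _

/-- The complex expansion of y_i in the basis v collapses the trace to ∑⟨v_i, y_i⟩, and each term
has real part 1/2. -/
theorem IsDualFrame.trace_gram_mul_gram_re {n d : ℕ} {φ : Fin d → ℂ} {v y : Fin n → Fin d → ℂ}
    (h : IsDualFrame φ v y) : (gram y * gram v).trace.re = n / 2 := by
  rw [← h.sum_re_dual, ← Complex.re_sum]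
  congr 1
  rw [Matrix.trace_mul_comm]
  simp only [Matrix.trace, Matrix.diag, Matrix.mul_apply]
  refine Finset.sum_congr rfl fun i _ => ?_
  have := congrArg (fun z => star (v i) ⬝ᵥ z) (h.sum_complex_smul (h.orth' i))
  simp only [dotProduct_sum, dotProduct_smul, smul_eq_mul] at this
  rw [← this]
  exact Finset.sum_congr rfl fun j _ => mul_comm _ _

/-- Duality determines the relevant part of X completely, and V ≥ Z(X) is tested against the Gram
matrix of v. Its real part is the weight matrix ¼H, while its imaginary part is invisible to a real
V but not to Z(X). -/
theorem holevoBound_eq {d : ℕ} [NeZero d] {Θ : Set (Fin (2 * (d - 1)) → ℝ)}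
    {ρ : (Fin (2 * (d - 1)) → ℝ) → Matrix (Fin d) (Fin d) ℂ}
    (h : IsPureStateParametrization d Θ ρ) {θ : Fin (2 * (d - 1)) → ℝ} (hθ : θ ∈ Θ)
    {φ : Fin d → ℂ} (hφ : star φ ⬝ᵥ φ = 1) (hρ : ρ θ = Matrix.vecMulVec φ (star φ)) :
    holevoBound ρ θ (reGram (tangentVec ρ θ φ)) = (((d : ℝ) - 1 : ℝ) : EReal) := by
  set v := tangentVec ρ θ φ with hvdef
  have hvo : ∀ k, star φ ⬝ᵥ v k = 0 := fun k => (partialDeriv_eq_tangentMatrix h hθ hφ hρ k).1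
  have hd1 : ((2 * (d - 1) : ℕ) : ℝ) / 2 = (d : ℝ) - 1 := by
    rw [Nat.cast_mul, Nat.cast_sub (NeZero.one_le)]
    push_cast; ring
  have hVre : ∀ (V : Matrix (Fin (2 * (d - 1))) (Fin (2 * (d - 1))) ℝ),
      (V.map Complex.ofReal * gram v).trace.re = (reGram v * V).trace := by
    intro V
    rw [Matrix.trace_mul_comm (reGram v)]
    simp only [Matrix.trace, Matrix.diag, Matrix.mul_apply, Complex.re_sum, Matrix.map_apply,
      Complex.re_ofReal_mul]
    rfl
  apply le_antisymm
  · obtain ⟨y, hy⟩ := exists_dualFrame hφ hvo (linearIndependent_tangentVec h hθ hφ hρ)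
    have hXφ : ∀ j, tangentMatrix φ (y j) *ᵥ φ = y j := fun j => by
      have : star (y j) ⬝ᵥ φ = 0 := by rw [star_dotProduct_comm, hy.orth', star_zero]
      rw [tangentMatrix, Matrix.add_mulVec, Matrix.vecMulVec_mulVec, Matrix.vecMulVec_mulVec, hφ,
        this]
      simp
    have hXh : ∀ j, (tangentMatrix φ (y j)).IsHermitian := fun j => by
      ext a b
      simp [tangentMatrix, Matrix.vecMulVec_apply]
      ring
    -- For these X the matrix Z(X) is the Gram matrix of y. With V twice its real part, V - Z(X) is
    -- the complex conjugate of Z(X), hence positive semidefinite.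
    have hF : IsHolevoFeasible ρ θ (fun j => tangentMatrix φ (y j)) ((2 : ℝ) • reGram y) := by
      refine ⟨hXh, fun i j => ?_, (reGram_isSymm y).smul 2, ?_⟩
      · rw [fderiv_trace_mul h hθ hφ hρ i (hXh j), hXφ]
        exact hy.dual i j
      · have : ((2 : ℝ) • reGram y).map Complex.ofReal - holevoZ (ρ θ) (fun j => tangentMatrix φ (y j))
            = (gram y)ᵀ := by
          ext i j
          rw [hρ, Matrix.sub_apply, holevoZ_apply hXh, hXφ, hXφ, Matrix.transpose_apply, gram,
            Matrix.of_apply, star_dotProduct_comm (y j)]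
          apply Complex.ext
          · simp [reGram_apply]; ring
          · simp
        rw [this]
        exact (gram_posSemidef y).transpose
    have hle : holevoBound ρ θ (reGram v) ≤ ((reGram v * ((2 : ℝ) • reGram y)).trace : ℝ) :=
      iInf_le_of_le _ (iInf_le_of_le _ (iInf_le _ hF))
    refine hle.trans ?_
    rw [EReal.coe_le_coe_iff, ← hd1, ← hy.sum_re_dual]
    refine le_of_eq ?_
    simp only [Matrix.trace, Matrix.diag, Matrix.mul_apply]
    refine Finset.sum_congr rfl fun i _ => ?_
    have := congrArg (fun z => (star (v i) ⬝ᵥ z).re) (hy.sum_smul (hy.orth' i))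
    simp only [dotProduct_sum, dotProduct_real_smul, Complex.re_sum, Complex.re_ofReal_mul] at this
    rw [← this]
    exact Finset.sum_congr rfl fun j _ => mul_comm _ _
  · refine le_iInf fun X => le_iInf fun V => le_iInf fun hF => ?_
    rw [EReal.coe_le_coe_iff]
    -- Split X_jφ into a multiple of φ and a part y_j orthogonal to φ. The unbiasedness constraint
    -- sees only y_j and says that y is dual to v.
    set a : Fin (2 * (d - 1)) → ℂ := fun j => star φ ⬝ᵥ (X j *ᵥ φ) with ha
    set y : Fin (2 * (d - 1)) → Fin d → ℂ := fun j => X j *ᵥ φ - a j • φ with hydef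
    have hyo : ∀ j, star φ ⬝ᵥ y j = 0 := fun j => by
      simp only [hydef, dotProduct_sub, dotProduct_smul, hφ, ha]
      simp
    have hdual : ∀ i j, 2 * (star (v i) ⬝ᵥ y j).re = if i = j then 1 else 0 := by
      intro i j
      rw [← hF.unbiased i j, fderiv_trace_mul h hθ hφ hρ i (hF.isHermitian j)]
      have : star (v i) ⬝ᵥ φ = 0 := by rw [star_dotProduct_comm, hvo, star_zero]
      simp only [hydef, dotProduct_sub, dotProduct_smul, this, smul_zero, sub_zero]
      rfl
    have hy : IsDualFrame φ v y := ⟨hφ, hvo, hyo,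
      exists_real_combination hφ hvo (linearIndependent_tangentVec h hθ hφ hρ), hdual⟩
    -- The multiples of φ only enlarge Z(X), by a positive rank-one matrix, which can be dropped
    -- from the lower bound.
    have hZ : holevoZ (ρ θ) X = gram y + Matrix.vecMulVec (star a) a := by
      ext i j
      have hx : ∀ j, X j *ᵥ φ = y j + a j • φ := fun j => by simp [hydef]
      have hyo' : star (y i) ⬝ᵥ φ = 0 := by rw [star_dotProduct_comm, hyo, star_zero]
      rw [hρ, holevoZ_apply hF.isHermitian, hx, hx, Matrix.add_apply, Matrix.vecMulVec_apply]
      simp only [star_add, star_smul, add_dotProduct, dotProduct_add, smul_dotProduct,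
        dotProduct_smul, hyo, hyo', hφ]
      simp [gram, mul_comm]
    have h1 := POVM.trace_mul_re_nonneg hF.le (gram_posSemidef v)
    have h2 := POVM.trace_mul_re_nonneg (Matrix.posSemidef_vecMulVec_star_self a) (gram_posSemidef v)
    rw [Matrix.sub_mul, hZ, Matrix.add_mul, Matrix.trace_sub, Matrix.trace_add, Complex.sub_re,
      Complex.add_re, hy.trace_gram_mul_gram_re, hVre, hd1] at h1
    linarith

/-! ### The Fisher information of a measurement -/

/-- The projection of the `k`-th unit vector on the orthogonal complement of `φ`. -/
def projVec {d : ℕ} (φ : Fin d → ℂ) (k : Fin d) : Fin d → ℂ := Pi.single k 1 - star (φ k) • φ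

theorem star_dotProduct_projVec {d : ℕ} {φ : Fin d → ℂ} (hφ : star φ ⬝ᵥ φ = 1) (k : Fin d) :
    star φ ⬝ᵥ projVec φ k = 0 := by
  rw [projVec, dotProduct_sub, dotProduct_smul, hφ, dotProduct_single]
  simp

theorem sum_smul_projVec {d : ℕ} (φ w : Fin d → ℂ) :
    ∑ k, w k • projVec φ k = w - (star φ ⬝ᵥ w) • φ := by
  simp only [projVec, smul_sub, Finset.sum_sub_distrib, smul_smul, ← Finset.sum_smul]
  congr 1
  · ext i
    simp [Finset.sum_apply, Pi.single_apply]
  · congr 1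
    exact Finset.sum_congr rfl fun k _ => mul_comm _ _

theorem sum_star_projVec_dotProduct {d : ℕ} {φ : Fin d → ℂ} (hφ : star φ ⬝ᵥ φ = 1) :
    ∑ k, (star (projVec φ k) ⬝ᵥ projVec φ k).re = (d : ℝ) - 1 := by
  have h : ∀ k, star (projVec φ k) ⬝ᵥ projVec φ k = 1 - star (φ k) * φ k := by
    intro k
    have h0 : star (projVec φ k) ⬝ᵥ φ = 0 := by
      rw [star_dotProduct_comm, star_dotProduct_projVec hφ, star_zero]
    nth_rewrite 2 [projVec]
    rw [dotProduct_sub, dotProduct_smul, h0, dotProduct_single, projVec]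
    simp [mul_comm]
  rw [← Complex.re_sum]
  simp only [h, Finset.sum_sub_distrib]
  rw [show ∑ k, star (φ k) * φ k = 1 from hφ]
  simp

/-- Restricted to φ^⊥ the functional a is pairing with some α in φ^⊥. On the left stands the squared
norm of ∑ 2 Re⟨v_i, α⟩ y_i, which is α by the dual expansion; on the right stands ‖α‖² in
coordinates. In this way the contraction with H⁻¹ becomes independent of the basis. -/
theorem IsDualFrame.sum_reGram_mul {n d : ℕ} {φ : Fin d → ℂ} {v y : Fin n → Fin d → ℂ}
    (h : IsDualFrame φ v y) (a : (Fin d → ℂ) →ₗ[ℂ] ℂ) :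
    ∑ i, ∑ j, reGram y i j * (2 * (a (v i)).re * (2 * (a (v j)).re)) =
      ∑ k, Complex.normSq (a (projVec φ k)) := by
  set α : Fin d → ℂ := fun k => star (a (projVec φ k)) with hα
  have h1 : ∀ w, star α ⬝ᵥ w = a (w - (star φ ⬝ᵥ w) • φ) := by
    intro w
    rw [← sum_smul_projVec, map_sum]
    refine Finset.sum_congr rfl fun k _ => ?_
    rw [map_smul, smul_eq_mul, mul_comm, hα]
    simp
  have h2 : star φ ⬝ᵥ α = 0 := by
    rw [star_dotProduct_comm, h1, h.unit]
    simp
  have h3 : ∀ i, 2 * (a (v i)).re = 2 * (star (v i) ⬝ᵥ α).re := by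
    intro i
    rw [re_star_dotProduct_comm, h1, h.orth]
    simp
  have h4 := h.sum_dual_smul h2
  have h5 := dotProduct_reGram_mulVec y fun i => 2 * (star (v i) ⬝ᵥ α).re
  rw [h4, star_dotProduct_self_eq, Complex.ofReal_re] at h5
  simp only [hα, Complex.star_def, Complex.normSq_conj] at h5
  rw [← h5]
  simp only [h3]
  change _ = ∑ i, _ * ∑ j, reGram y i j * _
  simp only [Finset.mul_sum]
  exact Finset.sum_congr rfl fun i _ => Finset.sum_congr rfl fun j _ => by
    simp only [hα, Complex.star_def]; ring

/-- The linear functional `w ↦ ⟨φ^{⊗N}| m |D(w)⟩` with `D` the derivative of the tensor power. -/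
def scoreFunctional {d N : ℕ} (φ : Fin d → ℂ) (m : Matrix (Fin N → Fin d) (Fin N → Fin d) ℂ) :
    (Fin d → ℂ) →ₗ[ℂ] ℂ where
  toFun w := star (powVec N φ) ⬝ᵥ m *ᵥ derivVec N φ w
  map_add' v w := by rw [derivVec_add, Matrix.mulVec_add, dotProduct_add]
  map_smul' c w := by rw [derivVec_smul, Matrix.mulVec_smul, dotProduct_smul]; rfl

section

variable {d N : ℕ} {X : Type*} [MeasurableSpace X] (M : POVM X (Fin N → Fin d)) (φ : Fin d → ℂ)

/-- Cauchy–Schwarz for the semidefinite form m. Where the probability density in the denominator is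
zero, the quotient is 0 by convention and the bound still holds. -/
theorem fisher_integrand_bound {m : Matrix (Fin N → Fin d) (Fin N → Fin d) ℂ} (hm : m.PosSemidef)
    (v : Fin d → ℂ) : Complex.normSq (star (powVec N φ) ⬝ᵥ m *ᵥ derivVec N φ v) /
      (star (powVec N φ) ⬝ᵥ m *ᵥ powVec N φ).re ≤
      (star (derivVec N φ v) ⬝ᵥ m *ᵥ derivVec N φ v).re := by
  refine div_le_of_le_mul₀ (hm.re_dotProduct_nonneg _) (hm.re_dotProduct_nonneg _) ?_
  rw [mul_comm]
  exact normSq_le_of_posSemidef hm _ _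

/-- By 4|Re s||Re t| ≤ 2(|s|² + |t|²) and Cauchy–Schwarz, the integrand is dominated by diagonal
values of the quadratic form of the density, which are integrable. -/
theorem integrable_fisher_integrand (v w : Fin d → ℂ) : Integrable (fun x =>
    2 * (star (powVec N φ) ⬝ᵥ M.density x *ᵥ derivVec N φ v).re *
    (2 * (star (powVec N φ) ⬝ᵥ M.density x *ᵥ derivVec N φ w).re) /
      (star (powVec N φ) ⬝ᵥ M.density x *ᵥ powVec N φ).re) M.traceMeasure := by
  have hre : ∀ a b : (Fin N → Fin d) → ℂ,
      Integrable (fun x => (a ⬝ᵥ M.density x *ᵥ b).re) M.traceMeasure := fun a b =>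
    (M.integrable_dotProduct_density a b).re
  have hq := fun v => hre (star (derivVec N φ v)) (derivVec N φ v)
  refine Integrable.mono' (((hq v).add (hq w)).const_mul 2) ?_ ?_
  · exact ((((hre _ _).aestronglyMeasurable.aemeasurable.const_mul 2).mul
      ((hre _ _).aestronglyMeasurable.aemeasurable.const_mul 2)).div
      (hre _ _).aestronglyMeasurable.aemeasurable).aestronglyMeasurable
  · filter_upwards [M.density_posSemidef] with x hx
    have h1 := fisher_integrand_bound φ hx v
    have h2 := fisher_integrand_bound φ hx w
    have hp := hx.re_dotProduct_nonneg (powVec N φ)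
    simp only [RCLike.re_eq_complex_re] at hp
    rw [Real.norm_eq_abs, abs_div, abs_of_nonneg hp]
    refine le_trans (div_le_div_of_nonneg_right
      (c := (star (powVec N φ) ⬝ᵥ M.density x *ᵥ powVec N φ).re)
      (b := 2 * (Complex.normSq (star (powVec N φ) ⬝ᵥ M.density x *ᵥ derivVec N φ v) +
        Complex.normSq (star (powVec N φ) ⬝ᵥ M.density x *ᵥ derivVec N φ w))) ?_ hp) ?_
    · rw [abs_mul, abs_mul, abs_mul, abs_two, Complex.normSq_apply, Complex.normSq_apply]
      set s := (star (powVec N φ) ⬝ᵥ M.density x *ᵥ derivVec N φ v)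
      set t := (star (powVec N φ) ⬝ᵥ M.density x *ᵥ derivVec N φ w)
      nlinarith [sq_nonneg (|s.re| - |t.re|), sq_abs s.re, sq_abs t.re, sq_nonneg s.im,
        sq_nonneg t.im]
    · rw [mul_div_assoc, add_div]
      simp only [Pi.add_apply]
      linarith

/-- This is trace(H⁻¹ I_M) ≤ N(d - 1). Pointwise the left side becomes ∑_k |⟨φ^{⊗N}|m|D_k⟩|²/p, with
D_k the derivative along the projected k-th unit vector and p the outcome density. Cauchy–Schwarz
removes the quotient, m integrates to the identity, and ‖D_k‖² is N times the squared norm of the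
projected vector; these squared norms sum to the rank d - 1 of the projection on φ^⊥. -/
theorem IsDualFrame.sum_reGram_mul_fisherForm_le {n : ℕ} {φ : Fin d → ℂ} {v y : Fin n → Fin d → ℂ}
    (h : IsDualFrame φ v y) :
    ∑ i, ∑ j, reGram y i j * fisherForm M φ (v i) (v j) ≤ N * ((d : ℝ) - 1) := by
  have hq : ∀ k, Integrable (fun x => (star (derivVec N φ (projVec φ k)) ⬝ᵥ M.density x *ᵥ
      derivVec N φ (projVec φ k)).re) M.traceMeasure := fun k =>
    (M.integrable_dotProduct_density _ _).re
  have hqi : ∀ k, ∫ x, (star (derivVec N φ (projVec φ k)) ⬝ᵥ M.density x *ᵥ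
      derivVec N φ (projVec φ k)).re ∂M.traceMeasure =
        N * (star (projVec φ k) ⬝ᵥ projVec φ k).re := fun k => by
    have h1 := integral_re (M.integrable_dotProduct_density (star (derivVec N φ (projVec φ k)))
      (derivVec N φ (projVec φ k)))
    simp only [RCLike.re_eq_complex_re] at h1
    rw [h1, M.integral_dotProduct_density, star_derivVec_dotProduct_self h.unit
      (star_dotProduct_projVec h.unit k)]
    simp
  have hi : ∀ i, Integrable (fun x => ∑ j, reGram y i j *
      (2 * (star (powVec N φ) ⬝ᵥ M.density x *ᵥ derivVec N φ (v i)).re *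
      (2 * (star (powVec N φ) ⬝ᵥ M.density x *ᵥ derivVec N φ (v j)).re) /
      (star (powVec N φ) ⬝ᵥ M.density x *ᵥ powVec N φ).re)) M.traceMeasure := fun i =>
    integrable_finsetSum _ fun j _ =>
      (integrable_fisher_integrand M φ (v i) (v j)).const_mul (reGram y i j)
  calc ∑ i, ∑ j, reGram y i j * fisherForm M φ (v i) (v j)
      = ∫ x, ∑ i, ∑ j, reGram y i j *
          (2 * (star (powVec N φ) ⬝ᵥ M.density x *ᵥ derivVec N φ (v i)).re *
          (2 * (star (powVec N φ) ⬝ᵥ M.density x *ᵥ derivVec N φ (v j)).re) /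
          (star (powVec N φ) ⬝ᵥ M.density x *ᵥ powVec N φ).re) ∂M.traceMeasure := by
        rw [integral_finsetSum _ fun i _ => hi i]
        refine Finset.sum_congr rfl fun i _ => ?_
        rw [integral_finsetSum _ fun j _ =>
          (integrable_fisher_integrand M φ (v i) (v j)).const_mul _]
        exact Finset.sum_congr rfl fun j _ => (integral_const_mul _ _).symm
    _ ≤ ∫ x, ∑ k, (star (derivVec N φ (projVec φ k)) ⬝ᵥ M.density x *ᵥ
          derivVec N φ (projVec φ k)).re ∂M.traceMeasure := by
        refine integral_mono_ae (integrable_finsetSum _ fun i _ => hi i)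
          (integrable_finsetSum _ fun k _ => hq k) ?_
        filter_upwards [M.density_posSemidef] with x hx
        have h1 := h.sum_reGram_mul (scoreFunctional φ (M.density x))
        simp only [← mul_div_assoc, ← Finset.sum_div]
        refine (congrArg (· / _) h1).trans_le ?_
        rw [Finset.sum_div]
        exact Finset.sum_le_sum fun k _ => fisher_integrand_bound φ hx _
    _ = N * ((d : ℝ) - 1) := by
        rw [integral_finsetSum _ fun k _ => hq k]
        simp only [hqi]
        rw [← Finset.mul_sum, sum_star_projVec_dotProduct h.unit]

theorem fisherForm_comm (v w : Fin d → ℂ) : fisherForm M φ v w = fisherForm M φ w v := by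
  simp only [fisherForm]
  congr 1
  ext x
  ring

theorem fisherForm_posSemidef {n : ℕ} (v : Fin n → Fin d → ℂ) :
    (Matrix.of fun i j => fisherForm M φ (v i) (v j)).PosSemidef := by
  refine Matrix.PosSemidef.of_dotProduct_mulVec_nonneg ?_ fun x => ?_
  · ext i j
    simp [fisherForm_comm M φ (v j)]
  · have : star x ⬝ᵥ (Matrix.of fun i j => fisherForm M φ (v i) (v j)) *ᵥ x =
        ∫ z, (∑ i, x i * (2 * (star (powVec N φ) ⬝ᵥ M.density z *ᵥ derivVec N φ (v i)).re)) ^ 2 /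
          (star (powVec N φ) ⬝ᵥ M.density z *ᵥ powVec N φ).re ∂M.traceMeasure := by
      have h1 : ∀ z, (∑ i, x i * (2 * (star (powVec N φ) ⬝ᵥ M.density z *ᵥ
          derivVec N φ (v i)).re)) ^ 2 / (star (powVec N φ) ⬝ᵥ M.density z *ᵥ powVec N φ).re =
          ∑ i, ∑ j, x i * x j *
          (2 * (star (powVec N φ) ⬝ᵥ M.density z *ᵥ derivVec N φ (v i)).re *
          (2 * (star (powVec N φ) ⬝ᵥ M.density z *ᵥ derivVec N φ (v j)).re) /
          (star (powVec N φ) ⬝ᵥ M.density z *ᵥ powVec N φ).re) := by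
        intro z
        rw [sq, Finset.sum_mul_sum, Finset.sum_div]
        refine Finset.sum_congr rfl fun i _ => ?_
        rw [Finset.sum_div]
        exact Finset.sum_congr rfl fun j _ => by ring
      simp only [h1]
      rw [integral_finsetSum _ fun i _ => integrable_finsetSum _ fun j _ =>
          (integrable_fisher_integrand M φ (v i) (v j)).const_mul _]
      change ∑ i, x i * ∑ j, fisherForm M φ (v i) (v j) * x j = _
      refine Finset.sum_congr rfl fun i _ => ?_
      rw [integral_finsetSum _ fun j _ =>
          (integrable_fisher_integrand M φ (v i) (v j)).const_mul _, Finset.mul_sum]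
      refine Finset.sum_congr rfl fun j _ => ?_
      rw [integral_const_mul, fisherForm]
      ring
    rw [this]
    refine integral_nonneg_of_ae ?_
    filter_upwards [M.density_posSemidef] with z hz
    exact div_nonneg (sq_nonneg _) (hz.re_dotProduct_nonneg _)

end

/-! ### From a trace bound on the information to a bound on its inverse -/

open scoped MatrixOrder in
theorem trace_mul_nonneg_of_posSemidef {n : ℕ} {A B : Matrix (Fin n) (Fin n) ℝ}
    (hA : A.PosSemidef) (hB : B.PosSemidef) : 0 ≤ (A * B).trace := by
  obtain ⟨C, rfl⟩ := CStarAlgebra.nonneg_iff_eq_star_mul_self.1 hA.nonneg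
  rw [Matrix.mul_assoc, Matrix.trace_mul_comm]
  exact (hB.mul_mul_conjTranspose_same C).trace_nonneg

/-- Since H is four times the real Gram matrix of v, this identifies the real Gram matrix of y with
H⁻¹. -/
theorem IsDualFrame.reGram_mul_reGram {n d : ℕ} {φ : Fin d → ℂ} {v y : Fin n → Fin d → ℂ}
    (h : IsDualFrame φ v y) : (4 : ℝ) • (reGram v * reGram y) = 1 := by
  ext i k
  have h1 := congrArg (fun z => (star (v i) ⬝ᵥ z).re) (h.sum_smul (h.orth' k))
  simp only [dotProduct_sum, dotProduct_real_smul, Complex.re_sum, Complex.re_ofReal_mul] at h1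
  rw [Matrix.one_apply, ← h.dual i k, ← h1, Matrix.smul_apply, Matrix.mul_apply, smul_eq_mul,
    Finset.mul_sum, Finset.mul_sum]
  refine Finset.sum_congr rfl fun j _ => ?_
  simp only [reGram_apply]
  ring

/-- With K = G⁻¹/4, expanding trace(G (A⁻¹ - 2K) A (A⁻¹ - 2K)) ≥ 0 gives trace(GA⁻¹) ≥ n -
trace(KA). The shift 2K is the value of A⁻¹ at the optimum A = 2G. -/
theorem IsDualFrame.le_trace_mul_inv {n d : ℕ} {φ : Fin d → ℂ} {v y : Fin n → Fin d → ℂ}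
    (h : IsDualFrame φ v y) {A : Matrix (Fin n) (Fin n) ℝ} (hA : A.PosSemidef) (hdet : A.det ≠ 0)
    (htr : (reGram y * A).trace ≤ n / 2) : (n : ℝ) / 2 ≤ (reGram v * A⁻¹).trace := by
  set G := reGram v
  set K := reGram y
  have hu : IsUnit A.det := isUnit_iff_ne_zero.2 hdet
  have hGK : G * K = (1 / 4 : ℝ) • 1 := by
    rw [← h.reGram_mul_reGram, smul_smul]
    norm_num [G, K]
  have hG : G.PosSemidef := by
    refine Matrix.PosSemidef.of_dotProduct_mulVec_nonneg ?_ fun x => ?_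
    · rw [Matrix.IsHermitian, Matrix.conjTranspose_eq_transpose_of_trivial]
      exact reGram_isSymm v
    · rw [star_trivial, dotProduct_reGram_mulVec]
      exact re_star_dotProduct_self_nonneg _
  have hW : (A⁻¹ - (2 : ℝ) • K)ᴴ = A⁻¹ - (2 : ℝ) • K := by
    rw [Matrix.conjTranspose_sub, hA.inv.1.eq, Matrix.conjTranspose_smul,
      Matrix.conjTranspose_eq_transpose_of_trivial K, reGram_isSymm y]
    simp [K]
  have h1 := trace_mul_nonneg_of_posSemidef hG (hA.conjTranspose_mul_mul_same (A⁻¹ - (2 : ℝ) • K))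
  rw [hW] at h1
  have h2 : G * ((A⁻¹ - (2 : ℝ) • K) * A * (A⁻¹ - (2 : ℝ) • K)) =
      G * A⁻¹ - (1 : ℝ) • 1 + A * K := by
    have e1 : (A⁻¹ - (2 : ℝ) • K) * A * (A⁻¹ - (2 : ℝ) • K) =
        A⁻¹ - (4 : ℝ) • K + (4 : ℝ) • (K * (A * K)) := by
      simp only [Matrix.sub_mul, Matrix.mul_sub, Matrix.smul_mul, Matrix.mul_smul,
        Matrix.nonsing_inv_mul _ hu, Matrix.one_mul, Matrix.mul_assoc, Matrix.mul_nonsing_inv _ hu,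
        Matrix.mul_one]
      module
    rw [e1, Matrix.mul_add, Matrix.mul_sub, Matrix.mul_smul, Matrix.mul_smul, ← Matrix.mul_assoc G K,
      hGK, smul_smul, Matrix.smul_mul, Matrix.one_mul, smul_smul]
    norm_num
  rw [h2, Matrix.trace_add, Matrix.trace_sub, one_smul, Matrix.trace_one, Matrix.trace_mul_comm A,
    Fintype.card_fin] at h1
  linarith

/-! ### Haar measure on the unitary group -/

instance (d : ℕ) : SecondCountableTopology (U d) :=
  have : SecondCountableTopology (Matrix (Fin d) (Fin d) ℂ) :=
    inferInstanceAs (SecondCountableTopology (Fin d → Fin d → ℂ))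
  TopologicalSpace.Subtype.secondCountableTopology
    (Matrix.unitaryGroup (Fin d) ℂ : Set (Matrix (Fin d) (Fin d) ℂ))

instance (d : ℕ) : (haarU d).IsHaarMeasure := by unfold haarU; infer_instance

/-- A right translate of Haar measure is again a left-invariant probability measure, so uniqueness
identifies the two. -/
instance (d : ℕ) : (haarU d).IsMulRightInvariant := by
  refine ⟨fun g => ?_⟩
  have hm : Measurable fun x : U d => x * g := (continuous_mul_const g).measurable
  have : IsProbabilityMeasure ((haarU d).map fun x => x * g) :=
    Measure.isProbabilityMeasure_map hm.aemeasurable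
  have : ((haarU d).map fun x => x * g).IsMulLeftInvariant := by
    refine ⟨fun h => ?_⟩
    have hm' : Measurable fun x : U d => h * x := (continuous_const_mul h).measurable
    rw [Measure.map_map hm' hm]
    have : ((fun x => h * x) ∘ fun x : U d => x * g) = (fun x => x * g) ∘ fun x => h * x := by
      ext x : 1
      simp [mul_assoc]
    rw [this, ← Measure.map_map hm hm', map_mul_left_eq_self]
  exact Measure.isHaarMeasure_eq_of_isProbabilityMeasure _ _

theorem continuous_unitary_mulVec {d : ℕ} (φ : Fin d → ℂ) :
    Continuous fun g : U d => (g : Matrix (Fin d) (Fin d) ℂ) *ᵥ φ :=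
  continuous_subtype_val.matrix_mulVec continuous_const

theorem continuous_powVec {d N : ℕ} : Continuous (powVec N : (Fin d → ℂ) → _) :=
  continuous_pi fun I => by
    simp only [powVec, prodVec]
    exact continuous_finsetProd _ fun k _ => continuous_apply (I k)

theorem Continuous.derivVec {Y : Type*} [TopologicalSpace Y] {d N : ℕ} {a b : Y → Fin d → ℂ}
    (ha : Continuous a) (hb : Continuous b) :
    Continuous fun y => QuantumEstimation.derivVec N (a y) (b y) :=
  continuous_pi fun I => continuous_finsetSum _ fun k _ =>
    ((continuous_apply (I k)).comp hb).mul
      (continuous_finsetProd _ fun l _ => (continuous_apply (I l)).comp ha)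

/-- A zero with nonzero derivative is isolated among the zeros, and a discrete subset of the line is
countable. -/
theorem countable_setOf_zero_deriv_ne {F F' : ℝ → ℂ} (h : ∀ t, HasDerivAt F (F' t) t) :
    {t | F t = 0 ∧ F' t ≠ 0}.Countable := by
  have hd : DiscreteTopology {t | F t = 0 ∧ F' t ≠ 0} := by
    rw [discreteTopology_subtype_iff]
    intro t ht
    rw [Filter.inf_principal_eq_bot]
    have := (h t).eventually_ne ht.2 (c := 0)
    filter_upwards [this] with s hs hs'
    exact hs hs'.1
  exact Set.countable_coe_iff.1 (TopologicalSpace.separableSpace_iff_countable.1 inferInstance)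

/-- The curve of unitaries `t ↦ 1 + (e^{it} - 1) σ`. -/
def phaseCurve {d : ℕ} {σ : Matrix (Fin d) (Fin d) ℂ} (hσ : IsPureState σ) (t : ℝ) : U d :=
  phaseUnitary (c := Complex.exp (t * Complex.I)) (by
    rw [Complex.star_def, ← Complex.normSq_eq_conj_mul_self, Complex.normSq_eq_norm_sq,
      Complex.norm_exp_ofReal_mul_I]
    simp) hσ

theorem coe_phaseCurve {d : ℕ} {σ : Matrix (Fin d) (Fin d) ℂ} (hσ : IsPureState σ) (t : ℝ) :
    (phaseCurve hσ t : Matrix (Fin d) (Fin d) ℂ) = 1 + (Complex.exp (t * Complex.I) - 1) • σ := rfl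

theorem continuous_phaseCurve {d : ℕ} {σ : Matrix (Fin d) (Fin d) ℂ} (hσ : IsPureState σ) :
    Continuous (phaseCurve hσ) := by
  refine Continuous.subtype_mk (f := fun t : ℝ => 1 + (Complex.exp (t * Complex.I) - 1) • σ) ?_ _
  fun_prop

theorem hasDerivAt_phaseCurve_mulVec {d : ℕ} {σ : Matrix (Fin d) (Fin d) ℂ} (hσ : IsPureState σ)
    (g : Matrix (Fin d) (Fin d) ℂ) (w : Fin d → ℂ) (t : ℝ) :
    HasDerivAt (fun t => (g * (phaseCurve hσ t : Matrix (Fin d) (Fin d) ℂ)) *ᵥ w)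
      ((g * (phaseCurve hσ t : Matrix (Fin d) (Fin d) ℂ)) *ᵥ (Complex.I • σ *ᵥ w)) t := by
  have h1 : HasDerivAt (fun t : ℝ => Complex.exp (t * Complex.I))
      (Complex.exp (t * Complex.I) * (1 * Complex.I)) t :=
    ((Complex.ofRealCLM.hasDerivAt (x := t)).mul_const Complex.I).cexp
  have h2 := ((h1.sub_const 1).smul_const (g *ᵥ σ *ᵥ w)).const_add (g *ᵥ w)
  have h3 : (fun t => (g * (phaseCurve hσ t : Matrix (Fin d) (Fin d) ℂ)) *ᵥ w) =
      fun t : ℝ => g *ᵥ w + (Complex.exp (t * Complex.I) - 1) • g *ᵥ σ *ᵥ w := by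
    ext s : 1
    rw [coe_phaseCurve, Matrix.mul_add, Matrix.add_mulVec, Matrix.mul_smul, Matrix.smul_mulVec,
      Matrix.mul_one, Matrix.mulVec_mulVec]
  rw [h3]
  refine h2.congr_deriv ?_
  rw [coe_phaseCurve, Matrix.mul_add, Matrix.add_mulVec, Matrix.mul_smul, Matrix.smul_mulVec,
    Matrix.mul_one, ← Matrix.mulVec_mulVec, Matrix.mulVec_smul, Matrix.mulVec_smul,
    Matrix.mulVec_mulVec (M := σ), hσ.2.2, Matrix.mulVec_smul]
  module

/-- Let σ project on the direction of φ + v and move g along g·`phaseCurve`. The function F(t) =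
ψ·(g_tφ)^{⊗N} then has derivative a nonzero multiple of N F(t) + ψ·D(g_tφ, g_tv). So a t violating
the implication is a zero of F with nonzero derivative, and there are only countably many of those.
Fubini and right invariance carry this from curves to Haar measure. -/
theorem ae_haarU_dotProduct_derivVec_eq_zero {d N : ℕ} {φ v : Fin d → ℂ} (hφ : star φ ⬝ᵥ φ = 1)
    (hv : star φ ⬝ᵥ v = 0) (ψ : (Fin N → Fin d) → ℂ) :
    ∀ᵐ g : U d ∂haarU d, ψ ⬝ᵥ powVec N ((g : Matrix (Fin d) (Fin d) ℂ) *ᵥ φ) = 0 →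
      ψ ⬝ᵥ derivVec N ((g : Matrix (Fin d) (Fin d) ℂ) *ᵥ φ)
        ((g : Matrix (Fin d) (Fin d) ℂ) *ᵥ v) = 0 := by
  have hv' : star v ⬝ᵥ φ = 0 := by rw [star_dotProduct_comm, hv, star_zero]
  set r : ℝ := (star v ⬝ᵥ v).re with hr
  have hr0 : 0 ≤ r := re_star_dotProduct_self_nonneg v
  have hrc : star v ⬝ᵥ v = r := by
    rw [hr, star_dotProduct_self_eq, Complex.ofReal_re]
  -- Normalizes φ + v, whose squared norm is 1 + ‖v‖² by orthogonality.
  set a : ℝ := (Real.sqrt (1 + r))⁻¹ with ha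
  have haa : a * a * (1 + r) = 1 := by
    have : Real.sqrt (1 + r) * Real.sqrt (1 + r) = 1 + r := Real.mul_self_sqrt (by linarith)
    have h0 : Real.sqrt (1 + r) ≠ 0 := (Real.sqrt_pos.2 (by linarith)).ne'
    rw [ha]
    field_simp
    linarith
  have ha0 : a ≠ 0 := by
    rintro h
    simp [h] at haa
  have hs : star (a • (φ + v)) ⬝ᵥ (a • (φ + v)) = 1 := by
    rw [star_real_smul_dotProduct, dotProduct_real_smul, star_add, add_dotProduct, dotProduct_add,
      dotProduct_add, hφ, hv, hv', hrc]
    norm_cast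
    rw [← haa]
    ring
  have hσ := isPureState_vecMulVec hs
  set σ := Matrix.vecMulVec (a • (φ + v)) (star (a • (φ + v))) with hσdef
  have hσφ : σ *ᵥ φ = ((a * a : ℝ) : ℂ) • (φ + v) := by
    rw [hσdef, Matrix.vecMulVec_mulVec, star_real_smul_dotProduct, star_add, add_dotProduct, hφ, hv']
    ext i
    simp
    ring
  set S : Set (U d) := {g | ψ ⬝ᵥ powVec N ((g : Matrix (Fin d) (Fin d) ℂ) *ᵥ φ) = 0 →
      ψ ⬝ᵥ derivVec N ((g : Matrix (Fin d) (Fin d) ℂ) *ᵥ φ)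
        ((g : Matrix (Fin d) (Fin d) ℂ) *ᵥ v) = 0} with hS
  have hSm : MeasurableSet S := by
    have h1 : Measurable fun g : U d => ψ ⬝ᵥ powVec N ((g : Matrix (Fin d) (Fin d) ℂ) *ᵥ φ) :=
      (continuous_const.dotProduct
        (continuous_powVec.comp (continuous_unitary_mulVec φ))).measurable
    have h2 : Measurable fun g : U d => ψ ⬝ᵥ derivVec N ((g : Matrix (Fin d) (Fin d) ℂ) *ᵥ φ)
        ((g : Matrix (Fin d) (Fin d) ℂ) *ᵥ v) :=
      (continuous_const.dotProduct (Continuous.derivVec (continuous_unitary_mulVec φ)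
        (continuous_unitary_mulVec v))).measurable
    exact (h1 (measurableSet_singleton 0)).compl.union (h2 (measurableSet_singleton 0)) |>.congr
      (by ext g; simp [hS, imp_iff_not_or])
  have hcount : ∀ g : U d, ∀ᵐ t : ℝ, g * phaseCurve hσ t ∈ S := by
    intro g
    have hF : ∀ t : ℝ, HasDerivAt (fun t => ψ ⬝ᵥ powVec N
        (((g : Matrix (Fin d) (Fin d) ℂ) * (phaseCurve hσ t : Matrix (Fin d) (Fin d) ℂ)) *ᵥ φ))
        (ψ ⬝ᵥ derivVec N
        (((g : Matrix (Fin d) (Fin d) ℂ) * (phaseCurve hσ t : Matrix (Fin d) (Fin d) ℂ)) *ᵥ φ)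
        (((g : Matrix (Fin d) (Fin d) ℂ) * (phaseCurve hσ t : Matrix (Fin d) (Fin d) ℂ)) *ᵥ
          (Complex.I • σ *ᵥ φ))) t := fun t => by
      have := hasDerivAt_powVec (N := N) (hasDerivAt_phaseCurve_mulVec hσ g φ t)
      exact HasDerivAt.fun_sum fun I _ => (hasDerivAt_pi.1 this I).const_mul (ψ I)
    have hnull := (countable_setOf_zero_deriv_ne hF).measure_zero volume
    refine (measure_eq_zero_iff_ae_notMem.1 hnull).mono fun t ht h0 => ?_
    have h0' : ψ ⬝ᵥ powVec N (((g : Matrix (Fin d) (Fin d) ℂ) *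
      (phaseCurve hσ t : Matrix (Fin d) (Fin d) ℂ)) *ᵥ φ) = 0 := h0
    by_contra hne
    refine ht ⟨h0', ?_⟩
    rw [hσφ, smul_smul, Matrix.mulVec_smul, derivVec_smul, dotProduct_smul, Matrix.mulVec_add,
      derivVec_add, dotProduct_add, derivVec_self, dotProduct_smul, h0', smul_zero, zero_add]
    refine smul_ne_zero ?_ hne
    simp [ha0]
  have hmeas : MeasurableSet {z : U d × ℝ | z.1 * phaseCurve hσ z.2 ∈ S} := by
    have : Continuous fun z : U d × ℝ => z.1 * phaseCurve hσ z.2 :=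
      continuous_fst.mul ((continuous_phaseCurve hσ).comp continuous_snd)
    exact this.measurable hSm
  have h1 := (Measure.ae_ae_comm (μ := haarU d) (ν := (volume : Measure ℝ)) hmeas).1
    (Filter.Eventually.of_forall hcount)
  -- A single t for which almost every g has g·`phaseCurve` t in S is enough: right translation by
  -- that unitary preserves Haar measure.
  obtain ⟨t, ht⟩ := h1.exists
  have h2 := (measurePreserving_mul_right (haarU d) (phaseCurve hσ t))
  have h3 : ∀ᵐ g ∂(haarU d).map (fun g => g * phaseCurve hσ t), g ∈ S :=
    (ae_map_iff h2.measurable.aemeasurable hSm).2 ht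
  rwa [h2.map_eq] at h3

/-! ### Covariant measurements -/

theorem POVM.measurable_density {X : Type*} [MeasurableSpace X] {ι : Type*} [Fintype ι]
    [DecidableEq ι] (M : POVM X ι) (i j : ι) : Measurable fun x => M.density x i j :=
  Complex.measurableEquivRealProd.symm.measurable.comp
    ((SignedMeasure.measurable_rnDeriv _ _).prodMk (SignedMeasure.measurable_rnDeriv _ _))

theorem tensorPower_unitary_mul_conjTranspose {d : ℕ} (N : ℕ) (g : U d) :
    tensorPower N (g : Matrix (Fin d) (Fin d) ℂ) *
      (tensorPower N (g : Matrix (Fin d) (Fin d) ℂ))ᴴ = 1 := by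
  rw [tensorPower_conjTranspose, tensorPower_mul]
  have : (g : Matrix (Fin d) (Fin d) ℂ) * (g : Matrix (Fin d) (Fin d) ℂ)ᴴ = 1 :=
    Matrix.mem_unitaryGroup_iff.1 g.2
  rw [this, tensorPower_one]

theorem tensorPower_unitary_conjTranspose_mul {d : ℕ} (N : ℕ) (g : U d) :
    (tensorPower N (g : Matrix (Fin d) (Fin d) ℂ))ᴴ *
      tensorPower N (g : Matrix (Fin d) (Fin d) ℂ) = 1 := by
  rw [tensorPower_conjTranspose, tensorPower_mul]
  have : (g : Matrix (Fin d) (Fin d) ℂ)ᴴ * (g : Matrix (Fin d) (Fin d) ℂ) = 1 :=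
    Matrix.mem_unitaryGroup_iff'.1 g.2
  rw [this, tensorPower_one]

theorem integrable_mul_mul {X ι : Type*} [MeasurableSpace X] [Fintype ι] {μ : Measure X}
    {m : X → Matrix ι ι ℂ} (hint : ∀ i j, Integrable (fun x => m x i j) μ) (A B : Matrix ι ι ℂ)
    (i j : ι) : Integrable (fun x => (A * m x * B) i j) μ := by
  simp only [Matrix.mul_apply]
  exact integrable_finsetSum _ fun b _ => (integrable_finsetSum _ fun a _ =>
    (hint a b).const_mul _).mul_const _

theorem integral_mul_mul {X ι : Type*} [MeasurableSpace X] [Fintype ι] {μ : Measure X}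
    {m : X → Matrix ι ι ℂ} (hint : ∀ i j, Integrable (fun x => m x i j) μ) (A B : Matrix ι ι ℂ)
    (i j : ι) : ∫ x, (A * m x * B) i j ∂μ =
      (A * (Matrix.of fun i j => ∫ x, m x i j ∂μ) * B) i j := by
  simp only [Matrix.mul_apply, Matrix.of_apply]
  rw [integral_finsetSum _ fun b _ => (integrable_finsetSum _ fun a _ =>
    (hint a b).const_mul _).mul_const _]
  refine Finset.sum_congr rfl fun b _ => ?_
  rw [integral_mul_const, integral_finsetSum _ fun a _ => (hint a b).const_mul _]
  simp only [integral_const_mul]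

section

variable {d N : ℕ} {X : Type*} [MeasurableSpace X] {act : U d →* Equiv.Perm X}
  {M : POVM X (Fin N → Fin d)}

theorem IsCovariant.measurePreserving (h : IsCovariant act M) (g : U d) :
    MeasurePreserving (act g) M.traceMeasure M.traceMeasure := by
  refine ⟨h.1 g, ?_⟩
  ext B hB
  rw [Measure.map_apply (h.1 g) hB, M.traceMeasure_apply hB, M.traceMeasure_apply (h.1 g hB),
    h.2 g B hB, Matrix.trace_mul_comm, ← Matrix.mul_assoc, tensorPower_unitary_conjTranspose_mul,
    Matrix.one_mul]

/-- The measurable equivalence of a measurable action by a group element. -/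
def IsCovariant.measurableEquiv (h : IsCovariant act M) (g : U d) : X ≃ᵐ X where
  toEquiv := act g
  measurable_toFun := h.1 g
  measurable_invFun := by
    have := h.1 g⁻¹
    rwa [map_inv] at this

theorem IsCovariant.setIntegral_density_act (h : IsCovariant act M) (g : U d) {B : Set X}
    (hB : MeasurableSet B) (a b : Fin N → Fin d) :
    ∫ x in B, M.density (act g x) a b ∂M.traceMeasure =
      (tensorPower N (g : Matrix (Fin d) (Fin d) ℂ) * M.toVectorMeasure B *
        (tensorPower N (g : Matrix (Fin d) (Fin d) ℂ))ᴴ) a b := by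
  have hB' : MeasurableSet ((act g).symm ⁻¹' B) := (h.measurableEquiv g).symm.measurable hB
  have hpre : act g ⁻¹' ((act g).symm ⁻¹' B) = B := by
    ext x; simp
  have h1 := (h.measurePreserving g).setIntegral_preimage_emb
    (h.measurableEquiv g).measurableEmbedding (fun x => M.density x a b) ((act g).symm ⁻¹' B)
  rw [hpre] at h1
  rw [h1, M.setIntegral_density _ _ hB', h.2 g _ hB', hpre]

/-- By covariance and invariance of the trace measure, x ↦ G* m(gx) G has the same set integrals as
m, and the density is unique almost everywhere. -/
theorem IsCovariant.density_act (h : IsCovariant act M) (g : U d) :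
    ∀ᵐ x ∂M.traceMeasure, M.density (act g x) =
      tensorPower N (g : Matrix (Fin d) (Fin d) ℂ) * M.density x *
        (tensorPower N (g : Matrix (Fin d) (Fin d) ℂ))ᴴ := by
  have hint : ∀ i j, Integrable (fun x => M.density (act g x) i j) M.traceMeasure := fun i j =>
    (h.measurePreserving g).integrable_comp_of_integrable (g := fun x => M.density x i j)
      (M.integrable_density i j)
  have hGG := tensorPower_unitary_conjTranspose_mul N g
  have hset := fun (B : Set X) (hB : MeasurableSet B) => Matrix.ext (h.setIntegral_density_act g hB)
  have hGG' := tensorPower_unitary_mul_conjTranspose N g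
  generalize tensorPower N (g : Matrix (Fin d) (Fin d) ℂ) = G at hGG hGG' hset ⊢
  have key := M.density_ae_eq (m := fun x => Gᴴ * M.density (act g x) * G)
    (integrable_mul_mul hint _ _)
    (fun B hB i j => by
      refine (integral_mul_mul (fun a b => (hint a b).integrableOn) _ _ _ _).trans ?_
      have h2 : Gᴴ * (G * M.toVectorMeasure B * Gᴴ) * G = M.toVectorMeasure B := by
        rw [← Matrix.mul_assoc, ← Matrix.mul_assoc, hGG, Matrix.one_mul, Matrix.mul_assoc, hGG,
          Matrix.mul_one]
      rw [← h2]
      exact congrArg (fun A => (Gᴴ * A * G) i j) (hset B hB))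
  filter_upwards [key] with x hx
  rw [hx, ← Matrix.mul_assoc, ← Matrix.mul_assoc, hGG', Matrix.one_mul, Matrix.mul_assoc, hGG',
    Matrix.mul_one]

theorem IsCovariant.integral_density (h : IsCovariant act M) (g : U d)
    (F : Matrix (Fin N → Fin d) (Fin N → Fin d) ℂ → ℝ) :
    ∫ x, F (tensorPower N (g : Matrix (Fin d) (Fin d) ℂ) * M.density x *
      (tensorPower N (g : Matrix (Fin d) (Fin d) ℂ))ᴴ) ∂M.traceMeasure =
      ∫ x, F (M.density x) ∂M.traceMeasure := by
  rw [← (h.measurePreserving g).integral_comp (h.measurableEquiv g).measurableEmbedding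
    fun x => F (M.density x)]
  exact integral_congr_ae ((h.density_act g).mono fun x hx => by simp only [hx])

theorem IsCovariant.ae_density (h : IsCovariant act M) (g : U d)
    {P : Matrix (Fin N → Fin d) (Fin N → Fin d) ℂ → Prop}
    (hP : ∀ᵐ x ∂M.traceMeasure, P (tensorPower N (g : Matrix (Fin d) (Fin d) ℂ) * M.density x *
      (tensorPower N (g : Matrix (Fin d) (Fin d) ℂ))ᴴ)) :
    ∀ᵐ x ∂M.traceMeasure, P (M.density x) := by
  have h1 : ∀ᵐ x ∂M.traceMeasure, P (M.density (act g x)) := by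
    filter_upwards [hP, h.density_act g] with x hx hx'
    rwa [hx']
  have h2 := (h.measurableEquiv g).measurableEmbedding.ae_map_iff (p := fun x => P (M.density x))
    (μ := M.traceMeasure) |>.2 h1
  rwa [show Measure.map (h.measurableEquiv g) M.traceMeasure = M.traceMeasure from
    (h.measurePreserving g).map_eq] at h2

theorem star_dotProduct_conj_mulVec {ι : Type*} [Fintype ι] (G m : Matrix ι ι ℂ) (a b : ι → ℂ) :
    star a ⬝ᵥ (G * m * Gᴴ) *ᵥ b = star (Gᴴ *ᵥ a) ⬝ᵥ m *ᵥ (Gᴴ *ᵥ b) := by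
  rw [Matrix.star_mulVec, Matrix.conjTranspose_conjTranspose, ← Matrix.mulVec_mulVec,
    ← Matrix.mulVec_mulVec, ← Matrix.dotProduct_mulVec]

theorem conjTranspose_tensorPower_coe (g : U d) :
    (tensorPower N (g : Matrix (Fin d) (Fin d) ℂ))ᴴ =
      tensorPower N ((g⁻¹ : U d) : Matrix (Fin d) (Fin d) ℂ) := tensorPower_conjTranspose _

/-- For a covariant measurement, almost everywhere where the probability density vanishes its
derivative vanishes as well, in the strong sense that the vector `m D(v)` is zero. -/
theorem IsCovariant.ae_eq_zero (h : IsCovariant act M) {φ v : Fin d → ℂ}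
    (hφ : star φ ⬝ᵥ φ = 1) (hv : star φ ⬝ᵥ v = 0) :
    ∀ᵐ x ∂M.traceMeasure, M.density x *ᵥ powVec N φ = 0 → M.density x *ᵥ derivVec N φ v = 0 := by
  have hfix : ∀ x, ∀ᵐ g : U d ∂haarU d,
      M.density x *ᵥ powVec N ((g : Matrix (Fin d) (Fin d) ℂ) *ᵥ φ) = 0 →
      M.density x *ᵥ derivVec N ((g : Matrix (Fin d) (Fin d) ℂ) *ᵥ φ)
        ((g : Matrix (Fin d) (Fin d) ℂ) *ᵥ v) = 0 := by
    intro x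
    filter_upwards [ae_all_iff.2 fun I =>
      ae_haarU_dotProduct_derivVec_eq_zero (N := N) hφ hv (M.density x I)] with g hg h0
    ext I
    exact hg I (congrFun h0 I)
  have hmeas : MeasurableSet {z : X × U d |
      M.density z.1 *ᵥ powVec N ((z.2 : Matrix (Fin d) (Fin d) ℂ) *ᵥ φ) = 0 →
      M.density z.1 *ᵥ derivVec N ((z.2 : Matrix (Fin d) (Fin d) ℂ) *ᵥ φ)
        ((z.2 : Matrix (Fin d) (Fin d) ℂ) *ᵥ v) = 0} := by
    have hm : ∀ a : U d → (Fin N → Fin d) → ℂ, Continuous a →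
        MeasurableSet {z : X × U d | M.density z.1 *ᵥ a z.2 = 0} := by
      intro a ha
      have h1 : Measurable fun z : X × U d => M.density z.1 *ᵥ a z.2 := by
        refine measurable_pi_iff.2 fun I => ?_
        exact Finset.measurable_sum _ fun J _ =>
          ((M.measurable_density I J).comp measurable_fst).mul
            (((continuous_apply J).comp ha).measurable.comp measurable_snd)
      exact h1 (measurableSet_singleton 0)
    exact ((hm _ (continuous_powVec.comp (continuous_unitary_mulVec φ))).compl.union
      (hm _ (Continuous.derivVec (continuous_unitary_mulVec φ)
        (continuous_unitary_mulVec v)))).congr (by ext z; simp [imp_iff_not_or])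
  -- For each outcome x almost every g is good, by the previous section applied to every row of the
  -- density. Fubini exchanges the quantifiers and yields one g that is good for almost every x.
  have h1 := (Measure.ae_ae_comm (μ := M.traceMeasure) (ν := haarU d) hmeas).1
    (Filter.Eventually.of_forall hfix)
  obtain ⟨g, hg⟩ := h1.exists
  -- Covariance moves the statement for gφ and gv back to φ and v.
  refine h.ae_density g⁻¹ (P := fun m => m *ᵥ powVec N φ = 0 → m *ᵥ derivVec N φ v = 0) ?_
  filter_upwards [hg] with x hx h0
  rw [conjTranspose_tensorPower_coe, inv_inv] at h0 ⊢
  rw [← Matrix.mulVec_mulVec, tensorPower_mulVec_powVec, ← Matrix.mulVec_mulVec] at h0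
  rw [← Matrix.mulVec_mulVec, tensorPower_mulVec_derivVec, ← Matrix.mulVec_mulVec, hx, Matrix.mulVec_zero]
  have h2 := congrArg (fun z => tensorPower N (g : Matrix (Fin d) (Fin d) ℂ) *ᵥ z) h0
  rwa [Matrix.mulVec_mulVec, ← conjTranspose_tensorPower_coe, tensorPower_unitary_mul_conjTranspose,
    Matrix.one_mulVec, Matrix.mulVec_zero] at h2

end

/-- For m = w uᵀ every value a·mb factors as (a·w)(u·b). This is what makes Cauchy–Schwarz an
equality for exhaustive measurements. -/
theorem rank_one_mul_eq {ι : Type*} [Fintype ι] [DecidableEq ι] {m : Matrix ι ι ℂ} (hm : m.rank = 1)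
    (a b c e : ι → ℂ) : (a ⬝ᵥ m *ᵥ b) * (c ⬝ᵥ m *ᵥ e) = (a ⬝ᵥ m *ᵥ e) * (c ⬝ᵥ m *ᵥ b) := by
  obtain ⟨w, u, rfl⟩ : ∃ w u : ι → ℂ, m = Matrix.vecMulVec w u := by
    rw [Matrix.rank] at hm
    obtain ⟨w, hw⟩ := finrank_le_one_iff.1 hm.le
    choose u hu using fun j => hw ⟨m.mulVecLin (Pi.single j 1), LinearMap.mem_range_self _ _⟩
    refine ⟨w, u, ?_⟩
    ext i j
    have := congrFun (congrArg Subtype.val (hu j)) i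
    simp only [Matrix.mulVecLin_apply, Matrix.mulVec_single_one] at this
    rw [Matrix.vecMulVec_apply, mul_comm]
    exact this.symm
  simp only [Matrix.vecMulVec_mulVec, dotProduct_smul, MulOpposite.smul_eq_mul_unop, MulOpposite.unop_op]
  ring

theorem star_dotProduct_mulVec_comm {ι : Type*} [Fintype ι] {m : Matrix ι ι ℂ} (hm : m.IsHermitian)
    (a b : ι → ℂ) : star b ⬝ᵥ m *ᵥ a = star (star a ⬝ᵥ m *ᵥ b) := by
  rw [Matrix.star_dotProduct, Matrix.star_mulVec, hm.eq, Matrix.dotProduct_mulVec]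

/-! ### The Fisher information of exhaustive covariant measurements -/

section

variable {d N : ℕ} {X : Type*} [MeasurableSpace X] {act : U d →* Equiv.Perm X}
  {M : POVM X (Fin N → Fin d)}

/-- Use the unitary that multiplies φ by -i and fixes v. It multiplies φ^{⊗N} by (-i)^N and the
derivative in direction v by (-i)^{N-1}, so the score in direction v acquires the relative phase i,
as if v had been replaced by iv. The probability density does not change. -/
theorem IsCovariant.fisherForm_self_eq_im (h : IsCovariant act M) (hN : 1 ≤ N) {φ v : Fin d → ℂ}
    (hφ : star φ ⬝ᵥ φ = 1) (hv : star φ ⬝ᵥ v = 0) :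
    fisherForm M φ v v = fisherForm M φ (Complex.I • v) (Complex.I • v) := by
  have hc : star (-Complex.I) * (-Complex.I) = 1 := by simp
  set g := (phaseUnitary hc (isPureState_vecMulVec hφ))⁻¹ with hg
  have hginv : ((g⁻¹ : U d) : Matrix (Fin d) (Fin d) ℂ) =
    1 + (-Complex.I - 1) • Matrix.vecMulVec φ (star φ) := by rw [hg, inv_inv]; rfl
  have h1 : ((g⁻¹ : U d) : Matrix (Fin d) (Fin d) ℂ) *ᵥ φ = (-Complex.I) • φ := by
    rw [hginv, Matrix.add_mulVec, Matrix.smul_mulVec, Matrix.vecMulVec_mulVec, hφ, Matrix.one_mulVec]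
    simp
    module
  have h2 : ((g⁻¹ : U d) : Matrix (Fin d) (Fin d) ℂ) *ᵥ v = v := by
    rw [hginv, Matrix.add_mulVec, Matrix.smul_mulVec, Matrix.vecMulVec_mulVec, hv, Matrix.one_mulVec]
    simp
  have h3 := h.integral_density g fun m => 2 * (star (powVec N φ) ⬝ᵥ m *ᵥ derivVec N φ v).re *
    (2 * (star (powVec N φ) ⬝ᵥ m *ᵥ derivVec N φ v).re) /
      (star (powVec N φ) ⬝ᵥ m *ᵥ powVec N φ).re
  rw [fisherForm, ← h3, fisherForm]
  congr 1
  ext x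
  have hcN : ∀ n : ℕ, star ((-Complex.I) ^ n) * (-Complex.I) ^ n = 1 := fun n => by
    rw [star_pow, ← mul_pow, hc, one_pow]
  obtain ⟨n, rfl⟩ := Nat.exists_eq_add_of_le' hN
  simp only [star_dotProduct_conj_mulVec]
  simp only [conjTranspose_tensorPower_coe, tensorPower_mulVec_powVec,
    tensorPower_mulVec_derivVec, h1, h2, powVec_smul, derivVec_smul_left, derivVec_smul,
    Matrix.mulVec_smul, dotProduct_smul, star_smul, smul_dotProduct, smul_eq_mul,
    Nat.add_sub_cancel]
  have hA : (-Complex.I) ^ n * star ((-Complex.I) ^ (n + 1)) = Complex.I := by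
    rw [mul_comm, pow_succ, star_mul', mul_right_comm, hcN]
    simp
  have hB : (-Complex.I) ^ (n + 1) * star ((-Complex.I) ^ (n + 1)) = 1 := by rw [mul_comm, hcN]
  simp only [← mul_assoc ((-Complex.I) ^ n), ← mul_assoc ((-Complex.I) ^ (n + 1)), hA, hB, one_mul]

/-- The directions v and iv contribute the squared real and imaginary parts of one complex score,
together 4|⟨φ^{⊗N}|m|D⟩|²/p. By rank one this equals 4⟨D|m|D⟩, with integral 4N‖v‖². By the phase
symmetry each direction has half of it. -/
theorem fisherForm_self_of_exhaustive (h : IsCovariant act M) (hM : M.IsExhaustive) (hN : 1 ≤ N)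
    {φ v : Fin d → ℂ} (hφ : star φ ⬝ᵥ φ = 1) (hv : star φ ⬝ᵥ v = 0) :
    fisherForm M φ v v = 2 * N * (star v ⬝ᵥ v).re := by
  have h1 : fisherForm M φ v v + fisherForm M φ (Complex.I • v) (Complex.I • v) =
      4 * (N * (star v ⬝ᵥ v).re) := by
    rw [fisherForm, fisherForm, ← integral_add (integrable_fisher_integrand M φ _ _)
      (integrable_fisher_integrand M φ _ _)]
    have h2 := integral_re (M.integrable_dotProduct_density (star (derivVec N φ v))
      (derivVec N φ v))
    simp only [RCLike.re_eq_complex_re] at h2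
    rw [M.integral_dotProduct_density, star_derivVec_dotProduct_self hφ hv] at h2
    have h3 : (N * (star v ⬝ᵥ v) : ℂ).re = N * (star v ⬝ᵥ v).re := by simp
    rw [h3] at h2
    rw [← h2, ← integral_const_mul]
    refine integral_congr_ae ?_
    filter_upwards [M.density_posSemidef, hM, h.ae_eq_zero hφ hv] with x hx hr hz
    have hp := hx.dotProduct_mulVec_nonneg (powVec N φ)
    have h4 := rank_one_mul_eq hr (star (powVec N φ)) (derivVec N φ v) (star (derivVec N φ v))
      (powVec N φ)
    rw [star_dotProduct_mulVec_comm hx.1 (powVec N φ) (derivVec N φ v), Complex.star_def,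
      Complex.mul_conj] at h4
    have h5 := congrArg Complex.re h4
    rw [Complex.mul_re, ← (Complex.le_def.1 hp).2, Complex.ofReal_re] at h5
    simp only [Complex.zero_im, zero_mul, sub_zero] at h5
    simp only [derivVec_smul, Matrix.mulVec_smul, dotProduct_smul, smul_eq_mul]
    rw [← add_div]
    -- At zero density the quotient is 0 by convention, so ⟨D|m|D⟩ has to vanish as well; this is
    -- where covariance enters through `IsCovariant.ae_eq_zero`.
    by_cases hp0 : (star (powVec N φ) ⬝ᵥ M.density x *ᵥ powVec N φ).re = 0
    · have h6 : star (powVec N φ) ⬝ᵥ M.density x *ᵥ powVec N φ = 0 :=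
        Complex.ext hp0 (Complex.le_def.1 hp).2.symm
      rw [hz ((hx.dotProduct_mulVec_zero_iff _).1 h6), hp0]
      simp
    · rw [div_eq_iff hp0]
      rw [Complex.normSq_apply] at h5
      simp only [Complex.I_mul_re]
      linear_combination 4 * h5
  have h2 := h.fisherForm_self_eq_im hN hφ hv
  linarith

/-- Polarization of the diagonal case. -/
theorem fisherForm_of_exhaustive (h : IsCovariant act M) (hM : M.IsExhaustive) (hN : 1 ≤ N)
    {φ v w : Fin d → ℂ} (hφ : star φ ⬝ᵥ φ = 1) (hv : star φ ⬝ᵥ v = 0) (hw : star φ ⬝ᵥ w = 0) :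
    fisherForm M φ v w = 2 * N * (star v ⬝ᵥ w).re := by
  have h1 := fisherForm_self_of_exhaustive h hM hN hφ hv
  have h2 := fisherForm_self_of_exhaustive h hM hN hφ hw
  have h3 := fisherForm_self_of_exhaustive h hM hN hφ (v := v + w)
    (by rw [dotProduct_add, hv, hw, add_zero])
  have h4 : fisherForm M φ (v + w) (v + w) =
      fisherForm M φ v v + 2 * fisherForm M φ v w + fisherForm M φ w w := by
    have hi := integrable_fisher_integrand M φ
    have hi2 := (hi v w).const_mul 2
    simp only [fisherForm]
    rw [← integral_const_mul, ← integral_add (hi v v) hi2]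
    refine Eq.trans ?_ (integral_add ((hi v v).add hi2) (hi w w))
    congr 1
    ext x
    simp only [derivVec_add, Matrix.mulVec_add, dotProduct_add, Complex.add_re]
    ring
  rw [star_add, add_dotProduct, dotProduct_add, dotProduct_add, Complex.add_re, Complex.add_re,
    Complex.add_re, re_star_dotProduct_comm w v] at h3
  linarith

end

/-! ### Standard tomography -/

namespace POVM

variable {X : Type*} [MeasurableSpace X] {ι : Type*} [Fintype ι] [DecidableEq ι] {μ : Measure X}
  {m : X → Matrix ι ι ℂ} {hm : ∀ x, (m x).PosSemidef}
  {hint : ∀ i j, Integrable (fun x => m x i j) μ}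
  {htot : ∀ i j, ∫ x, m x i j ∂μ = (1 : Matrix ι ι ℂ) i j}

theorem ofDensity_apply {B : Set X} (hB : MeasurableSet B) :
    (ofDensity μ m hm hint htot).toVectorMeasure B =
      Matrix.of fun i j => ∫ x in B, m x i j ∂μ :=
  integralMeasure_apply μ m hint hB

theorem traceMeasure_ofDensity [IsFiniteMeasure μ] (htr : ∀ x, (m x).trace = 1) :
    (ofDensity μ m hm hint htot).traceMeasure = μ := by
  ext B hB
  rw [traceMeasure_apply _ hB, ofDensity_apply hB, Matrix.trace]
  simp only [Matrix.diag_apply, Matrix.of_apply]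
  rw [← integral_finsetSum _ fun i _ => (hint i i).integrableOn]
  have : ∀ x, ∑ i, m x i i = 1 := htr
  simp [this, Measure.real]

theorem density_ofDensity [IsFiniteMeasure μ] (htr : ∀ x, (m x).trace = 1) :
    ∀ᵐ x ∂μ, (ofDensity μ m hm hint htot).density x = m x := by
  have h := traceMeasure_ofDensity (hm := hm) (hint := hint) (htot := htot) htr
  have := (ofDensity μ m hm hint htot).density_ae_eq (m := m) (by rwa [h]) (fun B hB i j => by
    rw [h, ofDensity_apply hB, Matrix.of_apply])
  rwa [h] at this

end POVM

theorem isCovariant_ofDensity {d N : ℕ} {X : Type*} [MeasurableSpace X] {μ : Measure X}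
    {m : X → Matrix (Fin N → Fin d) (Fin N → Fin d) ℂ} {hm : ∀ x, (m x).PosSemidef}
    {hint : ∀ i j, Integrable (fun x => m x i j) μ}
    {htot : ∀ i j, ∫ x, m x i j ∂μ = (1 : Matrix (Fin N → Fin d) (Fin N → Fin d) ℂ) i j}
    {act : U d →* Equiv.Perm X} (hact : ∀ g, MeasurePreserving (act g) μ μ)
    (hmact : ∀ g x, m (act g x) = tensorPower N (g : Matrix (Fin d) (Fin d) ℂ) * m x *
      (tensorPower N (g : Matrix (Fin d) (Fin d) ℂ))ᴴ) :
    IsCovariant act (POVM.ofDensity μ m hm hint htot) := by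
  refine ⟨fun g => (hact g).measurable, fun g B hB => ?_⟩
  rw [POVM.ofDensity_apply hB, POVM.ofDensity_apply ((hact g).measurable hB)]
  have hinv : Measurable (act g).symm := by
    have := (hact g⁻¹).measurable
    rwa [map_inv] at this
  have hemb : MeasurableEmbedding (act g) :=
    (⟨act g, (hact g).measurable, hinv⟩ : X ≃ᵐ X).measurableEmbedding
  ext i j
  rw [Matrix.of_apply, ← (hact g).setIntegral_preimage_emb hemb (fun x => m x i j)]
  simp only [hmact]
  exact integral_mul_mul (fun a b => (hint a b).integrableOn) _ _ _ _

theorem tensorProd_basisProjector {d N : ℕ} (x : TomographyOutcome d N) :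
    tensorProd (fun k => basisProjector (x k).1 (x k).2) =
      Matrix.vecMulVec (prodVec fun k => ((x k).1 : Matrix (Fin d) (Fin d) ℂ).col (x k).2)
        (star (prodVec fun k => ((x k).1 : Matrix (Fin d) (Fin d) ℂ).col (x k).2)) := by
  simp only [basisProjector, tensorProd_vecMulVec, star_prodVec]

theorem trace_tensorProd {d N : ℕ} (A : Fin N → Matrix (Fin d) (Fin d) ℂ) :
    (tensorProd A).trace = ∏ k, (A k).trace := by
  simp only [Matrix.trace, Matrix.diag_apply, tensorProd, Matrix.of_apply]
  rw [Finset.prod_univ_sum, Fintype.piFinset_univ]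

theorem rank_eq_one_of_eq_vecMulVec {ι : Type*} [Fintype ι] [DecidableEq ι] {A : Matrix ι ι ℂ}
    {a b : ι → ℂ} (h : A = Matrix.vecMulVec a b) (hA : A ≠ 0) : A.rank = 1 := by
  refine le_antisymm (h ▸ Matrix.rank_vecMulVec_le a b) (Nat.one_le_iff_ne_zero.2 fun h0 => hA ?_)
  rw [Matrix.rank, Submodule.finrank_eq_zero, LinearMap.range_eq_bot] at h0
  exact Matrix.toLin'.map_eq_zero_iff.1 h0

theorem tomography_isExhaustive (d N : ℕ) : (tomography d N).IsExhaustive := by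
  have htr : ∀ x : TomographyOutcome d N,
      (tensorProd fun k => basisProjector (x k).1 (x k).2).trace = 1 := fun x => by
    rw [trace_tensorProd]
    exact Finset.prod_eq_one fun k _ => (basisProjector_isPureState _ _).2.1
  rw [POVM.IsExhaustive, tomography, POVM.traceMeasure_ofDensity htr]
  filter_upwards [POVM.density_ofDensity htr] with x hx
  rw [hx]
  refine rank_eq_one_of_eq_vecMulVec (tensorProd_basisProjector x) fun h => ?_
  have := htr x
  rw [h] at this
  simp at this

theorem basisProjector_mul {d : ℕ} (g u : U d) (i : Fin d) :
    basisProjector (g * u) i = (g : Matrix (Fin d) (Fin d) ℂ) * basisProjector u i *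
      (g : Matrix (Fin d) (Fin d) ℂ)ᴴ := by
  have : ((g * u : U d) : Matrix (Fin d) (Fin d) ℂ).col i =
      (g : Matrix (Fin d) (Fin d) ℂ) *ᵥ (u : Matrix (Fin d) (Fin d) ℂ).col i := by
    ext a
    simp [Matrix.mul_apply, Matrix.mulVec, dotProduct]
  rw [basisProjector, this, Matrix.star_mulVec, basisProjector, Matrix.mul_vecMulVec,
    Matrix.vecMulVec_mul]

theorem tomography_isCovariant (d N : ℕ) :
    IsCovariant (tomographyAction d N) (tomography d N) := by
  refine isCovariant_ofDensity (fun g => ?_) fun g x => ?_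
  · exact measurePreserving_pi (fun _ => basisMeasure d) (fun _ => basisMeasure d) fun _ =>
      (measurePreserving_mul_left (haarU d) g).prod (MeasurePreserving.id Measure.count)
  · rw [tensorPower, tensorProd_conjTranspose, tensorProd_mul, tensorProd_mul]
    simp only [tomographyAction, MonoidHom.coe_mk, OneHom.coe_mk, Equiv.coe_fn_mk,
      basisProjector_mul]

/-! ### The local optimality statements -/

section

variable {d : ℕ} {Θ : Set (Fin (2 * (d - 1)) → ℝ)}
  {ρ : (Fin (2 * (d - 1)) → ℝ) → Matrix (Fin d) (Fin d) ℂ} {θ : Fin (2 * (d - 1)) → ℝ}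
  {φ : Fin d → ℂ} {N : ℕ} {X : Type*} [MeasurableSpace X]

theorem natCast_two_mul_pred_half (d : ℕ) [NeZero d] :
    ((2 * (d - 1) : ℕ) : ℝ) / 2 = (d : ℝ) - 1 := by
  rw [Nat.cast_mul, Nat.cast_sub NeZero.one_le]
  push_cast
  ring

theorem averageInformation_eq (h : IsPureStateParametrization d Θ ρ) (hθ : θ ∈ Θ)
    (hφ : star φ ⬝ᵥ φ = 1) (hρ : ρ θ = Matrix.vecMulVec φ (star φ))
    (M : POVM X (Fin N → Fin d)) :
    averageInformation M ρ θ = (N : ℝ)⁻¹ •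
      Matrix.of fun k l => fisherForm M φ (tangentVec ρ θ φ k) (tangentVec ρ θ φ l) := by
  ext k l
  exact averageInformation_apply h hθ hφ hρ M k l

theorem le_trace_mul_averageInformation_inv [NeZero d] (h : IsPureStateParametrization d Θ ρ)
    (hθ : θ ∈ Θ) (hφ : star φ ⬝ᵥ φ = 1) (hρ : ρ θ = Matrix.vecMulVec φ (star φ)) (hN : 1 ≤ N)
    (M : POVM X (Fin N → Fin d)) (hdet : (averageInformation M ρ θ).det ≠ 0) :
    (d : ℝ) - 1 ≤ (reGram (tangentVec ρ θ φ) * (averageInformation M ρ θ)⁻¹).trace := by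
  have hv : ∀ k, star φ ⬝ᵥ tangentVec ρ θ φ k = 0 := fun k =>
    (partialDeriv_eq_tangentMatrix h hθ hφ hρ k).1
  obtain ⟨y, hy⟩ := exists_dualFrame hφ hv (linearIndependent_tangentVec h hθ hφ hρ)
  have hN' : (0 : ℝ) < N := by exact_mod_cast hN
  rw [← natCast_two_mul_pred_half d]
  refine hy.le_trace_mul_inv ?_ hdet ?_
  · rw [averageInformation_eq h hθ hφ hρ]
    exact (fisherForm_posSemidef M φ _).smul (inv_nonneg.2 hN'.le)
  · rw [averageInformation_eq h hθ hφ hρ, Matrix.mul_smul, Matrix.trace_smul, smul_eq_mul,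
      natCast_two_mul_pred_half, inv_mul_le_iff₀ hN']
    refine le_of_eq_of_le ?_ (hy.sum_reGram_mul_fisherForm_le M)
    simp only [Matrix.trace, Matrix.diag_apply, Matrix.mul_apply, Matrix.of_apply]
    exact Finset.sum_congr rfl fun i _ => Finset.sum_congr rfl fun j _ => by
      rw [fisherForm_comm]

theorem averageInformation_of_exhaustive (h : IsPureStateParametrization d Θ ρ) (hθ : θ ∈ Θ)
    (hφ : star φ ⬝ᵥ φ = 1) (hρ : ρ θ = Matrix.vecMulVec φ (star φ)) (hN : 1 ≤ N)
    {M : POVM X (Fin N → Fin d)} {act : U d →* Equiv.Perm X} (hM : M.IsExhaustive)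
    (hcov : IsCovariant act M) :
    averageInformation M ρ θ = (2 : ℝ) • reGram (tangentVec ρ θ φ) := by
  have hv : ∀ k, star φ ⬝ᵥ tangentVec ρ θ φ k = 0 := fun k =>
    (partialDeriv_eq_tangentMatrix h hθ hφ hρ k).1
  have hN' : (N : ℝ) ≠ 0 := by exact_mod_cast (by omega : N ≠ 0)
  rw [averageInformation_eq h hθ hφ hρ]
  ext k l
  rw [Matrix.smul_apply, Matrix.of_apply,
    fisherForm_of_exhaustive hcov hM hN hφ (hv k) (hv l), Matrix.smul_apply, reGram_apply,
    smul_eq_mul, smul_eq_mul]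
  field_simp

theorem trace_mul_two_smul_inv [NeZero d] {G : Matrix (Fin (2 * (d - 1))) (Fin (2 * (d - 1))) ℝ}
    (hG : G.PosDef) : (G * ((2 : ℝ) • G)⁻¹).trace = (d : ℝ) - 1 := by
  have hu : IsUnit G.det := G.isUnit_iff_isUnit_det.1 hG.isUnit
  have : ((2 : ℝ) • G)⁻¹ = (1 / 2 : ℝ) • G⁻¹ := by
    refine Matrix.inv_eq_right_inv ?_
    rw [Matrix.smul_mul, Matrix.mul_smul, Matrix.mul_nonsing_inv _ hu, smul_smul]
    norm_num
  rw [this, Matrix.mul_smul, Matrix.mul_nonsing_inv _ hu, Matrix.trace_smul, Matrix.trace_one,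
    Fintype.card_fin, ← natCast_two_mul_pred_half d, smul_eq_mul]
  ring

end

theorem local_optimality {d : ℕ} [NeZero d] {Θ : Set (Fin (2 * (d - 1)) → ℝ)}
    {ρ : (Fin (2 * (d - 1)) → ℝ) → Matrix (Fin d) (Fin d) ℂ}
    (h : IsPureStateParametrization d Θ ρ) {θ : Fin (2 * (d - 1)) → ℝ} (hθ : θ ∈ Θ) :
    (∃! H, IsHelstromInformation ρ θ H) ∧
    ∀ H, IsHelstromInformation ρ θ H →
      H.PosDef ∧
      holevoBound ρ θ ((1 / 4 : ℝ) • H) = (((d : ℝ) - 1 : ℝ) : EReal) ∧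
      (∀ (N : ℕ), 1 ≤ N → ∀ (X : Type u) [MeasurableSpace X] (M : POVM X (Fin N → Fin d)),
        (averageInformation M ρ θ).det ≠ 0 →
        holevoBound ρ θ ((1 / 4 : ℝ) • H) ≤
          (((((1 / 4 : ℝ) • H) * (averageInformation M ρ θ)⁻¹).trace : ℝ) : EReal)) ∧
      (∀ (N : ℕ), 1 ≤ N → ∀ (X : Type u) [MeasurableSpace X] (act : U d →* Equiv.Perm X)
        (M : POVM X (Fin N → Fin d)), M.IsExhaustive → IsCovariant act M →
        averageInformation M ρ θ = (1 / 2 : ℝ) • H ∧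
        (((((1 / 4 : ℝ) • H) * (averageInformation M ρ θ)⁻¹).trace : ℝ) : EReal) =
          holevoBound ρ θ ((1 / 4 : ℝ) • H)) ∧
      (∀ (N : ℕ), 1 ≤ N →
        (tomography d N).IsExhaustive ∧
        IsCovariant (tomographyAction d N) (tomography d N) ∧
        averageInformation (tomography d N) ρ θ = (1 / 2 : ℝ) • H ∧
        (((((1 / 4 : ℝ) • H) * (averageInformation (tomography d N) ρ θ)⁻¹).trace : ℝ) : EReal)
          = holevoBound ρ θ ((1 / 4 : ℝ) • H)) := by
  obtain ⟨φ, hφ, hρ⟩ := (h.isPureState θ hθ).exists_vector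
  have hH := isHelstromInformation_reGram h hθ hφ hρ
  refine ⟨⟨_, hH, fun H' hH' => hH'.unique hH⟩, fun H' hH' => ?_⟩
  obtain rfl := hH'.unique hH
  have hpos := reGram_posDef (linearIndependent_tangentVec h hθ hφ hρ)
  have hq : (1 / 4 : ℝ) • (4 : ℝ) • reGram (tangentVec ρ θ φ) = reGram (tangentVec ρ θ φ) := by
    rw [smul_smul]; norm_num
  have hhalf : (1 / 2 : ℝ) • (4 : ℝ) • reGram (tangentVec ρ θ φ) =
      (2 : ℝ) • reGram (tangentVec ρ θ φ) := by
    rw [smul_smul]; norm_num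
  rw [hq, hhalf, holevoBound_eq h hθ hφ hρ]
  refine ⟨hpos.smul (by norm_num), rfl, fun N hN X _ M hdet => ?_,
    fun N hN X _ act M hM hcov => ?_, fun N hN => ⟨tomography_isExhaustive d N,
      tomography_isCovariant d N, ?_⟩⟩
  · exact EReal.coe_le_coe_iff.2 (le_trace_mul_averageInformation_inv h hθ hφ hρ hN M hdet)
  · rw [averageInformation_of_exhaustive h hθ hφ hρ hN hM hcov, trace_mul_two_smul_inv hpos]
    exact ⟨rfl, rfl⟩
  · rw [averageInformation_of_exhaustive h hθ hφ hρ hN (tomography_isExhaustive d N)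
      (tomography_isCovariant d N), trace_mul_two_smul_inv hpos]
    exact ⟨rfl, rfl⟩

/-! ### Moments of a uniformly distributed unit vector -/

theorem integrable_haarU {d : ℕ} {E : Type*} [NormedAddCommGroup E] {f : U d → E}
    (hf : Continuous f) : Integrable f (haarU d) :=
  hf.integrable_of_hasCompactSupport (HasCompactSupport.of_compactSpace f)

/-- By left invariance the integral of f along the translated curve does not depend on t;
differentiate under the integral, with a uniform bound from compactness. -/
theorem integral_deriv_phaseCurve_eq_zero {d : ℕ} {σ : Matrix (Fin d) (Fin d) ℂ}
    (hσ : IsPureState σ) {f f' : U d → ℂ} (hf : Continuous f) (hf' : Continuous f')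
    (h : ∀ g t, HasDerivAt (fun t => f (phaseCurve hσ t * g)) (f' (phaseCurve hσ t * g)) t) :
    ∫ g, f' g ∂haarU d = 0 := by
  obtain ⟨C, hC⟩ := isCompact_univ.exists_bound_of_continuousOn hf'.continuousOn
  have hm : ∀ t, Continuous fun g : U d => phaseCurve hσ t * g := fun t =>
    continuous_const.mul continuous_id
  have h1 := (hasDerivAt_integral_of_dominated_loc_of_deriv_le (μ := haarU d)
    (F := fun t g => f (phaseCurve hσ t * g)) (F' := fun t g => f' (phaseCurve hσ t * g))
    (x₀ := (0 : ℝ)) (bound := fun _ => C) Filter.univ_mem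
    (Filter.Eventually.of_forall fun t => (hf.comp (hm t)).aestronglyMeasurable)
    (integrable_haarU (hf.comp (hm 0))) (hf'.comp (hm 0)).aestronglyMeasurable
    (Filter.Eventually.of_forall fun g t _ => hC _ (Set.mem_univ _)) (integrable_const C)
    (Filter.Eventually.of_forall fun g t _ => h g t)).2
  simp only [integral_mul_left_eq_self] at h1
  exact h1.unique (hasDerivAt_const _ _)

theorem hasDerivAt_eval {σ : Type*} [Fintype σ] (p : MvPolynomial σ ℂ) {γ : ℝ → σ → ℂ}
    {γ' : σ → ℂ} {t : ℝ} (h : HasDerivAt γ γ' t) :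
    HasDerivAt (fun s => MvPolynomial.eval (γ s) p)
      (∑ i, MvPolynomial.eval (γ t) (MvPolynomial.pderiv i p) * γ' i) t := by
  classical
  induction p using MvPolynomial.induction_on with
  | C a => simpa using hasDerivAt_const t a
  | add p q hp hq =>
    simp only [map_add, add_mul, Finset.sum_add_distrib]
    exact hp.add hq
  | mul_X p i hp =>
    simp only [map_mul, MvPolynomial.eval_X]
    refine (hp.mul (hasDerivAt_pi.1 h i)).congr_deriv ?_
    simp only [Derivation.leibniz, MvPolynomial.pderiv_X, smul_eq_mul, map_add, map_mul,
      MvPolynomial.eval_X, add_mul, Finset.sum_add_distrib, Finset.sum_mul]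
    rw [add_comm]
    congr 1
    · rw [Finset.sum_eq_single i (fun j _ hj => by simp [Pi.single_eq_of_ne' hj]) (by simp)]
      simp
    · exact Finset.sum_congr rfl fun j _ => by ring

/-- Scaling extends the vanishing from unit vectors to all vectors. Polarizing with the pairs e_a,
e_b and e_a, i e_b then isolates the single coefficient. -/
theorem eq_zero_of_forall_sum_mul_star {ι : Type*} [Fintype ι] [DecidableEq ι] {T : ι → ι → ℂ}
    (h : ∀ w : ι → ℂ, star w ⬝ᵥ w = 1 → ∑ a, ∑ b, w a * star (w b) * T a b = 0) (a b : ι) :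
    T a b = 0 := by
  have h1 : ∀ w : ι → ℂ, ∑ a, ∑ b, w a * star (w b) * T a b = 0 := by
    intro w
    by_cases hw : w = 0
    · simp [hw]
    have hpos := Complex.lt_def.1 (Matrix.dotProduct_star_self_pos_iff.2 hw)
    set r : ℝ := (star w ⬝ᵥ w).re with hr
    have hr0 : 0 < r := hpos.1
    have hwr : star w ⬝ᵥ w = r := Complex.ext rfl hpos.2.symm
    have hc : (((√r)⁻¹ : ℝ) : ℂ) * ((√r)⁻¹ : ℝ) = ((r⁻¹ : ℝ) : ℂ) := by
      rw [← Complex.ofReal_mul, ← mul_inv, Real.mul_self_sqrt hr0.le]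
    have h2 := h ((((√r)⁻¹ : ℝ) : ℂ) • w) (by
      rw [star_smul, smul_dotProduct, dotProduct_smul, hwr, Complex.star_def, Complex.conj_ofReal,
        smul_eq_mul, smul_eq_mul, ← mul_assoc, hc, ← Complex.ofReal_mul,
        inv_mul_cancel₀ hr0.ne', Complex.ofReal_one])
    have h3 : ∀ a b, ((((√r)⁻¹ : ℝ) : ℂ) • w) a * star (((((√r)⁻¹ : ℝ) : ℂ) • w) b) * T a b =
        ((r⁻¹ : ℝ) : ℂ) * (w a * star (w b) * T a b) := fun a b => by
      rw [← hc]
      simp only [Pi.smul_apply, smul_eq_mul, star_mul', Complex.star_def, Complex.conj_ofReal]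
      ring
    simp only [h3, ← Finset.mul_sum] at h2
    exact (mul_eq_zero.1 h2).resolve_left (by exact_mod_cast (inv_pos.2 hr0).ne')
  have h2 : ∀ x y : ι → ℂ, ∑ a, ∑ b, x a * star (y b) * T a b +
      ∑ a, ∑ b, y a * star (x b) * T a b = 0 := by
    intro x y
    have h3 := h1 (x + y)
    have h4 : ∀ a b, (x + y) a * star ((x + y) b) * T a b = x a * star (x b) * T a b +
      y a * star (y b) * T a b + (x a * star (y b) * T a b + y a * star (x b) * T a b) :=
        fun a b => by simp only [Pi.add_apply, star_add]; ring
    simpa only [h4, Finset.sum_add_distrib, h1, zero_add] using h3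
  have h5 : ∀ (i j : ι) (c e : ℂ), ∑ a, ∑ b, (Pi.single i c : ι → ℂ) a *
      star ((Pi.single j e : ι → ℂ) b) * T a b = c * star e * T i j := by
    intro i j c e
    rw [Finset.sum_eq_single i (fun k _ hk => by simp [Pi.single_eq_of_ne hk]) (by simp),
      Finset.sum_eq_single j (fun k _ hk => by simp [Pi.single_eq_of_ne hk]) (by simp),
      Pi.single_eq_same, Pi.single_eq_same]
  have h6 := h2 (Pi.single a 1) (Pi.single b 1)
  have h7 := h2 (Pi.single a 1) (Pi.single b Complex.I)
  rw [h5, h5] at h6 h7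
  simp only [Complex.star_def, Complex.conj_I, map_one] at h6 h7
  linear_combination (1 / 2) * h6 + (Complex.I / 2) * h7 + (T a b - T b a) / 2 * Complex.I_sq

/-- The linear form `z ↦ ⟨s, z⟩`. -/
def linearForm {d : ℕ} (s : Fin d → ℂ) : MvPolynomial (Fin d) ℂ :=
  ∑ i, star (s i) • MvPolynomial.X i

theorem eval_linearForm {d : ℕ} (s z : Fin d → ℂ) :
    MvPolynomial.eval z (linearForm s) = star s ⬝ᵥ z := by
  simp [linearForm, dotProduct]

theorem isHomogeneous_linearForm {d : ℕ} (s : Fin d → ℂ) : (linearForm s).IsHomogeneous 1 :=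
  MvPolynomial.IsHomogeneous.sum _ _ _ fun i _ =>
    (MvPolynomial.homogeneousSubmodule (Fin d) ℂ 1).smul_mem _ (MvPolynomial.isHomogeneous_X ℂ i)

theorem pderiv_linearForm {d : ℕ} (s : Fin d → ℂ) (i : Fin d) :
    MvPolynomial.pderiv i (linearForm s) = MvPolynomial.C (star (s i)) := by
  simp only [linearForm, map_sum, Derivation.map_smul, MvPolynomial.pderiv_X]
  rw [Finset.sum_eq_single i (fun j _ hj => by simp [Pi.single_eq_of_ne hj]) (by simp)]
  simp [MvPolynomial.smul_eq_C_mul]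

/-- The derivative of a polynomial in the direction `s`. -/
def dirDeriv {d : ℕ} (s : Fin d → ℂ) (q : MvPolynomial (Fin d) ℂ) : MvPolynomial (Fin d) ℂ :=
  ∑ i, s i • MvPolynomial.pderiv i q

/-- Product rule: the form ⟨s, ·⟩ has derivative ‖s‖² = 1 in the direction s. -/
theorem dirDeriv_linearForm_mul {d : ℕ} {s : Fin d → ℂ} (hs : star s ⬝ᵥ s = 1)
    (q : MvPolynomial (Fin d) ℂ) :
    dirDeriv s (linearForm s * q) = q + linearForm s * dirDeriv s q := by
  simp only [dirDeriv, Derivation.leibniz, pderiv_linearForm, smul_add, Finset.sum_add_distrib,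
    Finset.mul_sum, smul_eq_mul, mul_smul_comm]
  rw [add_comm]
  congr 1
  have : ∑ i, s i * star (s i) = 1 := by
    rw [← hs, dotProduct]
    exact Finset.sum_congr rfl fun i _ => mul_comm _ _
  simp only [mul_comm q, ← MvPolynomial.smul_eq_C_mul, smul_smul]
  rw [← Finset.sum_smul, this, one_smul]

theorem dirDeriv_linearForm_pow {d : ℕ} {s : Fin d → ℂ} (hs : star s ⬝ᵥ s = 1) (k : ℕ) :
    linearForm s * dirDeriv s (linearForm s ^ k) = (k : ℂ) • linearForm s ^ k := by
  induction k with
  | zero => simp [dirDeriv]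
  | succ k ih =>
    rw [pow_succ', dirDeriv_linearForm_mul hs, ih]
    push_cast
    rw [add_smul, one_smul, mul_add, mul_smul_comm, add_comm]

/-- The first vector of the orthonormal basis formed by the columns of a unitary matrix. -/
def firstCol {d : ℕ} [NeZero d] (u : U d) : Fin d → ℂ := (u : Matrix (Fin d) (Fin d) ℂ).col 0

/-! ### Inner products of polynomials on the unit sphere -/

section

variable {d : ℕ} [NeZero d]

theorem firstCol_mul (g u : U d) :
    firstCol (g * u) = (g : Matrix (Fin d) (Fin d) ℂ) *ᵥ firstCol u := by
  ext a
  simp [firstCol, Matrix.mul_apply, Matrix.mulVec, dotProduct]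

theorem star_firstCol_dotProduct_self (u : U d) : star (firstCol u) ⬝ᵥ firstCol u = 1 := by
  have h := congrFun (congrFun (Matrix.mem_unitaryGroup_iff'.1 u.2) 0) 0
  simpa [firstCol, Matrix.mul_apply, Matrix.star_apply, dotProduct] using h

theorem continuous_firstCol : Continuous (firstCol : U d → Fin d → ℂ) :=
  continuous_pi fun i => continuous_subtype_val.matrix_elem i 0

theorem continuous_eval_firstCol (p : MvPolynomial (Fin d) ℂ) :
    Continuous fun u : U d => MvPolynomial.eval (firstCol u) p :=
  (MvPolynomial.continuous_eval p).comp continuous_firstCol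

/-- The `L²` inner product of two polynomials on the unit sphere of `ℂ^d`, linear in the first
argument. -/
def sphereInner (p q : MvPolynomial (Fin d) ℂ) : ℂ :=
  ∫ u, MvPolynomial.eval (firstCol u) p * star (MvPolynomial.eval (firstCol u) q) ∂haarU d

theorem integrable_sphereInner (p q : MvPolynomial (Fin d) ℂ) :
    Integrable (fun u => MvPolynomial.eval (firstCol u) p *
      star (MvPolynomial.eval (firstCol u) q)) (haarU d) :=
  integrable_haarU ((continuous_eval_firstCol p).mul (continuous_eval_firstCol q).star)

theorem star_sphereInner (p q : MvPolynomial (Fin d) ℂ) :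
    star (sphereInner p q) = sphereInner q p := by
  rw [sphereInner, Complex.star_def, ← integral_conj, sphereInner]
  congr 1
  ext u
  simp [mul_comm]

theorem sphereInner_add_left (p p' q : MvPolynomial (Fin d) ℂ) :
    sphereInner (p + p') q = sphereInner p q + sphereInner p' q := by
  rw [sphereInner, sphereInner, sphereInner,
    ← integral_add (integrable_sphereInner p q) (integrable_sphereInner p' q)]
  simp only [map_add, add_mul]

theorem sphereInner_smul_left (c : ℂ) (p q : MvPolynomial (Fin d) ℂ) :
    sphereInner (c • p) q = c * sphereInner p q := by
  rw [sphereInner, sphereInner, ← integral_const_mul]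
  simp only [MvPolynomial.smul_eval, mul_assoc]

theorem sphereInner_sum_left {ι : Type*} (s : Finset ι) (p : ι → MvPolynomial (Fin d) ℂ)
    (q : MvPolynomial (Fin d) ℂ) :
    sphereInner (∑ i ∈ s, p i) q = ∑ i ∈ s, sphereInner (p i) q := by
  simp only [sphereInner]
  rw [← integral_finsetSum _ fun i _ => integrable_sphereInner (p i) q]
  simp only [map_sum, Finset.sum_mul]

theorem sphereInner_add_right (p q q' : MvPolynomial (Fin d) ℂ) :
    sphereInner p (q + q') = sphereInner p q + sphereInner p q' := by
  rw [← star_sphereInner, sphereInner_add_left, star_add, star_sphereInner, star_sphereInner]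

theorem sphereInner_smul_right (c : ℂ) (p q : MvPolynomial (Fin d) ℂ) :
    sphereInner p (c • q) = star c * sphereInner p q := by
  rw [← star_sphereInner, sphereInner_smul_left, star_mul', star_sphereInner]

theorem sphereInner_sum_right {ι : Type*} (s : Finset ι) (p : MvPolynomial (Fin d) ℂ)
    (q : ι → MvPolynomial (Fin d) ℂ) :
    sphereInner p (∑ i ∈ s, q i) = ∑ i ∈ s, sphereInner p (q i) := by
  rw [← star_sphereInner, sphereInner_sum_left, star_sum]
  simp only [star_sphereInner]

theorem sphereInner_self_eq (p : MvPolynomial (Fin d) ℂ) :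
    sphereInner p p = ((∫ u, Complex.normSq (MvPolynomial.eval (firstCol u) p) ∂haarU d : ℝ) : ℂ) := by
  rw [sphereInner, ← integral_complex_ofReal]
  simp only [Complex.star_def, Complex.mul_conj]

/-- Rotation invariance of the inner product, differentiated along 1 + (e^{it} - 1)|w⟩⟨w|.
Infinitesimally z moves by i⟨w, z⟩w; the conjugate on the second factor turns i into -i, hence the
minus sign. -/
theorem sum_mul_sphereInner_sub_eq_zero (p q : MvPolynomial (Fin d) ℂ) {w : Fin d → ℂ}
    (hw : star w ⬝ᵥ w = 1) :
    ∑ a, ∑ b, w a * star (w b) * (sphereInner (MvPolynomial.X b * MvPolynomial.pderiv a p) q -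
      sphereInner p (MvPolynomial.X a * MvPolynomial.pderiv b q)) = 0 := by
  have hσ := isPureState_vecMulVec hw
  have h := integral_deriv_phaseCurve_eq_zero hσ
    (f := fun u => MvPolynomial.eval (firstCol u) p * star (MvPolynomial.eval (firstCol u) q))
    (f' := fun u =>
      (∑ a, MvPolynomial.eval (firstCol u) (MvPolynomial.pderiv a p) *
        (Complex.I • Matrix.vecMulVec w (star w) *ᵥ firstCol u) a) *
        star (MvPolynomial.eval (firstCol u) q) +
      MvPolynomial.eval (firstCol u) p *
        star (∑ b, MvPolynomial.eval (firstCol u) (MvPolynomial.pderiv b q) *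
          (Complex.I • Matrix.vecMulVec w (star w) *ᵥ firstCol u) b))
    ((continuous_eval_firstCol p).mul (continuous_eval_firstCol q).star) ?_ ?_
  · have h2 : ∀ u : U d, (∑ a, MvPolynomial.eval (firstCol u) (MvPolynomial.pderiv a p) *
        (Complex.I • Matrix.vecMulVec w (star w) *ᵥ firstCol u) a) *
        star (MvPolynomial.eval (firstCol u) q) +
      MvPolynomial.eval (firstCol u) p *
        star (∑ b, MvPolynomial.eval (firstCol u) (MvPolynomial.pderiv b q) *
          (Complex.I • Matrix.vecMulVec w (star w) *ᵥ firstCol u) b) =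
      ∑ a, ∑ b, Complex.I * (w a * star (w b)) *
        (MvPolynomial.eval (firstCol u) (MvPolynomial.X b * MvPolynomial.pderiv a p) *
          star (MvPolynomial.eval (firstCol u) q) -
        MvPolynomial.eval (firstCol u) p *
          star (MvPolynomial.eval (firstCol u) (MvPolynomial.X a * MvPolynomial.pderiv b q))) := by
      intro u
      have h3 : ∀ a, (Complex.I • Matrix.vecMulVec w (star w) *ᵥ firstCol u) a =
          ∑ b, Complex.I * (w a * star (w b)) * firstCol u b := fun a => by
        simp only [Pi.smul_apply, Matrix.mulVec, dotProduct, Matrix.vecMulVec_apply, smul_eq_mul,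
          Finset.mul_sum, Pi.star_apply, mul_assoc]
      simp only [h3, mul_sub, Finset.sum_sub_distrib]
      rw [sub_eq_add_neg]
      congr 1
      · simp only [Finset.mul_sum, Finset.sum_mul, map_mul, MvPolynomial.eval_X]
        exact Finset.sum_congr rfl fun a _ => Finset.sum_congr rfl fun b _ => by ring
      · simp only [Finset.mul_sum, star_sum, map_mul, MvPolynomial.eval_X, star_mul', star_star,
          ← Finset.sum_neg_distrib]
        rw [Finset.sum_comm]
        refine Finset.sum_congr rfl fun a _ => Finset.sum_congr rfl fun b _ => ?_
        rw [Complex.star_def, Complex.conj_I]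
        ring
    simp only [h2] at h
    have hi : ∀ a b, Integrable (fun u => Complex.I * (w a * star (w b)) *
        (MvPolynomial.eval (firstCol u) (MvPolynomial.X b * MvPolynomial.pderiv a p) *
          star (MvPolynomial.eval (firstCol u) q) -
        MvPolynomial.eval (firstCol u) p *
          star (MvPolynomial.eval (firstCol u) (MvPolynomial.X a * MvPolynomial.pderiv b q))))
        (haarU d) := fun a b =>
      ((integrable_sphereInner _ _).sub (integrable_sphereInner _ _)).const_mul _
    rw [integral_finsetSum _ fun a _ => integrable_finsetSum _ fun b _ => hi a b] at h
    have h4 : ∀ a, ∫ u, ∑ b, Complex.I * (w a * star (w b)) *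
        (MvPolynomial.eval (firstCol u) (MvPolynomial.X b * MvPolynomial.pderiv a p) *
          star (MvPolynomial.eval (firstCol u) q) -
        MvPolynomial.eval (firstCol u) p *
          star (MvPolynomial.eval (firstCol u) (MvPolynomial.X a * MvPolynomial.pderiv b q)))
        ∂haarU d = Complex.I * ∑ b, w a * star (w b) *
          (sphereInner (MvPolynomial.X b * MvPolynomial.pderiv a p) q -
      sphereInner p (MvPolynomial.X a * MvPolynomial.pderiv b q)) := fun a => by
      rw [integral_finsetSum _ fun b _ => hi a b, Finset.mul_sum]
      refine Finset.sum_congr rfl fun b _ => ?_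
      rw [integral_const_mul, integral_sub (integrable_sphereInner _ _)
        (integrable_sphereInner _ _), mul_assoc Complex.I]
      rfl
    simp only [h4, ← Finset.mul_sum] at h
    exact (mul_eq_zero.1 h).resolve_left Complex.I_ne_zero
  · have hc : ∀ a, Continuous fun u : U d =>
        (Complex.I • Matrix.vecMulVec w (star w) *ᵥ firstCol u) a := fun a =>
      continuous_const.mul ((continuous_apply a).comp
        (Continuous.matrix_mulVec continuous_const continuous_firstCol))
    exact ((continuous_finsetSum _ fun a _ => (continuous_eval_firstCol _).mul (hc a)).mul
      (continuous_eval_firstCol q).star).add ((continuous_eval_firstCol p).mul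
        (continuous_finsetSum _ fun b _ => (continuous_eval_firstCol _).mul (hc b)).star)
  · intro g t
    have h1 : HasDerivAt (fun t => firstCol (phaseCurve hσ t * g))
        (Complex.I • Matrix.vecMulVec w (star w) *ᵥ firstCol (phaseCurve hσ t * g)) t := by
      have := hasDerivAt_phaseCurve_mulVec hσ 1 (firstCol g) t
      simp only [Matrix.one_mul] at this
      simp only [firstCol_mul]
      refine this.congr_deriv ?_
      rw [Matrix.mulVec_smul, Matrix.mulVec_mulVec, Matrix.mulVec_mulVec, coe_phaseCurve]
      congr 2
      rw [Matrix.mul_add, Matrix.add_mul, Matrix.mul_smul, Matrix.smul_mul, Matrix.one_mul,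
        Matrix.mul_one]
    exact (hasDerivAt_eval p h1).mul (hasDerivAt_eval q h1).star

/-- Unitarity of the rotation action at the level of generators: X_b ∂_a and X_a ∂_b are adjoint.
The rank-one identities suffice by polarization. -/
theorem sphereInner_X_mul_pderiv (p q : MvPolynomial (Fin d) ℂ) (a b : Fin d) :
    sphereInner (MvPolynomial.X b * MvPolynomial.pderiv a p) q =
      sphereInner p (MvPolynomial.X a * MvPolynomial.pderiv b q) :=
  sub_eq_zero.1 (eq_zero_of_forall_sum_mul_star
    (T := fun a b => sphereInner (MvPolynomial.X b * MvPolynomial.pderiv a p) q -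
      sphereInner p (MvPolynomial.X a * MvPolynomial.pderiv b q))
    (fun _ hw => sum_mul_sphereInner_sub_eq_zero p q hw) a b)

theorem sum_sphereInner_X_mul (p q : MvPolynomial (Fin d) ℂ) :
    ∑ i, sphereInner (MvPolynomial.X i * p) (MvPolynomial.X i * q) = sphereInner p q := by
  simp only [sphereInner]
  rw [← integral_finsetSum _ fun i _ => integrable_sphereInner _ _]
  congr 1
  ext u
  have h := star_firstCol_dotProduct_self u
  rw [dotProduct] at h
  simp only [map_mul, MvPolynomial.eval_X, star_mul']
  calc _ = ∑ i, (star (firstCol u) i * firstCol u i) * (MvPolynomial.eval (firstCol u) p *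
      star (MvPolynomial.eval (firstCol u) q)) :=
        Finset.sum_congr rfl fun i _ => by rw [Pi.star_apply]; ring
    _ = _ := by rw [← Finset.sum_mul, h, one_mul]

/-- Multiplication by a coordinate is, up to a factor, adjoint to the partial derivative. -/
theorem sphereInner_X_mul {n : ℕ} {r : MvPolynomial (Fin d) ℂ} (hr : r.IsHomogeneous n)
    (q : MvPolynomial (Fin d) ℂ) (i : Fin d) :
    (n + d) * sphereInner (MvPolynomial.X i * r) q = sphereInner r (MvPolynomial.pderiv i q) := by
  -- Insert ∑|z_j|² = 1 on the right and move X_j ∂_i to the first argument, where it becomes X_i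
  -- ∂_j. Euler's identity evaluates ∑ ∂_j(X_j r) as (n + d) r.
  rw [← sum_sphereInner_X_mul r]
  simp only [← sphereInner_X_mul_pderiv]
  rw [← sphereInner_sum_left]
  have h : ∑ j, MvPolynomial.X i * MvPolynomial.pderiv j (MvPolynomial.X j * r) =
      ((n : ℂ) + d) • (MvPolynomial.X i * r) := by
    simp only [Derivation.leibniz, MvPolynomial.pderiv_X_self, smul_eq_mul, mul_one]
    rw [← Finset.mul_sum, Finset.sum_add_distrib, hr.sum_X_mul_pderiv]
    simp only [Finset.sum_const, Finset.card_univ, Fintype.card_fin, ← add_smul, mul_smul_comm]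
    rw [← Nat.cast_add, Nat.cast_smul_eq_nsmul]
  rw [h, sphereInner_smul_left]

theorem sphereInner_linearForm_mul {n : ℕ} {r : MvPolynomial (Fin d) ℂ} (hr : r.IsHomogeneous n)
    (q : MvPolynomial (Fin d) ℂ) (s : Fin d → ℂ) :
    (n + d) * sphereInner (linearForm s * r) q = sphereInner r (dirDeriv s q) := by
  rw [linearForm, dirDeriv, Finset.sum_mul, sphereInner_sum_left, sphereInner_sum_right,
    Finset.mul_sum]
  refine Finset.sum_congr rfl fun i _ => ?_
  rw [smul_mul_assoc, sphereInner_smul_left, sphereInner_smul_right, ← sphereInner_X_mul hr]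
  ring

theorem sphereInner_linearForm_mul_self {n : ℕ} {q : MvPolynomial (Fin d) ℂ}
    (hq : q.IsHomogeneous n) {s : Fin d → ℂ} (hs : star s ⬝ᵥ s = 1) :
    (n + d) * sphereInner (linearForm s * q) (linearForm s * q) =
      sphereInner q q + sphereInner q (linearForm s * dirDeriv s q) := by
  rw [sphereInner_linearForm_mul hq, dirDeriv_linearForm_mul hs, sphereInner_add_right]

theorem normSq_dotProduct_le {ι : Type*} [Fintype ι] {s : ι → ℂ} (hs : star s ⬝ᵥ s = 1)
    (z : ι → ℂ) : Complex.normSq (s ⬝ᵥ z) ≤ ∑ i, Complex.normSq (z i) := by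
  have h1 : ∑ i, ‖s i‖ ^ 2 = 1 := by
    have := congrArg Complex.re hs
    rw [dotProduct, Complex.re_sum] at this
    rw [← Complex.one_re, ← this]
    exact Finset.sum_congr rfl fun i _ => by
      rw [Pi.star_apply, Complex.star_def, ← Complex.normSq_eq_conj_mul_self, Complex.ofReal_re,
        Complex.normSq_eq_norm_sq]
  have h2 : ‖s ⬝ᵥ z‖ ≤ ∑ i, ‖s i‖ * ‖z i‖ :=
    (norm_sum_le _ _).trans_eq (Finset.sum_congr rfl fun i _ => norm_mul _ _)
  have h3 := Finset.sum_mul_sq_le_sq_mul_sq Finset.univ (fun i => ‖s i‖) fun i => ‖z i‖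
  rw [h1, one_mul] at h3
  simp only [Complex.normSq_eq_norm_sq]
  exact (pow_le_pow_left₀ (norm_nonneg _) h2 2).trans h3

/-- The second moment in any direction of a homogeneous polynomial on the sphere is at most that
of a power of the corresponding linear form. -/
theorem integral_normSq_mul_normSq_le {n : ℕ} {q : MvPolynomial (Fin d) ℂ}
    (hq : q.IsHomogeneous n) {s : Fin d → ℂ} (hs : star s ⬝ᵥ s = 1) :
    ∫ u, Complex.normSq (star s ⬝ᵥ firstCol u) *
        Complex.normSq (MvPolynomial.eval (firstCol u) q) ∂haarU d ≤
      (n + 1) / (n + d) * ∫ u, Complex.normSq (MvPolynomial.eval (firstCol u) q) ∂haarU d := by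
  have hd : (0 : ℝ) < d := by exact_mod_cast NeZero.pos d
  -- The adjunction factor for the partial derivatives of q, of degree n - 1. If n = 0 the truncated
  -- difference is 0, and c is still positive.
  set c : ℝ := ((n - 1 : ℕ) : ℝ) + d with hc
  have hcpos : 0 < c := by positivity
  have hcC : (c : ℂ) = ((n - 1 : ℕ) : ℂ) + d := by rw [hc]; push_cast; rfl
  have hD : (dirDeriv s q).IsHomogeneous (n - 1) :=
    MvPolynomial.IsHomogeneous.sum _ _ _ fun i _ =>
      (MvPolynomial.homogeneousSubmodule (Fin d) ℂ (n - 1)).smul_mem _ hq.pderiv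
  have h1 := congrArg star (sphereInner_linearForm_mul hD q s)
  rw [star_sphereInner, ← hcC, star_mul', star_sphereInner, Complex.star_def, Complex.conj_ofReal,
    sphereInner_self_eq] at h1
  -- Euler's identity for q, followed by the adjunction, expresses n‖q‖² through the norms of the
  -- partial derivatives.
  have h2 : (n : ℂ) * sphereInner q q =
      (c : ℂ)⁻¹ * ∑ i, sphereInner (MvPolynomial.pderiv i q) (MvPolynomial.pderiv i q) := by
    have h3 : ∀ i, sphereInner (MvPolynomial.pderiv i q) (MvPolynomial.pderiv i q) =
        c * sphereInner (MvPolynomial.X i * MvPolynomial.pderiv i q) q := fun i => by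
      rw [hcC, sphereInner_X_mul hq.pderiv]
    simp only [h3]
    rw [← Finset.mul_sum, ← mul_assoc, inv_mul_cancel₀ (by exact_mod_cast hcpos.ne'), one_mul,
      ← sphereInner_sum_left, hq.sum_X_mul_pderiv, ← Nat.cast_smul_eq_nsmul ℂ,
      sphereInner_smul_left]
  have hint : ∀ p : MvPolynomial (Fin d) ℂ, Integrable
      (fun u => Complex.normSq (MvPolynomial.eval (firstCol u) p)) (haarU d) := fun p =>
    integrable_haarU (Complex.continuous_normSq.comp (continuous_eval_firstCol p))
  simp only [sphereInner_self_eq] at h2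
  have h4 : (n : ℝ) * ∫ u, Complex.normSq (MvPolynomial.eval (firstCol u) q) ∂haarU d =
      c⁻¹ * ∑ i, ∫ u, Complex.normSq (MvPolynomial.eval (firstCol u)
        (MvPolynomial.pderiv i q)) ∂haarU d := by exact_mod_cast h2
  -- The only inequality of the proof: a derivative in a unit direction is at most the full
  -- gradient, so that ‖D_s q‖² ≤ c n ‖q‖².
  have h5 : ∫ u, Complex.normSq (MvPolynomial.eval (firstCol u) (dirDeriv s q)) ∂haarU d ≤
      ∑ i, ∫ u, Complex.normSq (MvPolynomial.eval (firstCol u)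
        (MvPolynomial.pderiv i q)) ∂haarU d := by
    rw [← integral_finsetSum _ fun i _ => hint _]
    refine integral_mono (hint _) (integrable_finsetSum _ fun i _ => hint _) fun u => ?_
    have h6 := normSq_dotProduct_le hs fun i =>
      MvPolynomial.eval (firstCol u) (MvPolynomial.pderiv i q)
    simpa [dirDeriv, dotProduct] using h6
  have h7 := sphereInner_linearForm_mul_self hq hs
  have h8 : sphereInner q (linearForm s * dirDeriv s q) = ((c⁻¹ *
      ∫ u, Complex.normSq (MvPolynomial.eval (firstCol u) (dirDeriv s q)) ∂haarU d : ℝ) : ℂ) := by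
    rw [Complex.ofReal_mul, ← h1, Complex.ofReal_inv, ← mul_assoc,
      inv_mul_cancel₀ (by exact_mod_cast hcpos.ne'), one_mul]
  rw [h8, sphereInner_self_eq, sphereInner_self_eq] at h7
  have h9 : ((n : ℝ) + d) * ∫ u, Complex.normSq (MvPolynomial.eval (firstCol u)
      (linearForm s * q)) ∂haarU d =
      (∫ u, Complex.normSq (MvPolynomial.eval (firstCol u) q) ∂haarU d) + c⁻¹ *
      ∫ u, Complex.normSq (MvPolynomial.eval (firstCol u) (dirDeriv s q)) ∂haarU d := by
    exact_mod_cast h7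
  simp only [map_mul, eval_linearForm] at h9
  rw [div_mul_eq_mul_div, le_div_iff₀ (by positivity), mul_comm, h9, add_mul, one_mul, h4, add_comm]
  gcongr

/-- The moment `∫ |⟨s, z⟩|^{2k}` of a uniformly distributed unit vector `z`. -/
def sphereMoment (d k : ℕ) : ℝ := ∏ j ∈ Finset.range k, ((j : ℝ) + 1) / (j + d)

theorem sphereMoment_pos (k : ℕ) : 0 < sphereMoment d k :=
  Finset.prod_pos fun j _ => by
    have : (0 : ℝ) < d := by exact_mod_cast NeZero.pos d
    positivity

/-- For q = ⟨s, ·⟩^k the adjunction formula is an exact recursion, (k + d)‖⟨s, ·⟩^{k+1}‖² = (k +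
1)‖⟨s, ·⟩^k‖². -/
theorem integral_normSq_pow {s : Fin d → ℂ} (hs : star s ⬝ᵥ s = 1) (k : ℕ) :
    ∫ u, Complex.normSq (star s ⬝ᵥ firstCol u) ^ k ∂haarU d = sphereMoment d k := by
  have h1 : sphereInner (linearForm s ^ k) (linearForm s ^ k) = (sphereMoment d k : ℂ) := by
    induction k with
    | zero => simp [sphereInner, sphereMoment]
    | succ k ih =>
      have hd : (0 : ℝ) < d := by exact_mod_cast NeZero.pos d
      have h2 := sphereInner_linearForm_mul_self ((isHomogeneous_linearForm s).pow k) hs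
      rw [one_mul, dirDeriv_linearForm_pow hs, sphereInner_smul_right, ih, ← pow_succ'] at h2
      rw [sphereMoment, Finset.prod_range_succ, ← sphereMoment]
      have h3 : ((k : ℂ) + d) ≠ 0 := by
        have : ((k : ℝ) + d) ≠ 0 := by positivity
        exact_mod_cast this
      push_cast
      rw [← mul_div_assoc, eq_div_iff h3, mul_comm, h2]
      simp
      ring
  rw [sphereInner_self_eq] at h1
  simpa only [map_pow, eval_linearForm] using Complex.ofReal_injective h1

/-- The moments decay only polynomially in k, which will lose against r^k. The induction step is
Bernoulli's inequality (1 + 1/(k+1))^{d-1} ≥ (k+d)/(k+1). -/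
theorem one_le_sphereMoment_mul (k : ℕ) :
    1 ≤ sphereMoment d k * ((k : ℝ) + 1) ^ (d - 1) := by
  induction k with
  | zero => simp [sphereMoment]
  | succ k ih =>
    have hd : (0 : ℝ) < d := by exact_mod_cast NeZero.pos d
    have hd1 : ((d - 1 : ℕ) : ℝ) = d - 1 := by rw [Nat.cast_sub NeZero.one_le]; simp
    refine ih.trans ?_
    rw [sphereMoment, sphereMoment, Finset.prod_range_succ, mul_assoc]
    refine mul_le_mul_of_nonneg_left ?_ (sphereMoment_pos (d := d) k).le
    have h1 := one_add_mul_le_pow (a := 1 / ((k : ℝ) + 1))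
      (by have : (0 : ℝ) ≤ 1 / ((k : ℝ) + 1) := by positivity
          linarith) (d - 1)
    have h2 : (1 + 1 / ((k : ℝ) + 1)) = (k + 2) / (k + 1) := by field_simp; ring
    have h3 : 1 + ((d - 1 : ℕ) : ℝ) * (1 / ((k : ℝ) + 1)) = (k + d) / (k + 1) := by
      rw [hd1]; field_simp; ring
    rw [h2, h3, div_pow, div_le_div_iff₀ (by positivity) (by positivity)] at h1
    rw [div_mul_eq_mul_div, le_div_iff₀ (by positivity)]
    push_cast
    rw [show (k : ℝ) + 1 + 1 = k + 2 by ring]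
    linarith

end

/-! ### The mean fidelity of an estimator -/

/-- The homogeneous polynomial `z ↦ ∑ I, c I * z^{⊗N} I`. -/
def tensorForm {d N : ℕ} (c : (Fin N → Fin d) → ℂ) : MvPolynomial (Fin d) ℂ :=
  ∑ I, c I • ∏ k, MvPolynomial.X (I k)

theorem eval_tensorForm {d N : ℕ} (c : (Fin N → Fin d) → ℂ) (z : Fin d → ℂ) :
    MvPolynomial.eval z (tensorForm c) = c ⬝ᵥ powVec N z := by
  simp [tensorForm, dotProduct, powVec, prodVec]

theorem isHomogeneous_tensorForm {d N : ℕ} (c : (Fin N → Fin d) → ℂ) :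
    (tensorForm c).IsHomogeneous N :=
  MvPolynomial.IsHomogeneous.sum _ _ _ fun I _ =>
    (MvPolynomial.homogeneousSubmodule (Fin d) ℂ N).smul_mem _ (by
      have := MvPolynomial.IsHomogeneous.prod Finset.univ
        (fun k : Fin N => (MvPolynomial.X (I k) : MvPolynomial (Fin d) ℂ)) (fun _ => 1)
        fun k _ => MvPolynomial.isHomogeneous_X ℂ (I k)
      simpa using this)

theorem re_star_dotProduct_conjTranspose_mul_self {ι : Type*} [Fintype ι] (C : Matrix ι ι ℂ)
    (a : ι → ℂ) : (star a ⬝ᵥ (Cᴴ * C) *ᵥ a).re = ∑ i, Complex.normSq (C i ⬝ᵥ a) := by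
  rw [← Matrix.mulVec_mulVec, Matrix.dotProduct_mulVec, ← Matrix.star_mulVec, dotProduct,
    Complex.re_sum]
  refine Finset.sum_congr rfl fun i _ => ?_
  rw [Pi.star_apply, Complex.star_def, ← Complex.normSq_eq_conj_mul_self, Complex.ofReal_re]
  rfl

theorem measurable_pureState_apply {d : ℕ} (i j : Fin d) :
    Measurable fun φ : PureState d => φ.1 i j :=
  (continuous_subtype_val.matrix_elem i j).measurable

section

variable {d : ℕ} [NeZero d]

/-- Writing m = C*C, the likelihood is a sum of squared moduli of polynomials of degree N, one for
each row of C. The weight |⟨s, z⟩|^{2k} multiplies each polynomial by ⟨s, z⟩^k, and the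
second-moment bound applies in degree N + k. -/
theorem integral_overlap_mul_normSq_le {N : ℕ} {m : Matrix (Fin N → Fin d) (Fin N → Fin d) ℂ}
    (hm : m.PosSemidef) {s t : Fin d → ℂ} (ht : star t ⬝ᵥ t = 1) (k : ℕ) :
    ∫ u, Complex.normSq (star s ⬝ᵥ firstCol u) ^ k * (Complex.normSq (star t ⬝ᵥ firstCol u) *
        (star (powVec N (firstCol u)) ⬝ᵥ m *ᵥ powVec N (firstCol u)).re) ∂haarU d ≤
      ((N : ℝ) + k + 1) / (N + k + d) *
        ∫ u, Complex.normSq (star s ⬝ᵥ firstCol u) ^ k *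
          (star (powVec N (firstCol u)) ⬝ᵥ m *ᵥ powVec N (firstCol u)).re ∂haarU d := by
  obtain ⟨C, rfl⟩ := exists_conjTranspose_mul_self hm
  simp only [re_star_dotProduct_conjTranspose_mul_self]
  set q := fun I => linearForm s ^ k * tensorForm (C I) with hq
  have hqh : ∀ I, (q I).IsHomogeneous (N + k) := fun I => by
    have := ((isHomogeneous_linearForm s).pow k).mul (isHomogeneous_tensorForm (C I))
    rwa [one_mul, add_comm] at this
  have hqe : ∀ I (u : U d), Complex.normSq (MvPolynomial.eval (firstCol u) (q I)) =
      Complex.normSq (star s ⬝ᵥ firstCol u) ^ k * Complex.normSq (C I ⬝ᵥ powVec N (firstCol u)) :=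
    fun I u => by
      rw [hq, map_mul, map_pow, eval_linearForm, eval_tensorForm, map_mul, map_pow]
  have hint : ∀ I, Integrable (fun u => Complex.normSq (MvPolynomial.eval (firstCol u) (q I)))
      (haarU d) := fun I =>
    integrable_haarU (Complex.continuous_normSq.comp (continuous_eval_firstCol _))
  have hint' : ∀ I, Integrable (fun u => Complex.normSq (star t ⬝ᵥ firstCol u) *
      Complex.normSq (MvPolynomial.eval (firstCol u) (q I))) (haarU d) := fun I =>
    integrable_haarU ((Complex.continuous_normSq.comp
      (continuous_const.dotProduct continuous_firstCol)).mul
        (Complex.continuous_normSq.comp (continuous_eval_firstCol _)))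
  have h1 : ∀ u : U d, Complex.normSq (star s ⬝ᵥ firstCol u) ^ k *
      (Complex.normSq (star t ⬝ᵥ firstCol u) *
        ∑ I, Complex.normSq (C I ⬝ᵥ powVec N (firstCol u))) =
      ∑ I, Complex.normSq (star t ⬝ᵥ firstCol u) *
        Complex.normSq (MvPolynomial.eval (firstCol u) (q I)) := fun u => by
    simp only [hqe, Finset.mul_sum]
    exact Finset.sum_congr rfl fun I _ => by ring
  have h2 : ∀ u : U d, Complex.normSq (star s ⬝ᵥ firstCol u) ^ k *
        ∑ I, Complex.normSq (C I ⬝ᵥ powVec N (firstCol u)) =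
      ∑ I, Complex.normSq (MvPolynomial.eval (firstCol u) (q I)) := fun u => by
    simp only [hqe, Finset.mul_sum]
  simp only [h1, h2]
  rw [integral_finsetSum _ fun I _ => hint I, integral_finsetSum _ fun I _ => hint' I,
    Finset.mul_sum]
  refine Finset.sum_le_sum fun I _ => ?_
  have := integral_normSq_mul_normSq_le (hqh I) ht
  push_cast at this
  exact this

/-- The first vector of a basis, as a pure state. -/
def firstState (u : U d) : PureState d := ⟨basisProjector u 0, basisProjector_isPureState u 0⟩

theorem firstState_eq (u : U d) :
    (firstState u).1 = Matrix.vecMulVec (firstCol u) (star (firstCol u)) := rfl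

theorem continuous_firstState : Continuous (firstState : U d → PureState d) :=
  (continuous_basisProjector 0).subtype_mk _

end

/-! ### Averaging the fidelity over outcomes and states -/

section

variable {d N : ℕ} {X : Type*} [MeasurableSpace X] (M : POVM X (Fin N → Fin d))

theorem isProbabilityMeasure_law_tensorPower (φ : PureState d) :
    IsProbabilityMeasure (M.law (tensorPower N φ.1) (tensorPower_posSemidef φ.2.1)) := by
  refine ⟨?_⟩
  rw [M.law_apply _ _ MeasurableSet.univ, M.univ_eq_one, Matrix.mul_one, tensorPower,
    trace_tensorProd, Finset.prod_eq_one fun _ _ => φ.2.2.1]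
  simp

theorem measurable_trace_mul_density :
    Measurable fun y : PureState d × X => (tensorPower N y.1.1 * M.density y.2).trace.re := by
  simp only [Matrix.trace, Matrix.diag_apply, Matrix.mul_apply, tensorPower, tensorProd,
    Matrix.of_apply]
  exact Complex.measurable_re.comp (Finset.measurable_sum _ fun I _ =>
    Finset.measurable_sum _ fun J _ => (Finset.measurable_prod _ fun k _ =>
      (measurable_pureState_apply _ _).comp measurable_fst).mul
        ((M.measurable_density J I).comp measurable_snd))

theorem measurable_ofReal_trace_mul_density (φ : PureState d) :
    Measurable fun x => ENNReal.ofReal (tensorPower N φ.1 * M.density x).trace.re :=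
  ((measurable_trace_mul_density M).comp (measurable_prodMk_left (x := φ))).ennreal_ofReal

variable {est : X → PureState d}

theorem measurable_trace_est_mul (hest : Measurable est) :
    Measurable fun y : PureState d × X => ((est y.2).1 * y.1.1).trace.re := by
  simp only [Matrix.trace, Matrix.diag_apply, Matrix.mul_apply]
  exact Complex.measurable_re.comp (Finset.measurable_sum _ fun I _ =>
    Finset.measurable_sum _ fun J _ =>
      ((measurable_pureState_apply _ _).comp (hest.comp measurable_snd)).mul
        ((measurable_pureState_apply _ _).comp measurable_fst))

theorem meanFidelity_eq (φ : PureState d) :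
    meanFidelity M est φ = ∫ x, ((est x).1 * φ.1).trace.re *
      (tensorPower N φ.1 * M.density x).trace.re ∂M.traceMeasure := by
  rw [meanFidelity, M.law_eq_withDensity, integral_withDensity_eq_integral_toReal_smul
    (measurable_ofReal_trace_mul_density M φ)
    (Filter.Eventually.of_forall fun _ => ENNReal.ofReal_lt_top)]
  refine integral_congr_ae ?_
  filter_upwards [M.density_posSemidef] with x hx
  rw [ENNReal.toReal_ofReal (POVM.trace_mul_re_nonneg (tensorPower_posSemidef φ.2.1) hx),
    fidelity_eq (est x).2 φ.2, smul_eq_mul, mul_comm]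

theorem integral_trace_mul_density (φ : PureState d) :
    ∫ x, (tensorPower N φ.1 * M.density x).trace.re ∂M.traceMeasure = 1 := by
  have h := (isProbabilityMeasure_law_tensorPower M φ).measure_univ
  have h1 : ∫ _, (1 : ℝ) ∂M.law (tensorPower N φ.1) (tensorPower_posSemidef φ.2.1) = 1 := by
    simp [Measure.real, h]
  rw [← h1, M.law_eq_withDensity, integral_withDensity_eq_integral_toReal_smul
    (measurable_ofReal_trace_mul_density M φ)
    (Filter.Eventually.of_forall fun _ => ENNReal.ofReal_lt_top)]
  refine integral_congr_ae ?_
  filter_upwards [M.density_posSemidef] with x hx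
  rw [ENNReal.toReal_ofReal (POVM.trace_mul_re_nonneg (tensorPower_posSemidef φ.2.1) hx),
    smul_eq_mul, mul_one]

theorem fidelity_nonneg (σ ρ : Matrix (Fin d) (Fin d) ℂ) : 0 ≤ fidelity σ ρ := sq_nonneg _

theorem meanFidelity_nonneg (φ : PureState d) : 0 ≤ meanFidelity M est φ :=
  integral_nonneg fun _ => fidelity_nonneg _ _

theorem meanFidelity_le_one (φ : PureState d) : meanFidelity M est φ ≤ 1 := by
  have := isProbabilityMeasure_law_tensorPower M φ
  have h := integral_mono_of_nonneg
    (μ := M.law (tensorPower N φ.1) (tensorPower_posSemidef φ.2.1))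
    (f := fun x => fidelity (est x).1 φ.1) (g := fun _ => 1)
    (Filter.Eventually.of_forall fun _ => fidelity_nonneg _ _) (integrable_const _)
    (Filter.Eventually.of_forall fun x => by
      simp only [fidelity_eq (est x).2 φ.2]
      exact (est x).2.trace_mul_re_le_one φ.2)
  simpa [meanFidelity] using h

theorem measurable_meanFidelity (hest : Measurable est) : Measurable (meanFidelity M est) := by
  have h : meanFidelity M est = fun φ => ∫ x, ((est x).1 * φ.1).trace.re *
      (tensorPower N φ.1 * M.density x).trace.re ∂M.traceMeasure := funext fun φ =>
    meanFidelity_eq M φ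
  rw [h]
  exact (StronglyMeasurable.integral_prod_right'
    ((measurable_trace_est_mul hest).mul (measurable_trace_mul_density M)).stronglyMeasurable).measurable

/-- The mean fidelity, averaged with weight `|⟨s, z⟩|^{2k}` over the pure states `z`. -/
theorem integral_pow_mul_meanFidelity_le [NeZero d] (hest : Measurable est) {s : Fin d → ℂ} (hs : star s ⬝ᵥ s = 1)
    (k : ℕ) :
    ∫ u, Complex.normSq (star s ⬝ᵥ firstCol u) ^ k * meanFidelity M est (firstState u) ∂haarU d ≤
      ((N : ℝ) + k + 1) / (N + k + d) * sphereMoment d k := by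
  have hfs : Measurable (firstState : U d → PureState d) := continuous_firstState.measurable
  have hw : Continuous fun u : U d => Complex.normSq (star s ⬝ᵥ firstCol u) ^ k :=
    (Complex.continuous_normSq.comp (continuous_const.dotProduct continuous_firstCol)).pow k
  have hI1 : Integrable (fun y : U d × X => Complex.normSq (star s ⬝ᵥ firstCol y.1) ^ k *
      (tensorPower N (firstState y.1).1 * M.density y.2).trace.re)
      ((haarU d).prod M.traceMeasure) := by
    have h0 : ∀ I J, Integrable (fun y : U d × X =>
        ((Complex.normSq (star s ⬝ᵥ firstCol y.1) ^ k : ℝ) : ℂ) *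
          tensorPower N (firstState y.1).1 I J * M.density y.2 J I)
        ((haarU d).prod M.traceMeasure) := fun I J =>
      Integrable.mul_prod (f := fun u : U d => ((Complex.normSq (star s ⬝ᵥ firstCol u) ^ k : ℝ) : ℂ) *
          tensorPower N (firstState u).1 I J) (g := fun x => M.density x J I)
        (integrable_haarU ((Complex.continuous_ofReal.comp hw).mul
          (show Continuous fun u : U d => ∏ l, (firstState u).1 (I l) (J l) from
            continuous_finsetProd _ fun l _ =>
              (continuous_basisProjector 0).matrix_elem (I l) (J l)))) (M.integrable_density J I)
    have h1 := (integrable_finsetSum Finset.univ fun I _ =>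
      integrable_finsetSum Finset.univ fun J _ => h0 I J).re
    refine h1.congr (Filter.Eventually.of_forall fun y => ?_)
    simp only [Matrix.trace, Matrix.diag_apply, Matrix.mul_apply, mul_assoc, ← Finset.mul_sum]
    exact Complex.re_ofReal_mul _ _
  have hI2 : Integrable (fun y : U d × X => Complex.normSq (star s ⬝ᵥ firstCol y.1) ^ k *
      (((est y.2).1 * (firstState y.1).1).trace.re *
      (tensorPower N (firstState y.1).1 * M.density y.2).trace.re))
      ((haarU d).prod M.traceMeasure) := by
    have h1 := hI1.bdd_mul (c := 1) (f := fun y : U d × X =>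
        ((est y.2).1 * (firstState y.1).1).trace.re)
      ((measurable_trace_est_mul hest).comp
        ((hfs.comp measurable_fst).prodMk measurable_snd)).aestronglyMeasurable
      (Filter.Eventually.of_forall fun y => by
        rw [Real.norm_of_nonneg ((est y.2).2.trace_mul_re_nonneg (firstState y.1).2)]
        exact (est y.2).2.trace_mul_re_le_one (firstState y.1).2)
    refine h1.congr (Filter.Eventually.of_forall fun y => ?_)
    simp only
    ring
  calc ∫ u, Complex.normSq (star s ⬝ᵥ firstCol u) ^ k * meanFidelity M est (firstState u) ∂haarU d
      = ∫ u, ∫ x, Complex.normSq (star s ⬝ᵥ firstCol u) ^ k *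
          (((est x).1 * (firstState u).1).trace.re *
            (tensorPower N (firstState u).1 * M.density x).trace.re) ∂M.traceMeasure ∂haarU d := by
        simp only [meanFidelity_eq, integral_const_mul]
    _ = ∫ x, ∫ u, Complex.normSq (star s ⬝ᵥ firstCol u) ^ k *
          (((est x).1 * (firstState u).1).trace.re *
            (tensorPower N (firstState u).1 * M.density x).trace.re) ∂haarU d ∂M.traceMeasure :=
        integral_integral_swap hI2
    _ ≤ ∫ x, ((N : ℝ) + k + 1) / (N + k + d) *
          ∫ u, Complex.normSq (star s ⬝ᵥ firstCol u) ^ k *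
            (tensorPower N (firstState u).1 * M.density x).trace.re ∂haarU d ∂M.traceMeasure := by
        refine integral_mono_ae hI2.integral_prod_right (hI1.integral_prod_right.const_mul _) ?_
        filter_upwards [M.density_posSemidef] with x hx
        -- After the exchange of integrals the outcome is fixed, so the estimate is one fixed
        -- direction t, however the estimator was chosen.
        obtain ⟨t, ht, hσ⟩ := (est x).2.exists_vector
        have := integral_overlap_mul_normSq_le hx ht k (s := s)
        simp only [firstState_eq, hσ, trace_vecMulVec_mul_vecMulVec, tensorPower_vecMulVec,
          Complex.ofReal_re]
        simpa only [trace_vecMulVec_mul] using this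
    _ = ((N : ℝ) + k + 1) / (N + k + d) * ∫ u, ∫ x, Complex.normSq (star s ⬝ᵥ firstCol u) ^ k *
            (tensorPower N (firstState u).1 * M.density x).trace.re ∂M.traceMeasure ∂haarU d := by
        rw [integral_const_mul]
        exact congrArg _ (integral_integral_swap hI1).symm
    _ = _ := by
        simp only [integral_const_mul, integral_trace_mul_density, mul_one]
        rw [integral_normSq_pow hs]

end

/-! ### The asymptotic Bayesian lower bound -/

section

variable {d : ℕ} [NeZero d]

theorem integral_prior {f : PureState d → ℝ} (hf : Continuous f) (h0 : ∀ φ, 0 ≤ f φ)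
    {F : PureState d → ℝ} (hF : Measurable F) :
    ∫ φ, F φ ∂prior f = ∫ u, f (firstState u) * F (firstState u) ∂haarU d := by
  rw [prior, integral_withDensity_eq_integral_toReal_smul hf.measurable.ennreal_ofReal
    (Filter.Eventually.of_forall fun _ => ENNReal.ofReal_lt_top)]
  simp only [ENNReal.toReal_ofReal (h0 _), smul_eq_mul]
  exact integral_map (φ := firstState) continuous_firstState.measurable.aemeasurable
    (hf.measurable.mul hF).aestronglyMeasurable

/-- The overlap of the first vectors of two bases. -/
def overlap (a u : U d) : ℝ := Complex.normSq (star (firstCol a) ⬝ᵥ firstCol u)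

theorem overlap_comm (a u : U d) : overlap a u = overlap u a := by
  rw [overlap, star_dotProduct_comm, Complex.star_def, Complex.normSq_conj, overlap]

theorem overlap_eq (a u : U d) : overlap a u = ((firstState a).1 * (firstState u).1).trace.re := by
  rw [firstState_eq, firstState_eq, trace_vecMulVec_mul_vecMulVec, Complex.ofReal_re, overlap]

theorem overlap_nonneg (a u : U d) : 0 ≤ overlap a u := Complex.normSq_nonneg _

theorem overlap_le_one (a u : U d) : overlap a u ≤ 1 :=
  (overlap_eq a u).trans_le ((firstState a).2.trace_mul_re_le_one (firstState u).2)

theorem continuous_overlap : Continuous fun p : U d × U d => overlap p.1 p.2 :=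
  Complex.continuous_normSq.comp (((continuous_firstCol.comp continuous_fst).star).dotProduct
    (continuous_firstCol.comp continuous_snd))

theorem continuous_overlap_right (a : U d) : Continuous (overlap a) :=
  Complex.continuous_normSq.comp (continuous_const.dotProduct continuous_firstCol)

theorem integral_overlap_pow_left (u : U d) (k : ℕ) :
    ∫ a, overlap a u ^ k ∂haarU d = sphereMoment d k := by
  simp only [overlap_comm _ u]
  exact integral_normSq_pow (star_firstCol_dotProduct_self u) k

theorem firstState_eq_of_overlap_eq_one {a u : U d} (h : overlap a u = 1) :
    firstState a = firstState u :=
  Subtype.ext ((firstState a).2.eq_of_trace_mul_re_eq_one (firstState u).2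
    ((overlap_eq a u).symm.trans h))

/-- High powers of the overlap localize: a continuous function, lowered by `ε`, is below its value
at a nearby state, and far away the power is exponentially small. -/
theorem exists_max_mul_overlap_pow_le {f : PureState d → ℝ} (hf : Continuous f)
    (h0 : ∀ φ, 0 ≤ f φ) {ε : ℝ} (hε : 0 < ε) :
    ∃ B r : ℝ, 0 ≤ B ∧ 0 ≤ r ∧ r < 1 ∧ ∀ (a u : U d) (k : ℕ),
      max (f (firstState a) - ε) 0 * overlap a u ^ k ≤
        f (firstState u) * overlap a u ^ k + B * r ^ k := by
  have hfc : Continuous fun u : U d => f (firstState u) := hf.comp continuous_firstState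
  obtain ⟨B, hB⟩ := isCompact_univ.exists_bound_of_continuousOn
    ((hfc.sub continuous_const).max continuous_const : Continuous fun a : U d =>
      max (f (firstState a) - ε) 0).continuousOn
  have hB0 : 0 ≤ B := (norm_nonneg _).trans (hB 1 (Set.mem_univ _))
  have hB' : ∀ a : U d, max (f (firstState a) - ε) 0 ≤ B := fun a =>
    (le_abs_self _).trans (hB a (Set.mem_univ _))
  -- On this compact set the values of f differ by at least ε, so the two states differ and the
  -- overlap stays away from 1; its maximum over the set is r.
  set K : Set (U d × U d) := {p | f (firstState p.2) ≤ f (firstState p.1) - ε} with hK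
  have hKc : IsCompact K := (isClosed_le (hfc.comp continuous_snd)
    ((hfc.comp continuous_fst).sub continuous_const)).isCompact
  obtain ⟨r, hr0, hr1, hr⟩ : ∃ r : ℝ, 0 ≤ r ∧ r < 1 ∧ ∀ p ∈ K, overlap p.1 p.2 ≤ r := by
    rcases K.eq_empty_or_nonempty with hKe | hKn
    · exact ⟨0, le_rfl, one_pos, by simp [hKe]⟩
    · obtain ⟨p, hp, hmax⟩ := hKc.exists_isMaxOn hKn continuous_overlap.continuousOn
      refine ⟨overlap p.1 p.2, overlap_nonneg _ _, lt_of_le_of_ne (overlap_le_one _ _) fun h => ?_,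
        fun q hq => hmax hq⟩
      have h1 : f (firstState p.2) ≤ f (firstState p.1) - ε := hp
      rw [firstState_eq_of_overlap_eq_one h] at h1
      linarith
  refine ⟨B, r, hB0, hr0, hr1, fun a u k => ?_⟩
  have hp := pow_nonneg (overlap_nonneg a u) k
  by_cases hau : (a, u) ∈ K
  · have h1 : overlap a u ^ k ≤ r ^ k := pow_le_pow_left₀ (overlap_nonneg _ _) (hr _ hau) k
    have h2 : max (f (firstState a) - ε) 0 * overlap a u ^ k ≤ B * r ^ k :=
      mul_le_mul (hB' a) h1 hp hB0
    have h3 := mul_nonneg (h0 (firstState u)) hp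
    linarith
  · have h1 : max (f (firstState a) - ε) 0 ≤ f (firstState u) :=
      max_le (not_le.1 hau).le (h0 _)
    have h2 := mul_le_mul_of_nonneg_right h1 hp
    have h3 := mul_nonneg hB0 (pow_nonneg hr0 k)
    linarith

/-- As a prior, the k-th power of the overlap acts like k additional copies: the relative loss is at
least 1 - (N + k + 1)/(N + k + d). -/
theorem integral_overlap_pow_mul_loss_ge {N : ℕ} {X : Type*} [MeasurableSpace X]
    (M : POVM X (Fin N → Fin d)) {est : X → PureState d} (hest : Measurable est) (a : U d) (k : ℕ) :
    sphereMoment d k * (((d : ℝ) - 1) / (N + k + d)) ≤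
      ∫ u, overlap a u ^ k * (1 - meanFidelity M est (firstState u)) ∂haarU d := by
  have hd : (0 : ℝ) < d := by exact_mod_cast NeZero.pos d
  have hw : Integrable (fun u => overlap a u ^ k) (haarU d) :=
    integrable_haarU ((continuous_overlap_right a).pow k)
  have hF : Integrable (fun u => overlap a u ^ k * meanFidelity M est (firstState u)) (haarU d) :=
    hw.mul_bdd (c := 1) ((measurable_meanFidelity M hest).comp
      continuous_firstState.measurable).aestronglyMeasurable
      (Filter.Eventually.of_forall fun u => by
        rw [Real.norm_of_nonneg (meanFidelity_nonneg M _)]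
        exact meanFidelity_le_one M _)
  have h1 := integral_pow_mul_meanFidelity_le M hest (star_firstCol_dotProduct_self a) k
  have h2 : ∫ u, overlap a u ^ k ∂haarU d = sphereMoment d k :=
    integral_normSq_pow (star_firstCol_dotProduct_self a) k
  simp only [mul_sub, mul_one]
  rw [integral_sub hw hF, h2]
  have h3 : ((d : ℝ) - 1) / (N + k + d) = 1 - ((N : ℝ) + k + 1) / (N + k + d) := by
    field_simp
    ring
  rw [h3, mul_sub, mul_one, mul_comm (sphereMoment d k) (_ / _)]
  exact sub_le_sub_left h1 _

theorem measurable_loss {N : ℕ} {X : Type*} [MeasurableSpace X] (M : POVM X (Fin N → Fin d))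
    {est : X → PureState d} (hest : Measurable est) :
    Measurable fun u => 1 - meanFidelity M est (firstState u) :=
  measurable_const.sub ((measurable_meanFidelity M hest).comp continuous_firstState.measurable)

/-- The Bayesian lower bound for a fixed number of copies. -/
theorem mul_sub_le_integral_loss {f : PureState d → ℝ} (hf : Continuous f)
    (h1 : ∫ u, f (firstState u) ∂haarU d = 1) {ε B r : ℝ} (hB : 0 ≤ B) (hr : 0 ≤ r)
    {k : ℕ} (hBr : ∀ a u : U d, max (f (firstState a) - ε) 0 * overlap a u ^ k ≤
        f (firstState u) * overlap a u ^ k + B * r ^ k)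
    {N : ℕ} {X : Type*} [MeasurableSpace X]
    (M : POVM X (Fin N → Fin d)) {est : X → PureState d} (hest : Measurable est) :
    ((d : ℝ) - 1) / (N + k + d) * (1 - ε) - B * ((k : ℝ) + 1) ^ (d - 1) * r ^ k ≤
      ∫ u, f (firstState u) * (1 - meanFidelity M est (firstState u)) ∂haarU d := by
  set L : U d → ℝ := fun u => 1 - meanFidelity M est (firstState u) with hL
  have hLm : Measurable L := measurable_loss M hest
  have hL0 : ∀ u, 0 ≤ L u := fun u => sub_nonneg.2 (meanFidelity_le_one M _)
  have hL1 : ∀ u, L u ≤ 1 := fun u => sub_le_self _ (meanFidelity_nonneg M _)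
  have hLb : ∀ u, ‖L u‖ ≤ 1 := fun u => by rw [Real.norm_of_nonneg (hL0 u)]; exact hL1 u
  have hfc : Continuous fun u : U d => f (firstState u) := hf.comp continuous_firstState
  set h : U d → ℝ := fun a => max (f (firstState a) - ε) 0 with hh
  have hhc : Continuous h := (hfc.sub continuous_const).max continuous_const
  have hd1 : (0 : ℝ) ≤ (d : ℝ) - 1 := by
    have : (1 : ℝ) ≤ d := by exact_mod_cast NeZero.one_le
    linarith
  set w := sphereMoment d k with hw
  have hwpos : 0 < w := sphereMoment_pos k
  set c := ((d : ℝ) - 1) / (N + k + d) with hc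
  have hc0 : 0 ≤ c := by positivity
  have hfL : Integrable (fun u => f (firstState u) * L u) (haarU d) :=
    (integrable_haarU hfc).mul_bdd (c := 1) hLm.aestronglyMeasurable
      (Filter.Eventually.of_forall hLb)
  have hLi : Integrable L (haarU d) :=
    Integrable.of_bound hLm.aestronglyMeasurable 1 (Filter.Eventually.of_forall hLb)
  have hprod : Integrable (Function.uncurry fun a u => h a * overlap a u ^ k * L u)
      ((haarU d).prod (haarU d)) := by
    have hcont : Continuous fun p : U d × U d => h p.1 * overlap p.1 p.2 ^ k :=
      (hhc.comp continuous_fst).mul (continuous_overlap.pow k)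
    exact (hcont.integrable_of_hasCompactSupport (HasCompactSupport.of_compactSpace _)).mul_bdd
      (c := 1) (hLm.comp measurable_snd).aestronglyMeasurable
      (Filter.Eventually.of_forall fun p => hLb p.2)
  -- Mix the bounds for the priors concentrated around a with weight h(a), whose total mass is at
  -- least 1 - ε.
  have hlow : w * (c * (1 - ε)) ≤ ∫ a, ∫ u, h a * overlap a u ^ k * L u ∂haarU d ∂haarU d := by
    have h2 : 1 - ε ≤ ∫ a, h a ∂haarU d := by
      have h3 : ∫ a, (f (firstState a) - ε) ∂haarU d = 1 - ε := by
        rw [integral_sub (integrable_haarU hfc) (integrable_const _), h1]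
        simp
      rw [← h3]
      exact integral_mono (integrable_haarU (hfc.sub continuous_const)) (integrable_haarU hhc)
        fun a => le_max_left _ _
    calc w * (c * (1 - ε)) ≤ w * (c * ∫ a, h a ∂haarU d) := by gcongr
      _ = ∫ a, h a * (w * c) ∂haarU d := by rw [integral_mul_const]; ring
      _ ≤ _ := by
        refine integral_mono ((integrable_haarU hhc).mul_const _) hprod.integral_prod_left
          fun a => ?_
        simp only [mul_assoc, integral_const_mul]
        exact mul_le_mul_of_nonneg_left (integral_overlap_pow_mul_loss_ge M hest a k)
          (le_max_right _ _)
  -- Integrating over a first, localization replaces h(a) by f(u) and the overlap integrates to the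
  -- moment w, independently of u.
  have hup : ∫ a, ∫ u, h a * overlap a u ^ k * L u ∂haarU d ∂haarU d ≤
      w * (∫ u, f (firstState u) * L u ∂haarU d) + B * r ^ k := by
    rw [integral_integral_swap hprod]
    have hBr0 : 0 ≤ B * r ^ k := mul_nonneg hB (pow_nonneg hr k)
    calc _ ≤ ∫ u, (w * (f (firstState u) * L u) + B * r ^ k * L u) ∂haarU d := by
          refine integral_mono hprod.integral_prod_right
            ((hfL.const_mul w).add (hLi.const_mul (B * r ^ k))) fun u => ?_
          have hov : Integrable (fun a => overlap a u ^ k) (haarU d) :=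
            integrable_haarU ((continuous_overlap.comp
              (continuous_id.prodMk continuous_const)).pow k)
          have h4 : ∫ a, h a * overlap a u ^ k ∂haarU d ≤ f (firstState u) * w + B * r ^ k := by
            rw [hw, ← integral_overlap_pow_left u k, ← integral_const_mul]
            have h5 : ∫ _ : U d, B * r ^ k ∂haarU d = B * r ^ k := by simp
            rw [← h5, ← integral_add (hov.const_mul _) (integrable_const _)]
            exact integral_mono (integrable_haarU (hhc.mul ((continuous_overlap.comp
              (continuous_id.prodMk continuous_const)).pow k)))
              ((hov.const_mul _).add (integrable_const _)) fun a => hBr a u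
          simp only [integral_mul_const]
          refine (mul_le_mul_of_nonneg_right h4 (hL0 u)).trans_eq ?_
          ring
      _ = w * (∫ u, f (firstState u) * L u ∂haarU d) + B * r ^ k * ∫ u, L u ∂haarU d := by
          rw [integral_add (hfL.const_mul w) (hLi.const_mul _), integral_const_mul,
            integral_const_mul]
      _ ≤ _ := by
          have h6 : ∫ u, L u ∂haarU d ≤ 1 := by
            have := integral_mono hLi (integrable_const (1 : ℝ)) hL1
            simpa using this
          have := mul_le_mul_of_nonneg_left h6 hBr0
          linarith
  -- Prepares the division by w, which costs the error term only a factor polynomial in k.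
  have h7 : B * r ^ k ≤ w * (B * ((k : ℝ) + 1) ^ (d - 1) * r ^ k) := by
    have := mul_le_mul_of_nonneg_left (one_le_sphereMoment_mul (d := d) k)
      (mul_nonneg hB (pow_nonneg hr k))
    rw [mul_one] at this
    refine this.trans_eq ?_
    ring
  have h8 : w * (c * (1 - ε) - B * ((k : ℝ) + 1) ^ (d - 1) * r ^ k) ≤
      w * ∫ u, f (firstState u) * L u ∂haarU d := by
    rw [mul_sub]
    linarith
  exact le_of_mul_le_mul_left h8 hwpos

end

/-! ### Limits for the choice k = ⌊√N⌋ -/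

theorem tendsto_sq_div (d : ℕ) :
    Filter.Tendsto (fun k : ℕ => (k : ℝ) ^ 2 / (k ^ 2 + k + d)) Filter.atTop (nhds 1) := by
  have h1 : Filter.Tendsto (fun k : ℕ => (k : ℝ)⁻¹) Filter.atTop (nhds 0) :=
    tendsto_inv_atTop_zero.comp tendsto_natCast_atTop_atTop
  have h2 : Filter.Tendsto (fun k : ℕ => (1 + (k : ℝ)⁻¹ + d * ((k : ℝ)⁻¹ * (k : ℝ)⁻¹))⁻¹)
      Filter.atTop (nhds 1) := by
    have := (((h1.const_add 1).add ((h1.mul h1).const_mul (d : ℝ))).inv₀ (by simp))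
    simpa using this
  refine h2.congr' ?_
  filter_upwards [Filter.eventually_gt_atTop 0] with k hk
  have : (0 : ℝ) < k := by exact_mod_cast hk
  field_simp

theorem tendsto_add_one_pow_mul_pow {r : ℝ} (hr : 0 ≤ r) (hr1 : r < 1) (m : ℕ) :
    Filter.Tendsto (fun k : ℕ => ((k : ℝ) + 1) ^ m * r ^ k) Filter.atTop (nhds 0) := by
  rcases hr.eq_or_lt with rfl | hr0
  · refine tendsto_const_nhds.congr' ?_
    filter_upwards [Filter.eventually_gt_atTop 0] with k hk
    rw [zero_pow hk.ne', mul_zero]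
  · have h := ((tendsto_pow_const_mul_const_pow_of_lt_one m hr hr1).comp
      (Filter.tendsto_add_atTop_nat 1)).const_mul r⁻¹
    rw [mul_zero] at h
    refine h.congr fun k => ?_
    simp only [Function.comp_apply, pow_succ, Nat.cast_add, Nat.cast_one]
    field_simp

theorem tendsto_natSqrt_atTop : Filter.Tendsto Nat.sqrt Filter.atTop Filter.atTop :=
  Filter.tendsto_atTop.2 fun b => by
    filter_upwards [Filter.eventually_ge_atTop (b * b)] with n hn
    exact Nat.le_sqrt.2 hn

/-- The number k of virtual copies must satisfy k/N → 0, to keep the leading term (d - 1)/N, yet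
grow fast enough for N(k + 1)^{d-1} r^k → 0. The choice k = ⌊√N⌋ does both; ε is fixed beforehand
according to the number below d - 1 that is to be reached. -/
theorem bayes_lower_bound {d : ℕ} [NeZero d] (f : PureState d → ℝ) (hf : Continuous f)
    (h0 : ∀ φ, 0 ≤ f φ) (hprob : IsProbabilityMeasure (prior f)) (X : ℕ → Type u)
    [∀ N, MeasurableSpace (X N)] (M : ∀ N, POVM (X N) (Fin N → Fin d))
    (est : ∀ N, X N → PureState d) (hest : ∀ N, Measurable (est N)) :
    (((d : ℝ) - 1 : ℝ) : EReal) ≤ Filter.liminf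
      (fun N : ℕ => (((N : ℝ) * (1 - ∫ φ, meanFidelity (M N) (est N) φ ∂prior f) : ℝ) : EReal))
      Filter.atTop := by
  have hfc : Continuous fun u : U d => f (firstState u) := hf.comp continuous_firstState
  have h1 : ∫ u, f (firstState u) ∂haarU d = 1 := by
    have := integral_prior hf h0 (measurable_const (a := (1 : ℝ)))
    simpa using this.symm
  have hloss : ∀ N, 1 - ∫ φ, meanFidelity (M N) (est N) φ ∂prior f =
      ∫ u, f (firstState u) * (1 - meanFidelity (M N) (est N) (firstState u)) ∂haarU d := by
    intro N
    rw [integral_prior hf h0 (measurable_meanFidelity (M N) (hest N))]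
    simp only [mul_sub, mul_one]
    rw [integral_sub (integrable_haarU hfc) ?_, h1]
    exact (integrable_haarU hfc).mul_bdd (c := 1) ((measurable_meanFidelity (M N) (hest N)).comp
      continuous_firstState.measurable).aestronglyMeasurable
      (Filter.Eventually.of_forall fun u => by
        rw [Real.norm_of_nonneg (meanFidelity_nonneg _ _)]
        exact meanFidelity_le_one _ _)
  have hd1 : (0 : ℝ) ≤ (d : ℝ) - 1 := by
    have : (1 : ℝ) ≤ d := by exact_mod_cast NeZero.one_le
    linarith
  refine le_of_forall_lt fun c hc => ?_
  obtain ⟨c', hcc', hc'⟩ := EReal.lt_iff_exists_real_btwn.1 hc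
  have hc'' : c' < (d : ℝ) - 1 := EReal.coe_lt_coe_iff.1 hc'
  obtain ⟨ε, hε, hε1, hεc⟩ : ∃ ε : ℝ, 0 < ε ∧ ε ≤ 1 ∧ c' < ((d : ℝ) - 1) * (1 - ε) := by
    have ht : Filter.Tendsto (fun ε : ℝ => ((d : ℝ) - 1) * (1 - ε)) (nhdsWithin 0 (Set.Ioi 0))
        (nhds ((d : ℝ) - 1)) := by
      have : Continuous fun ε : ℝ => ((d : ℝ) - 1) * (1 - ε) := by fun_prop
      have h2 := this.tendsto 0
      rw [sub_zero, mul_one] at h2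
      exact h2.mono_left nhdsWithin_le_nhds
    have h3 := ht.eventually_const_lt hc''
    have h4 : ∀ᶠ ε : ℝ in nhdsWithin 0 (Set.Ioi 0), ε ∈ Set.Ioc (0 : ℝ) 1 :=
      Ioc_mem_nhdsGT one_pos
    obtain ⟨ε, h5, h6⟩ := (h3.and h4).exists
    exact ⟨ε, h6.1, h6.2, h5⟩
  obtain ⟨B, r, hB, hr, hr1, hBr⟩ := exists_max_mul_overlap_pow_le hf h0 hε
  -- The bound is phrased in k alone: k² ≤ N serves in the main term, and N ≤ (k + 1)² raises the
  -- exponent of the error by 2.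
  have hlim : Filter.Tendsto (fun k : ℕ => ((d : ℝ) - 1) * (1 - ε) *
      ((k : ℝ) ^ 2 / (k ^ 2 + k + d)) - B * (((k : ℝ) + 1) ^ (d - 1 + 2) * r ^ k)) Filter.atTop
      (nhds (((d : ℝ) - 1) * (1 - ε))) := by
    have := ((tendsto_sq_div d).const_mul (((d : ℝ) - 1) * (1 - ε))).sub
      ((tendsto_add_one_pow_mul_pow hr hr1 (d - 1 + 2)).const_mul B)
    simpa using this
  refine hcc'.trans_le (Filter.le_liminf_of_le (by isBoundedDefault) ?_)
  filter_upwards [(hlim.comp tendsto_natSqrt_atTop).eventually_const_lt hεc] with N hN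
  refine EReal.coe_le_coe_iff.2 (hN.le.trans ?_)
  rw [hloss]
  refine le_trans ?_ (mul_le_mul_of_nonneg_left (mul_sub_le_integral_loss hf h1 hB hr
    (fun a u => hBr a u N.sqrt) (M N) (hest N)) N.cast_nonneg)
  simp only [Function.comp_apply]
  set k := N.sqrt with hk
  have hk1 : (k : ℝ) ^ 2 ≤ N := by exact_mod_cast Nat.sqrt_le' N
  have hk2 : (N : ℝ) ≤ ((k : ℝ) + 1) ^ 2 := by exact_mod_cast (Nat.lt_succ_sqrt' N).le
  have hd : (0 : ℝ) < d := by exact_mod_cast NeZero.pos d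
  have h2 : (k : ℝ) ^ 2 / (k ^ 2 + k + d) ≤ N / (N + k + d) := by
    rw [div_le_div_iff₀ (by positivity) (by positivity)]
    have : (k : ℝ) ^ 2 * (k + d) ≤ N * (k + d) := by gcongr
    linarith
  have h3 : ((d : ℝ) - 1) * (1 - ε) * ((k : ℝ) ^ 2 / (k ^ 2 + k + d)) ≤
      N * (((d : ℝ) - 1) / (N + k + d) * (1 - ε)) := by
    refine (mul_le_mul_of_nonneg_left h2 (mul_nonneg hd1 (sub_nonneg.2 hε1))).trans_eq ?_
    ring
  have h4 : N * (B * ((k : ℝ) + 1) ^ (d - 1) * r ^ k) ≤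
      B * (((k : ℝ) + 1) ^ (d - 1 + 2) * r ^ k) := by
    have h5 : 0 ≤ B * ((k : ℝ) + 1) ^ (d - 1) * r ^ k := by positivity
    refine (mul_le_mul_of_nonneg_right hk2 h5).trans_eq ?_
    ring
  exact (sub_le_sub h3 h4).trans_eq (mul_sub _ _ _).symm

end QuantumEstimation

end

theorem mainTheorem4 (d : ℕ) [NeZero d] :
    -- the local statements, at each point of each regular parametrization of the pure states
    (∀ (Θ : Set (Fin (2 * (d - 1)) → ℝ))
      (ρ : (Fin (2 * (d - 1)) → ℝ) → Matrix (Fin d) (Fin d) ℂ),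
      IsPureStateParametrization d Θ ρ → ∀ θ ∈ Θ,
      (∃! H, IsHelstromInformation ρ θ H) ∧
      ∀ H, IsHelstromInformation ρ θ H →
        H.PosDef ∧
        -- the value of the Holevo bound for fidelity loss
        holevoBound ρ θ ((1 / 4 : ℝ) • H) = (((d : ℝ) - 1 : ℝ) : EReal) ∧
        -- it is a bound for all measurements with non-singular information
        (∀ (N : ℕ), 1 ≤ N → ∀ (X : Type u) [MeasurableSpace X] (M : POVM X (Fin N → Fin d)),
          (averageInformation M ρ θ).det ≠ 0 →
          holevoBound ρ θ ((1 / 4 : ℝ) • H) ≤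
            (((((1 / 4 : ℝ) • H) * (averageInformation M ρ θ)⁻¹).trace : ℝ) : EReal)) ∧
        -- all exhaustive covariant measurements have information `H / 2` and attain the bound
        (∀ (N : ℕ), 1 ≤ N → ∀ (X : Type u) [MeasurableSpace X] (act : U d →* Equiv.Perm X)
          (M : POVM X (Fin N → Fin d)), M.IsExhaustive → IsCovariant act M →
          averageInformation M ρ θ = (1 / 2 : ℝ) • H ∧
          (((((1 / 4 : ℝ) • H) * (averageInformation M ρ θ)⁻¹).trace : ℝ) : EReal) =
            holevoBound ρ θ ((1 / 4 : ℝ) • H)) ∧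
        -- in particular standard tomography does
        (∀ (N : ℕ), 1 ≤ N →
          (tomography d N).IsExhaustive ∧
          IsCovariant (tomographyAction d N) (tomography d N) ∧
          averageInformation (tomography d N) ρ θ = (1 / 2 : ℝ) • H ∧
          (((((1 / 4 : ℝ) • H) * (averageInformation (tomography d N) ρ θ)⁻¹).trace : ℝ) : EReal)
            = holevoBound ρ θ ((1 / 4 : ℝ) • H))) ∧
    -- the asymptotic lower bound, for every prior with a continuous density with respect to the
    -- uniform distribution, and all sequences of measurements and estimators
    (∀ f : PureState d → ℝ, Continuous f → (∀ φ, 0 ≤ f φ) →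
      MeasureTheory.IsProbabilityMeasure (prior f) →
      ∀ (X : ℕ → Type u) [∀ N, MeasurableSpace (X N)] (M : ∀ N, POVM (X N) (Fin N → Fin d))
        (est : ∀ N, X N → PureState d), (∀ N, Measurable (est N)) →
        (((d : ℝ) - 1 : ℝ) : EReal) ≤ Filter.liminf
          (fun N : ℕ => (((N : ℝ) * (1 - ∫ φ, meanFidelity (M N) (est N) φ ∂prior f) : ℝ) : EReal))
          Filter.atTop) := by
  exact ⟨fun Θ ρ h θ hθ => local_optimality h hθ, fun f hf h0 hp X _ M est hest =>
    bayes_lower_bound f hf h0 hp X M est hest⟩
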